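/- Let $(M^{2n},g,J)$ be a connected strict nearly Kähler manifold: $g$ is a smooth Riemannian metric, $J$ a smooth $g$-orthogonal almost complex structure, and, with $\nabla$ the Levi-Civita connection of $g$, $(\nabla_XJ)X=0$ for all $X$ and $\nabla_XJ\neq0$ for every tangent vector $X\neq 0$. Let $\overline\nabla_XY=\nabla_XY+\tfrac12(\nabla_XJ)JY$ be the canonical Hermitian connection. Suppose that $TM=L\oplus E$ is a $g$-orthogonal, $J$-stable, $\overline\nabla$-parallel decomposition into smooth subbundles with $L$ of real rank two (this is what a reduction of the holonomy of $\overline\nabla$ to $U(1)\times U(n-1)$ provides). Let $F$ be the endomorphism of $TM$ defined by $g(FX,Y)=-\tfrac12\operatorname{Tr}_L\big((\nabla_XJ)(\nabla_YJ)\big)$, and suppose that $F|_E$ is injective at every point. Then there is a constant $k>0$ with $F|_E=\tfrac k4\,\mathrm{Id}_E$, and for this $k$ the following holds. Let $\overline g$ be the Riemannian metric with $\overline g=g$ on $E$, $\overline g=2g$ on $L$ and $L\perp_{\overline g}E$, and let $\overline J$ be the reversed almost complex structure, $\overline J|_E=J$ and $\overline J|_L=-J$. Then $\overline g$ and $\overline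 J$ are smooth, $\overline g$ is Einstein with $\mathrm{Ric}_{\overline g}=\tfrac{(n+1)k}{4}\,\overline g$, the almost complex structure $\overline J$ is integrable (its Nijenhuis tensor vanishes), and $(M,\overline g,\overline J)$ is Hermitian with closed Kähler form $\overline g(\overline J\cdot,\cdot)$. Hence $(M,\overline g,\overline J)$ is Kähler–Einstein. -/

import Mathlib

open Bundle FiberBundle VectorField
open scoped Manifold ContDiff

noncomputable section

namespace NearlyKahler

variable {E : Type*} [NormedAddCommGroup E] [NormedSpace ℝ E]
  {M : Type*} [TopologicalSpace M] [ChartedSpace E M]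

/-! ### Vector fields and Riemannian metrics -/

variable [IsManifold 𝓘(ℝ, E) ∞ M]

/-- A (global) smooth vector field on `M`. -/
def IsSmoothField (X : Π x : M, TangentSpace 𝓘(ℝ, E) x) : Prop :=
  ContMDiff 𝓘(ℝ, E) (𝓘(ℝ, E).prod 𝓘(ℝ, E)) ∞
    (fun x ↦ (⟨x, X x⟩ : TangentBundle 𝓘(ℝ, E) M))

variable (E M) in
/-- A smooth Riemannian metric on `M`. -/
abbrev Metric : Type _ :=
  ContMDiffRiemannianMetric 𝓘(ℝ, E) ∞ E (fun x : M ↦ TangentSpace 𝓘(ℝ, E) x)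

/-- The inner product of a Riemannian metric on the tangent space at `x`, as a bilinear form. -/
def Metric.form (g : Metric E M) (x : M) : LinearMap.BilinForm ℝ (TangentSpace 𝓘(ℝ, E) x) :=
  LinearMap.mk₂ ℝ (fun v w ↦ g.inner x v w) (by simp) (by simp) (by simp) (by simp)

@[simp]
theorem Metric.form_apply (g : Metric E M) (x : M) (v w : TangentSpace 𝓘(ℝ, E) x) :
    g.form x v w = g.inner x v w := rfl

theorem Metric.form_isRefl (g : Metric E M) (x : M) : (g.form x).IsRefl := by
  intro v w h
  rw [Metric.form_apply] at h ⊢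
  rw [g.symm, h]

theorem Metric.eq_zero_of_self (g : Metric E M) {x : M} {v : TangentSpace 𝓘(ℝ, E) x}
    (h : g.inner x v v = 0) : v = 0 := by
  by_contra hv
  exact (g.pos x v hv).ne' h

theorem Metric.form_nondegenerate (g : Metric E M) (x : M) : (g.form x).Nondegenerate :=
  ⟨fun v h ↦ g.eq_zero_of_self (h v), fun v h ↦ g.eq_zero_of_self (h v)⟩

theorem Metric.ext_inner (g : Metric E M) {x : M} {v w : TangentSpace 𝓘(ℝ, E) x}
    (h : ∀ u, g.inner x v u = g.inner x w u) : v = w := by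
  rw [← sub_eq_zero]
  apply g.eq_zero_of_self
  have e := h (v - w)
  rw [← sub_eq_zero, ← sub_apply, ← map_sub] at e
  exact e

theorem Metric.mdifferentiableAt_inner (g : Metric E M) {X Y : Π x : M, TangentSpace 𝓘(ℝ, E) x}
    {x : M} (hX : MDiffAt (T% X) x) (hY : MDiffAt (T% Y) x) :
    MDiffAt (fun y ↦ g.inner y (X y) (Y y)) x := by
  have h : MDifferentiableAt 𝓘(ℝ, E) (𝓘(ℝ, E).prod 𝓘(ℝ))
      (fun y ↦ TotalSpace.mk' ℝ (E := Bundle.Trivial M ℝ) y (g.inner y (X y) (Y y))) x :=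
    MDifferentiableAt.clm_bundle_apply₂ (F₁ := E) (F₂ := E)
      (g.contMDiff.mdifferentiableAt (by simp)) hX hY
  simp only [mdifferentiableAt_totalSpace] at h
  exact h.2

variable [FiniteDimensional ℝ E]

instance tangentFiniteDimensional (x : M) : FiniteDimensional ℝ (TangentSpace 𝓘(ℝ, E) x) :=
  inferInstanceAs (FiniteDimensional ℝ E)

instance tangentT2Space (x : M) : T2Space (TangentSpace 𝓘(ℝ, E) x) :=
  inferInstanceAs (T2Space E)

/-- The vector representing a linear functional on the tangent space at `x`:
`⟨sharp φ, w⟩ = φ w`. -/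
def Metric.sharp (g : Metric E M) (x : M) :
    Module.Dual ℝ (TangentSpace 𝓘(ℝ, E) x) →ₗ[ℝ] TangentSpace 𝓘(ℝ, E) x :=
  ((g.form x).toDual (g.form_nondegenerate x)).symm.toLinearMap

theorem Metric.inner_sharp (g : Metric E M) (x : M)
    (φ : Module.Dual ℝ (TangentSpace 𝓘(ℝ, E) x)) (w : TangentSpace 𝓘(ℝ, E) x) :
    g.inner x (g.sharp x φ) w = φ w :=
  LinearMap.BilinForm.apply_toDual_symm_apply (hB := g.form_nondegenerate x) φ w

/-! ### The Levi-Civita connection -/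

/-- The right-hand side of the Koszul formula,
`X⟨Y, Z⟩ + Y⟨X, Z⟩ - Z⟨X, Y⟩ + ⟨[X, Y], Z⟩ - ⟨[X, Z], Y⟩ - ⟨[Y, Z], X⟩`. -/
def koszul (g : Metric E M) (X Y Z : Π x : M, TangentSpace 𝓘(ℝ, E) x) (x : M) : ℝ :=
  mvfderiv 𝓘(ℝ, E) (fun y ↦ g.inner y (Y y) (Z y)) x (X x)
    + mvfderiv 𝓘(ℝ, E) (fun y ↦ g.inner y (X y) (Z y)) x (Y x)
    - mvfderiv 𝓘(ℝ, E) (fun y ↦ g.inner y (X y) (Y y)) x (Z x)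
    + g.inner x (mlieBracket 𝓘(ℝ, E) X Y x) (Z x)
    - g.inner x (mlieBracket 𝓘(ℝ, E) X Z x) (Y x)
    - g.inner x (mlieBracket 𝓘(ℝ, E) Y Z x) (X x)

theorem tensorial_koszul_left (g : Metric E M) {Y Z : Π x : M, TangentSpace 𝓘(ℝ, E) x} {x : M}
    (hY : MDiffAt (T% Y) x) (hZ : MDiffAt (T% Z) x) :
    TensorialAt 𝓘(ℝ, E) E (fun X ↦ koszul g X Y Z x) x where
  smul := by
    intro f X hf hX
    have : CompleteSpace E := FiniteDimensional.complete ℝ E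
    have h1 := mvfderiv_mul hf (g.mdifferentiableAt_inner hX hZ)
    have h2 := mvfderiv_mul hf (g.mdifferentiableAt_inner hX hY)
    have e1 : (fun y ↦ g.inner y ((f • X) y) (Z y)) = f * fun y ↦ g.inner y (X y) (Z y) := by
      ext y; simp
    have e2 : (fun y ↦ g.inner y ((f • X) y) (Y y)) = f * fun y ↦ g.inner y (X y) (Y y) := by
      ext y; simp
    simp only [koszul]
    rw [e1, e2, h1, h2, mlieBracket_smul_left hf hX, mlieBracket_smul_left hf hX]
    simp
    ring
  add := by
    intro X X' hX hX'
    have : CompleteSpace E := FiniteDimensional.complete ℝ E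
    have h1 := mvfderiv_add (g.mdifferentiableAt_inner hX hZ) (g.mdifferentiableAt_inner hX' hZ)
    have h2 := mvfderiv_add (g.mdifferentiableAt_inner hX hY) (g.mdifferentiableAt_inner hX' hY)
    have e1 : (fun y ↦ g.inner y ((X + X') y) (Z y))
        = (fun y ↦ g.inner y (X y) (Z y)) + fun y ↦ g.inner y (X' y) (Z y) := by
      ext y; simp
    have e2 : (fun y ↦ g.inner y ((X + X') y) (Y y))
        = (fun y ↦ g.inner y (X y) (Y y)) + fun y ↦ g.inner y (X' y) (Y y) := by
      ext y; simp
    simp only [koszul]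
    rw [e1, e2, h1, h2, mlieBracket_add_left hX hX', mlieBracket_add_left hX hX']
    simp
    ring

theorem tensorial_koszul_right (g : Metric E M) {X Y : Π x : M, TangentSpace 𝓘(ℝ, E) x} {x : M}
    (hX : MDiffAt (T% X) x) (hY : MDiffAt (T% Y) x) :
    TensorialAt 𝓘(ℝ, E) E (fun Z ↦ koszul g X Y Z x) x where
  smul := by
    intro f Z hf hZ
    have : CompleteSpace E := FiniteDimensional.complete ℝ E
    have h1 := mvfderiv_mul hf (g.mdifferentiableAt_inner hX hZ)
    have h2 := mvfderiv_mul hf (g.mdifferentiableAt_inner hY hZ)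
    have e1 : (fun y ↦ g.inner y (X y) ((f • Z) y)) = f * fun y ↦ g.inner y (X y) (Z y) := by
      ext y; simp
    have e2 : (fun y ↦ g.inner y (Y y) ((f • Z) y)) = f * fun y ↦ g.inner y (Y y) (Z y) := by
      ext y; simp
    simp only [koszul]
    rw [e1, e2, h1, h2, mlieBracket_smul_right hf hZ, mlieBracket_smul_right hf hZ]
    simp
    rw [g.symm x (Z x) (Y x), g.symm x (Z x) (X x)]
    ring
  add := by
    intro Z Z' hZ hZ'
    have : CompleteSpace E := FiniteDimensional.complete ℝ E
    have h1 := mvfderiv_add (g.mdifferentiableAt_inner hX hZ) (g.mdifferentiableAt_inner hX hZ')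
    have h2 := mvfderiv_add (g.mdifferentiableAt_inner hY hZ) (g.mdifferentiableAt_inner hY hZ')
    have e1 : (fun y ↦ g.inner y (X y) ((Z + Z') y))
        = (fun y ↦ g.inner y (X y) (Z y)) + fun y ↦ g.inner y (X y) (Z' y) := by
      ext y; simp
    have e2 : (fun y ↦ g.inner y (Y y) ((Z + Z') y))
        = (fun y ↦ g.inner y (Y y) (Z y)) + fun y ↦ g.inner y (Y y) (Z' y) := by
      ext y; simp
    simp only [koszul]
    rw [e1, e2, h1, h2, mlieBracket_add_right hZ hZ', mlieBracket_add_right hZ hZ']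
    simp
    ring

open Classical in
/-- The bilinear form `(v, w) ↦ 2 ⟨∇_v Y, w⟩` on the tangent space at `x` given by the Koszul
formula; it is `0` by convention where `Y` is not differentiable. -/
def koszulForm (g : Metric E M) (Y : Π x : M, TangentSpace 𝓘(ℝ, E) x) (x : M) :
    TangentSpace 𝓘(ℝ, E) x →L[ℝ] TangentSpace 𝓘(ℝ, E) x →L[ℝ] ℝ :=
  if hY : MDiffAt (T% Y) x then
    TensorialAt.mkHom₂ (F := E) (F' := E) (fun X Z ↦ koszul g X Y Z x) x
      (fun _ hZ ↦ tensorial_koszul_left g hY hZ) (fun _ hX ↦ tensorial_koszul_right g hX hY)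
  else 0

theorem koszulForm_apply (g : Metric E M) {X Y Z : Π x : M, TangentSpace 𝓘(ℝ, E) x} {x : M}
    (hX : MDiffAt (T% X) x) (hY : MDiffAt (T% Y) x) (hZ : MDiffAt (T% Z) x) :
    koszulForm g Y x (X x) (Z x) = koszul g X Y Z x := by
  rw [koszulForm, dif_pos hY, TensorialAt.mkHom₂_apply _ _ hX hZ]

/-- The function underlying the Levi-Civita connection: `leviCivitaFun g Y x v = ∇_v Y`. -/
def leviCivitaFun (g : Metric E M) (Y : Π x : M, TangentSpace 𝓘(ℝ, E) x) (x : M) :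
    TangentSpace 𝓘(ℝ, E) x →L[ℝ] TangentSpace 𝓘(ℝ, E) x :=
  LinearMap.toContinuousLinearMap
    ((1 / 2 : ℝ) • g.sharp x ∘ₗ ContinuousLinearMap.coeLM ℝ ∘ₗ (koszulForm g Y x).toLinearMap)

theorem inner_leviCivitaFun (g : Metric E M) {X Y Z : Π x : M, TangentSpace 𝓘(ℝ, E) x} {x : M}
    (hX : MDiffAt (T% X) x) (hY : MDiffAt (T% Y) x) (hZ : MDiffAt (T% Z) x) :
    g.inner x (leviCivitaFun g Y x (X x)) (Z x) = (1 / 2) * koszul g X Y Z x := by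
  rw [← koszulForm_apply g hX hY hZ]
  simp [leviCivitaFun, Metric.inner_sharp]

theorem leviCivitaFun_isCovariantDerivativeOn (g : Metric E M) :
    IsCovariantDerivativeOn E (leviCivitaFun g) Set.univ where
  add := by
    intro Y Y' x hY hY' _
    have : CompleteSpace E := FiniteDimensional.complete ℝ E
    ext v
    apply g.ext_inner
    intro u
    have hX := mdifferentiableAt_extend 𝓘(ℝ, E) E v
    have hZ := mdifferentiableAt_extend 𝓘(ℝ, E) E u
    have a := inner_leviCivitaFun g hX (mdifferentiableAt_add_section hY hY') hZ
    have b := inner_leviCivitaFun g hX hY hZ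
    have c := inner_leviCivitaFun g hX hY' hZ
    have h1 := mvfderiv_add (g.mdifferentiableAt_inner hX hY) (g.mdifferentiableAt_inner hX hY')
    have h2 := mvfderiv_add (g.mdifferentiableAt_inner hY hZ) (g.mdifferentiableAt_inner hY' hZ)
    have e1 : (fun y ↦ g.inner y (extend E v y) ((Y + Y') y))
        = (fun y ↦ g.inner y (extend E v y) (Y y)) + fun y ↦ g.inner y (extend E v y) (Y' y) := by
      ext y; simp
    have e2 : (fun y ↦ g.inner y ((Y + Y') y) (extend E u y))
        = (fun y ↦ g.inner y (Y y) (extend E u y)) + fun y ↦ g.inner y (Y' y) (extend E u y) := by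
      ext y; simp
    simp only [koszul] at a b c
    rw [e1, e2, h1, h2, mlieBracket_add_left hY hY', mlieBracket_add_right hY hY'] at a
    simp only [extend_apply_self, Pi.add_apply, map_add, add_apply] at a b c ⊢
    rw [a, b, c]
    ring
  leibniz := by
    intro Y f x hY hf _
    have : CompleteSpace E := FiniteDimensional.complete ℝ E
    ext v
    apply g.ext_inner
    intro u
    have hX := mdifferentiableAt_extend 𝓘(ℝ, E) E v
    have hZ := mdifferentiableAt_extend 𝓘(ℝ, E) E u
    have a := inner_leviCivitaFun g hX (hf.smul_section hY) hZ
    have b := inner_leviCivitaFun g hX hY hZ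
    have h1 := mvfderiv_mul hf (g.mdifferentiableAt_inner hX hY)
    have h2 := mvfderiv_mul hf (g.mdifferentiableAt_inner hY hZ)
    have e1 : (fun y ↦ g.inner y (extend E v y) ((f • Y) y))
        = f * fun y ↦ g.inner y (extend E v y) (Y y) := by
      ext y; simp
    have e2 : (fun y ↦ g.inner y ((f • Y) y) (extend E u y))
        = f * fun y ↦ g.inner y (Y y) (extend E u y) := by
      ext y; simp
    simp only [koszul] at a b
    rw [e1, e2, h1, h2, mlieBracket_smul_left hf hY, mlieBracket_smul_right hf hY] at a
    simp at a b ⊢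
    rw [a, b, g.symm x (Y x) v]
    ring

/-- The Levi-Civita connection of a Riemannian metric. `leviCivita g Y x v` is `∇_v Y`. -/
def leviCivita (g : Metric E M) :
    CovariantDerivative 𝓘(ℝ, E) E (fun x : M ↦ TangentSpace 𝓘(ℝ, E) x) :=
  ⟨leviCivitaFun g, leviCivitaFun_isCovariantDerivativeOn g⟩

/-- The Levi-Civita connection is torsion-free: `∇_X Y - ∇_Y X = [X, Y]`. -/
theorem leviCivita_torsion_free (g : Metric E M) {X Y : Π x : M, TangentSpace 𝓘(ℝ, E) x} {x : M}
    (hX : MDiffAt (T% X) x) (hY : MDiffAt (T% Y) x) :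
    leviCivita g Y x (X x) - leviCivita g X x (Y x) = mlieBracket 𝓘(ℝ, E) X Y x := by
  apply g.ext_inner
  intro u
  have hZ := mdifferentiableAt_extend 𝓘(ℝ, E) E u
  have a := inner_leviCivitaFun g hX hY hZ
  have b := inner_leviCivitaFun g hY hX hZ
  have e : (fun y ↦ g.inner y (X y) (Y y)) = fun y ↦ g.inner y (Y y) (X y) := by
    ext y; exact g.symm y _ _
  simp only [koszul] at a b
  rw [mlieBracket_swap_apply (V := Y) (W := X)] at b
  rw [e] at a
  simp only [extend_apply_self, map_neg, neg_apply] at a b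
  rw [map_sub, sub_apply]
  change g.inner x (leviCivitaFun g Y x (X x)) u - g.inner x (leviCivitaFun g X x (Y x)) u = _
  rw [a, b]
  ring

/-- The Levi-Civita connection is metric: `X⟨Y, Z⟩ = ⟨∇_X Y, Z⟩ + ⟨Y, ∇_X Z⟩`. -/
theorem leviCivita_metric (g : Metric E M) {X Y Z : Π x : M, TangentSpace 𝓘(ℝ, E) x} {x : M}
    (hX : MDiffAt (T% X) x) (hY : MDiffAt (T% Y) x) (hZ : MDiffAt (T% Z) x) :
    mvfderiv 𝓘(ℝ, E) (fun y ↦ g.inner y (Y y) (Z y)) x (X x)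
      = g.inner x (leviCivita g Y x (X x)) (Z x) + g.inner x (Y x) (leviCivita g Z x (X x)) := by
  have a := inner_leviCivitaFun g hX hY hZ
  have b := inner_leviCivitaFun g hX hZ hY
  have e : (fun y ↦ g.inner y (Z y) (Y y)) = fun y ↦ g.inner y (Y y) (Z y) := by
    ext y; exact g.symm y _ _
  simp only [koszul] at a b
  rw [mlieBracket_swap_apply (V := Z) (W := Y), e] at b
  simp only [map_neg, neg_apply] at b
  rw [g.symm x (Y x)]
  change _ = g.inner x (leviCivitaFun g Y x (X x)) (Z x)
    + g.inner x (leviCivitaFun g Z x (X x)) (Y x)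
  rw [a, b]
  ring

/-! ### Curvature -/

/-- The curvature `R(X, Y)Z = ∇_X ∇_Y Z - ∇_Y ∇_X Z - ∇_[X, Y] Z` of the Levi-Civita connection. -/
def curvature (g : Metric E M) (X Y Z : Π x : M, TangentSpace 𝓘(ℝ, E) x) (x : M) :
    TangentSpace 𝓘(ℝ, E) x :=
  leviCivita g (fun y ↦ leviCivita g Z y (Y y)) x (X x)
    - leviCivita g (fun y ↦ leviCivita g Z y (X y)) x (Y x)
    - leviCivita g Z x (mlieBracket 𝓘(ℝ, E) X Y x)

/-- The Ricci tensor: `ricci g x u v` is the trace of `w ↦ R(w, u)v`, computed in a basis of the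
tangent space at `x`. Tangent vectors are extended to vector fields that are smooth near `x`;
the value does not depend on the extensions. -/
def ricci (g : Metric E M) (x : M) (u v : TangentSpace 𝓘(ℝ, E) x) : ℝ :=
  let b := Module.finBasis ℝ (TangentSpace 𝓘(ℝ, E) x)
  ∑ i, b.repr (curvature g (extend E (b i)) (extend E u) (extend E v) x) i

/-- `g` is an Einstein metric with Einstein constant `c`, that is, `Ric = c g`. -/
def IsEinstein (g : Metric E M) (c : ℝ) : Prop :=
  ∀ (x : M) (u v : TangentSpace 𝓘(ℝ, E) x), ricci g x u v = c * g.inner x u v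

/-! ### Almost Hermitian, nearly Kähler and Kähler structures -/

variable (E M) in
/-- A smooth almost complex structure on `M`. -/
structure AlmostComplex where
  /-- The endomorphism of each tangent space. -/
  toFun (x : M) : TangentSpace 𝓘(ℝ, E) x →L[ℝ] TangentSpace 𝓘(ℝ, E) x
  smooth : ContMDiff 𝓘(ℝ, E) (𝓘(ℝ, E).prod 𝓘(ℝ, E →L[ℝ] E)) ∞
    (fun x ↦ TotalSpace.mk' (E →L[ℝ] E)
      (E := fun x : M ↦ TangentSpace 𝓘(ℝ, E) x →L[ℝ] TangentSpace 𝓘(ℝ, E) x) x (toFun x))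
  sq (x : M) (v : TangentSpace 𝓘(ℝ, E) x) : toFun x (toFun x v) = -v

instance : CoeFun (AlmostComplex E M)
    (fun _ ↦ (x : M) → TangentSpace 𝓘(ℝ, E) x →L[ℝ] TangentSpace 𝓘(ℝ, E) x) :=
  ⟨AlmostComplex.toFun⟩

theorem AlmostComplex.mdifferentiableAt_apply (J : AlmostComplex E M)
    {Y : Π x : M, TangentSpace 𝓘(ℝ, E) x} {x : M} (hY : MDiffAt (T% Y) x) :
    MDiffAt (T% fun y ↦ J y (Y y)) x :=
  MDifferentiableAt.clm_bundle_apply (F₁ := E) (F₂ := E)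
    (J.smooth.mdifferentiableAt (by simp)) hY

theorem tensorial_nablaJ (g : Metric E M) (J : AlmostComplex E M) (x : M) :
    TensorialAt 𝓘(ℝ, E) E
      (fun Y ↦ leviCivita g (fun y ↦ J y (Y y)) x - J x ∘L leviCivita g Y x) x where
  smul := by
    intro f Y hf hY
    have h1 := (leviCivita g).isCovariantDerivativeOnUniv.leibniz (x := x)
      (J.mdifferentiableAt_apply hY) hf
    have h2 := (leviCivita g).isCovariantDerivativeOnUniv.leibniz (x := x) hY hf
    have e : (fun y ↦ J y ((f • Y) y)) = f • fun y ↦ J y (Y y) := by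
      ext y; simp
    rw [e, h1, h2]
    ext v
    simp
    module
  add := by
    intro Y Y' hY hY'
    have h1 := (leviCivita g).isCovariantDerivativeOnUniv.add (x := x)
      (J.mdifferentiableAt_apply hY) (J.mdifferentiableAt_apply hY')
    have h2 := (leviCivita g).isCovariantDerivativeOnUniv.add (x := x) hY hY'
    have e : (fun y ↦ J y ((Y + Y') y)) = (fun y ↦ J y (Y y)) + fun y ↦ J y (Y' y) := by
      ext y; simp
    rw [e, h1, h2]
    ext v
    simp
    module

/-- The bilinear map `(w, v) ↦ (∇_v J)w = ∇_v (J W) - J (∇_v W)`, for any vector field `W`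
extending `w`, where `∇` is the Levi-Civita connection. -/
def nablaJFlip (g : Metric E M) (J : AlmostComplex E M) (x : M) :
    TangentSpace 𝓘(ℝ, E) x →L[ℝ] TangentSpace 𝓘(ℝ, E) x →L[ℝ] TangentSpace 𝓘(ℝ, E) x :=
  TensorialAt.mkHom (F := E) _ x (tensorial_nablaJ g J x)

/-- The covariant derivative of the almost complex structure with respect to the Levi-Civita
connection: `nablaJ g J x v w = (∇_v J)w`. -/
def nablaJ (g : Metric E M) (J : AlmostComplex E M) (x : M) :
    TangentSpace 𝓘(ℝ, E) x →ₗ[ℝ] TangentSpace 𝓘(ℝ, E) x →ₗ[ℝ] TangentSpace 𝓘(ℝ, E) x :=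
  LinearMap.mk₂ ℝ (fun v w ↦ nablaJFlip g J x w v) (by simp) (by simp) (by simp) (by simp)

/-- `(∇_X J)Y = ∇_X (J Y) - J (∇_X Y)`. -/
theorem nablaJ_apply (g : Metric E M) (J : AlmostComplex E M)
    {Y : Π x : M, TangentSpace 𝓘(ℝ, E) x} {x : M} (hY : MDiffAt (T% Y) x)
    (v : TangentSpace 𝓘(ℝ, E) x) :
    nablaJ g J x v (Y x) = leviCivita g (fun y ↦ J y (Y y)) x v - J x (leviCivita g Y x v) := by
  have h := congrArg (fun A ↦ A v) (TensorialAt.mkHom_apply (tensorial_nablaJ g J x) hY)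
  exact h

/-- `(g, J)` is an almost Hermitian structure. -/
def IsAlmostHermitian (g : Metric E M) (J : AlmostComplex E M) : Prop :=
  ∀ (x : M) (v w : TangentSpace 𝓘(ℝ, E) x), g.inner x (J x v) (J x w) = g.inner x v w

/-- `(g, J)` is a nearly Kähler structure: almost Hermitian with `(∇_X J)X = 0`. -/
def IsNearlyKahler (g : Metric E M) (J : AlmostComplex E M) : Prop :=
  IsAlmostHermitian g J ∧ ∀ (x : M) (v : TangentSpace 𝓘(ℝ, E) x), nablaJ g J x v v = 0

/-- Strictness: `∇_X J ≠ 0` for every nonzero tangent vector `X`. -/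
def IsStrict (g : Metric E M) (J : AlmostComplex E M) : Prop :=
  ∀ (x : M) (v : TangentSpace 𝓘(ℝ, E) x), v ≠ 0 → nablaJ g J x v ≠ 0

/-- Integrability of an almost complex structure: the Nijenhuis tensor
`[X, Y] + J[JX, Y] + J[X, JY] - [JX, JY]` vanishes. -/
def IsIntegrable (J : AlmostComplex E M) : Prop :=
  ∀ X Y : Π x : M, TangentSpace 𝓘(ℝ, E) x, IsSmoothField X → IsSmoothField Y → ∀ x : M,
    mlieBracket 𝓘(ℝ, E) X Y x
      + J x (mlieBracket 𝓘(ℝ, E) (fun y ↦ J y (X y)) Y x)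
      + J x (mlieBracket 𝓘(ℝ, E) X (fun y ↦ J y (Y y)) x)
      - mlieBracket 𝓘(ℝ, E) (fun y ↦ J y (X y)) (fun y ↦ J y (Y y)) x = 0

/-- The fundamental (Kähler) form `ω(X, Y) = ⟨JX, Y⟩`. -/
def kahlerForm (g : Metric E M) (J : AlmostComplex E M) (x : M)
    (v w : TangentSpace 𝓘(ℝ, E) x) : ℝ :=
  g.inner x (J x v) w

/-- The exterior derivative of a 2-form `β`, evaluated on three vector fields. -/
def extDeriv₂ (β : (x : M) → TangentSpace 𝓘(ℝ, E) x → TangentSpace 𝓘(ℝ, E) x → ℝ)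
    (X Y Z : Π x : M, TangentSpace 𝓘(ℝ, E) x) (x : M) : ℝ :=
  mvfderiv 𝓘(ℝ, E) (fun y ↦ β y (Y y) (Z y)) x (X x)
    - mvfderiv 𝓘(ℝ, E) (fun y ↦ β y (X y) (Z y)) x (Y x)
    + mvfderiv 𝓘(ℝ, E) (fun y ↦ β y (X y) (Y y)) x (Z x)
    - β x (mlieBracket 𝓘(ℝ, E) X Y x) (Z x)
    + β x (mlieBracket 𝓘(ℝ, E) X Z x) (Y x)
    - β x (mlieBracket 𝓘(ℝ, E) Y Z x) (X x)

/-- `(g, J)` is a Kähler structure: Hermitian, with `J` integrable and closed Kähler form. -/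
def IsKahler (g : Metric E M) (J : AlmostComplex E M) : Prop :=
  IsAlmostHermitian g J ∧ IsIntegrable J ∧
    ∀ X Y Z : Π x : M, TangentSpace 𝓘(ℝ, E) x,
      IsSmoothField X → IsSmoothField Y → IsSmoothField Z →
        ∀ x : M, extDeriv₂ (kahlerForm g J) X Y Z x = 0

/-! ### The canonical Hermitian connection and parallel distributions -/

/-- The canonical Hermitian connection `∇̄_X Y = ∇_X Y + (1/2) (∇_X J)(J Y)`. -/
def canonicalConnection (g : Metric E M) (J : AlmostComplex E M) :
    CovariantDerivative 𝓘(ℝ, E) E (fun x : M ↦ TangentSpace 𝓘(ℝ, E) x) :=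
  (leviCivita g).addOneForm (fun x ↦ ((1 / 2 : ℝ) • nablaJFlip g J x) ∘L J x)

theorem canonicalConnection_apply (g : Metric E M) (J : AlmostComplex E M)
    (Y : Π x : M, TangentSpace 𝓘(ℝ, E) x) (x : M) (v : TangentSpace 𝓘(ℝ, E) x) :
    canonicalConnection g J Y x v
      = leviCivita g Y x v + (1 / 2 : ℝ) • nablaJ g J x v (J x (Y x)) := rfl

variable (E M) in
/-- A choice of a linear subspace of each tangent space of `M`. -/
abbrev Distribution : Type _ := (x : M) → Submodule ℝ (TangentSpace 𝓘(ℝ, E) x)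

/-- `Y` is a smooth vector field which is a section of the distribution `D`. -/
def IsSectionOf (D : Distribution E M) (Y : Π x : M, TangentSpace 𝓘(ℝ, E) x) : Prop :=
  IsSmoothField Y ∧ ∀ x, Y x ∈ D x

/-- A distribution of constant rank `k` is smooth (a subbundle of the tangent bundle) when each of
its vectors is the value of a smooth section. -/
def IsSubbundle (D : Distribution E M) (k : ℕ) : Prop :=
  (∀ x, Module.finrank ℝ (D x) = k) ∧ ∀ (x : M), ∀ v ∈ D x, ∃ Y, IsSectionOf D Y ∧ Y x = v

/-- The distribution is stable by `J`. -/
def IsStable (J : AlmostComplex E M) (D : Distribution E M) : Prop :=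
  ∀ (x : M), ∀ v ∈ D x, J x v ∈ D x

/-- The distribution is parallel for the canonical Hermitian connection: `∇̄_v Y` is in `D` for
all sections `Y` of `D` and all tangent vectors `v`. -/
def IsParallel (g : Metric E M) (J : AlmostComplex E M) (D : Distribution E M) : Prop :=
  ∀ Y, IsSectionOf D Y → ∀ (x : M) (v : TangentSpace 𝓘(ℝ, E) x),
    canonicalConnection g J Y x v ∈ D x

/-- The orthogonal complement of a distribution. -/
def orthCompl (g : Metric E M) (D : Distribution E M) : Distribution E M :=
  fun x ↦ (g.form x).orthogonal (D x)

theorem isCompl_orthCompl (g : Metric E M) (D : Distribution E M) (x : M) :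
    IsCompl (D x) (orthCompl g D x) := by
  rw [orthCompl, LinearMap.BilinForm.isCompl_orthogonal_iff_disjoint (g.form_isRefl x),
    Submodule.disjoint_def]
  exact fun v hv hv' ↦ g.eq_zero_of_self (hv' v hv)

/-- The orthogonal projection of the tangent space at `x` onto `D x`. -/
def orthProj (g : Metric E M) (D : Distribution E M) (x : M) :
    TangentSpace 𝓘(ℝ, E) x →ₗ[ℝ] D x :=
  (D x).projectionOnto (orthCompl g D x) (isCompl_orthCompl g D x)

/-- The trace `Tr_D A` over `D x` of an endomorphism `A` of the tangent space at `x`, i.e.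
`∑ ⟨A e_i, e_i⟩` over an orthonormal basis of `D x`. -/
def traceOn (g : Metric E M) (D : Distribution E M) (x : M)
    (A : TangentSpace 𝓘(ℝ, E) x →ₗ[ℝ] TangentSpace 𝓘(ℝ, E) x) : ℝ :=
  LinearMap.trace ℝ (D x) (orthProj g D x ∘ₗ A ∘ₗ (D x).subtype)

/-- The bilinear form `(u, v) ↦ -(1/2) Tr_L (∇_u J)(∇_v J)`. -/
def torsionForm (g : Metric E M) (J : AlmostComplex E M) (L : Distribution E M) (x : M) :
    TangentSpace 𝓘(ℝ, E) x →ₗ[ℝ] TangentSpace 𝓘(ℝ, E) x →ₗ[ℝ] ℝ :=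
  LinearMap.mk₂ ℝ
    (fun u v ↦ -(1 / 2) * traceOn g L x
      (nablaJ g J x u ∘ₗ nablaJ g J x v))
    (by
      intro u u' v
      simp only [traceOn, map_add, LinearMap.add_comp,
        LinearMap.comp_add, mul_add])
    (by
      intro c u v
      simp only [traceOn, map_smul, LinearMap.smul_comp,
        LinearMap.comp_smul, smul_eq_mul]
      ring)
    (by
      intro u v v'
      simp only [traceOn, map_add, LinearMap.add_comp,
        LinearMap.comp_add, mul_add])
    (by
      intro c u v
      simp only [traceOn, map_smul, LinearMap.smul_comp,
        LinearMap.comp_smul, smul_eq_mul]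
      ring)

/-- The endomorphism `F` of the tangent bundle with `⟨F u, v⟩ = -(1/2) Tr_L (∇_u J)(∇_v J)`. -/
def torsionEndo (g : Metric E M) (J : AlmostComplex E M) (L : Distribution E M) (x : M) :
    TangentSpace 𝓘(ℝ, E) x →ₗ[ℝ] TangentSpace 𝓘(ℝ, E) x :=
  g.sharp x ∘ₗ torsionForm g J L x

theorem inner_torsionEndo (g : Metric E M) (J : AlmostComplex E M) (L : Distribution E M) (x : M)
    (u v : TangentSpace 𝓘(ℝ, E) x) :
    g.inner x (torsionEndo g J L x u) v = -(1 / 2) * traceOn g L x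
      (nablaJ g J x u ∘ₗ nablaJ g J x v) :=
  g.inner_sharp x _ v

/-! ### The modified metric and the reversed almost complex structure -/

/-- `g'` equals `g` on the orthogonal complement of `L` and `2g` on `L`, and keeps the two
orthogonal. -/
def IsModifiedMetric (g g' : Metric E M) (L : Distribution E M) : Prop :=
  ∀ x : M,
    (∀ v ∈ orthCompl g L x, ∀ w ∈ orthCompl g L x, g'.inner x v w = g.inner x v w) ∧
    (∀ v ∈ L x, ∀ w ∈ L x, g'.inner x v w = 2 * g.inner x v w) ∧
    (∀ v ∈ orthCompl g L x, ∀ w ∈ L x, g'.inner x v w = 0)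

/-- `J'` equals `J` on the orthogonal complement of `L` and `-J` on `L`. -/
def IsReversed (g : Metric E M) (J J' : AlmostComplex E M) (L : Distribution E M) : Prop :=
  ∀ x : M, (∀ v ∈ orthCompl g L x, J' x v = J x v) ∧ (∀ v ∈ L x, J' x v = -J x v)

end NearlyKahler

end

/-!
The torsion `T(X, Y) = (∇_X J) J Y` of the canonical Hermitian connection `∇̄` is a three-form of
type (3,0) + (0,3). Splitting the first Bianchi identity of `∇̄` into types gives `∇̄T = 0`
(Kirichenko), so the curvature `R̄` of `∇̄` annihilates `T` and is pair symmetric.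

For the parallel plane `L` one has `T(L, L) = 0` and `T(L, E) ⊆ E`, and injectivity of `F` on `E`
forces `T(E, E) ⊆ L`. Writing `T_V = T(V, ·)`, the Bianchi identity for `V ∈ L` and `R̄ · T = 0`
determine `R̄(V, JV)`: it is `-2 J T_V²` on `E` and a multiple `-k|V|² J` on `L`, and comparing
the two yields `T_V² = -(k/4)|V|²` on `E`, which is `F = k/4`. As `T` and `L` are parallel, `k` is
constant.

If `P` is the projection onto `L`, then `∇̄_X Y - ½ T(X - PX, Y + PY)` is metric for `ḡ`, free of
torsion and preserves `J̄`; being the Levi-Civita connection of `ḡ`, it shows that `(ḡ, J̄)` is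
Kähler. The Ricci form of a Kähler metric is half the trace of `J̄` composed with the curvature.
On `E` this trace is governed by the action on `L` alone, because `R̄` commutes with `T_V` up to
its action on `V`.
-/

noncomputable section

namespace NearlyKahler

/-! ### Connections on Lie–Rinehart algebras -/

section LieRinehart

variable {A L : Type*} [CommRing A] [LieRing L] [Module A L] [LieRingModule L A]

variable (A L) in
/-- A connection on the module `L` over a Lie–Rinehart algebra `(A, L)`; for the vector fields `L`
over the ring `A` of smooth functions on a manifold this is an affine connection,
`∇ X Y = ∇_X Y`. -/
structure Connection where
  /-- The covariant derivative. -/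
  toFun : L →ₗ[A] L →+ L
  map_smul_right' (X : L) (a : A) (Y : L) : toFun X (a • Y) = ⁅X, a⁆ • Y + a • toFun X Y

namespace Connection

instance : CoeFun (Connection A L) (fun _ ↦ L → L →+ L) := ⟨fun D ↦ D.toFun⟩

theorem ext {D D' : Connection A L} (h : ∀ X Y, D X Y = D' X Y) : D = D' := by
  obtain ⟨D, _⟩ := D
  obtain ⟨D', _⟩ := D'
  obtain rfl : D = D' := LinearMap.ext fun X ↦ AddMonoidHom.ext (h X)
  rfl

theorem map_smul_right (D : Connection A L) (X : L) (a : A) (Y : L) :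
    D X (a • Y) = ⁅X, a⁆ • Y + a • D X Y :=
  D.map_smul_right' X a Y

@[simp]
theorem map_smul_left (D : Connection A L) (X : L) (a : A) (Y : L) : D (a • X) Y = a • D X Y := by
  rw [map_smul, AddMonoidHom.smul_apply]

/-- The covariant derivative `(∇_X J) Y` of an endomorphism `J` of `L`. -/
def covDeriv (D : Connection A L) (J : L →ₗ[A] L) : L →ₗ[A] L →ₗ[A] L :=
  LinearMap.mk₂ A (fun X Y ↦ D X (J Y) - J (D X Y))
    (fun X X' Y ↦ by simp only [map_add, AddMonoidHom.add_apply]; abel)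
    (fun a X Y ↦ by simp only [map_smul, AddMonoidHom.smul_apply]; module)
    (fun X Y Y' ↦ by simp only [map_add]; abel)
    (fun a X Y ↦ by simp only [map_smul, map_smul_right, map_add]; module)

theorem covDeriv_apply (D : Connection A L) (J : L →ₗ[A] L) (X Y : L) :
    D.covDeriv J X Y = D X (J Y) - J (D X Y) := rfl

/-- The covariant derivative `(∇_X S)(Y, Z)` of a bilinear operation `S` on `L`. -/
def covDeriv₂ (D : Connection A L) (S : L →ₗ[A] L →ₗ[A] L) : L →ₗ[A] L →ₗ[A] L →ₗ[A] L where
  toFun X :=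
    LinearMap.mk₂ A (fun Y Z ↦ D X (S Y Z) - S (D X Y) Z - S Y (D X Z))
      (fun Y Y' Z ↦ by simp only [map_add, LinearMap.add_apply]; abel)
      (fun a Y Z ↦ by
        simp only [map_smul, map_smul_right, map_add, LinearMap.add_apply, LinearMap.smul_apply]
        module)
      (fun Y Z Z' ↦ by simp only [map_add]; abel)
      (fun a Y Z ↦ by simp only [map_smul, map_smul_right, map_add]; module)
  map_add' X X' := LinearMap.ext₂ fun Y Z ↦ by
    simp only [LinearMap.mk₂_apply, LinearMap.add_apply, map_add, AddMonoidHom.add_apply]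
    abel
  map_smul' a X := LinearMap.ext₂ fun Y Z ↦ by
    simp only [LinearMap.mk₂_apply, LinearMap.smul_apply, map_smul,
      AddMonoidHom.smul_apply, RingHom.id_apply]
    module

theorem covDeriv₂_apply (D : Connection A L) (S : L →ₗ[A] L →ₗ[A] L) (X Y Z : L) :
    D.covDeriv₂ S X Y Z = D X (S Y Z) - S (D X Y) Z - S Y (D X Z) := rfl

/-- The connection preserves the bilinear form `B`: `X B(Y, Z) = B(∇_X Y, Z) + B(Y, ∇_X Z)`. -/
def IsMetric (D : Connection A L) (B : L →ₗ[A] L →ₗ[A] A) : Prop :=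
  ∀ X Y Z, ⁅X, B Y Z⁆ = B (D X Y) Z + B Y (D X Z)

/-- The endomorphism `J` is parallel: `∇_X (J Y) = J (∇_X Y)`. -/
def Preserves (D : Connection A L) (J : L →ₗ[A] L) : Prop :=
  ∀ X Y, D X (J Y) = J (D X Y)

/-- The connection `∇_X Y + S(X, Y)`. -/
def addOneForm (D : Connection A L) (S : L →ₗ[A] L →ₗ[A] L) : Connection A L where
  toFun :=
    { toFun := fun X ↦ D X + (S X).toAddMonoidHom
      map_add' := fun X X' ↦ by ext Y; simp [add_add_add_comm]
      map_smul' := fun a X ↦ by ext Y; simp }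
  map_smul_right' X a Y := by
    simp [D.map_smul_right, add_assoc]

@[simp]
theorem addOneForm_apply (D : Connection A L) (S : L →ₗ[A] L →ₗ[A] L) (X Y : L) :
    D.addOneForm S X Y = D X Y + S X Y := rfl

theorem IsMetric.addOneForm {D : Connection A L} {B : L →ₗ[A] L →ₗ[A] A} (hD : D.IsMetric B)
    {S : L →ₗ[A] L →ₗ[A] L} (hS : ∀ X Y Z, B (S X Y) Z = -B Y (S X Z)) :
    (D.addOneForm S).IsMetric B := by
  intro X Y Z
  simp only [addOneForm_apply, map_add, LinearMap.add_apply, hD X Y Z, hS]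
  ring

theorem Preserves.addOneForm {D : Connection A L} {J : L →ₗ[A] L} (hD : D.Preserves J)
    {S : L →ₗ[A] L →ₗ[A] L} (hS : ∀ X Y, S X (J Y) = J (S X Y)) :
    (D.addOneForm S).Preserves J := by
  intro X Y
  simp only [addOneForm_apply, map_add, hD X Y, hS]

theorem IsMetric.covDeriv₂_skew {D : Connection A L} {B : L →ₗ[A] L →ₗ[A] A} (hD : D.IsMetric B)
    {S : L →ₗ[A] L →ₗ[A] L} (hS : ∀ X Y Z, B (S X Y) Z = -B Y (S X Z)) (X Y Z W : L) :
    B (D.covDeriv₂ S X Y Z) W = -B Z (D.covDeriv₂ S X Y W) := by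
  have h : ⁅X, B (S Y Z) W⁆ = -⁅X, B Z (S Y W)⁆ := by rw [hS, lie_neg]
  rw [hD, hD] at h
  simp only [covDeriv₂_apply, map_sub, LinearMap.sub_apply, hS] at h ⊢
  linear_combination h

section LieRinehartRing

variable [LieRinehartRing A L]

theorem lie_smul_left (a : A) (X Y : L) : ⁅a • X, Y⁆ = a • ⁅X, Y⁆ - ⁅Y, a⁆ • X := by
  rw [← lie_skew, LieRinehartRing.leibniz_smul_right, ← lie_skew X Y, smul_neg]
  abel

/-- The torsion `T(X, Y) = ∇_X Y - ∇_Y X - [X, Y]`. -/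
def torsion (D : Connection A L) : L →ₗ[A] L →ₗ[A] L :=
  LinearMap.mk₂ A (fun X Y ↦ D X Y - D Y X - ⁅X, Y⁆)
    (fun X X' Y ↦ by simp only [map_add, AddMonoidHom.add_apply, add_lie]; abel)
    (fun a X Y ↦ by
      simp only [map_smul_left, map_smul_right, lie_smul_left]
      module)
    (fun X Y Y' ↦ by simp only [map_add, AddMonoidHom.add_apply, lie_add]; abel)
    (fun a X Y ↦ by
      simp only [map_smul_left, map_smul_right, LieRinehartRing.leibniz_smul_right]
      module)

theorem torsion_apply (D : Connection A L) (X Y : L) :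
    D.torsion X Y = D X Y - D Y X - ⁅X, Y⁆ := rfl

theorem torsion_swap (D : Connection A L) (X Y : L) : D.torsion Y X = -D.torsion X Y := by
  rw [torsion_apply, torsion_apply, ← lie_skew]
  abel

theorem torsion_addOneForm (D : Connection A L) (S : L →ₗ[A] L →ₗ[A] L) (X Y : L) :
    (D.addOneForm S).torsion X Y = D.torsion X Y + S X Y - S Y X := by
  simp only [torsion_apply, addOneForm_apply]
  abel

theorem lie_eq_of_torsion_eq_zero {D : Connection A L} (hD : D.torsion = 0) (X Y : L) :
    ⁅X, Y⁆ = D X Y - D Y X := by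
  have h := LinearMap.congr_fun₂ hD X Y
  rw [torsion_apply, LinearMap.zero_apply, LinearMap.zero_apply, sub_eq_zero] at h
  exact h.symm

theorem covDeriv₂_torsion_swap (D : Connection A L) (X Y Z : L) :
    D.covDeriv₂ D.torsion X Z Y = -D.covDeriv₂ D.torsion X Y Z := by
  simp only [covDeriv₂_apply]
  rw [D.torsion_swap Y Z, D.torsion_swap Y (D X Z), D.torsion_swap (D X Y) Z, map_neg]
  abel

/-- The curvature `R(X, Y)Z = ∇_X ∇_Y Z - ∇_Y ∇_X Z - ∇_[X, Y] Z`. -/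
def curvature (D : Connection A L) : L →ₗ[A] L →ₗ[A] L →ₗ[A] L :=
  LinearMap.mk₂ A
    (fun X Y ↦
      { toFun := fun Z ↦ D X (D Y Z) - D Y (D X Z) - D ⁅X, Y⁆ Z
        map_add' := fun Z Z' ↦ by simp only [map_add]; abel
        map_smul' := fun a Z ↦ by
          simp only [map_smul_right, map_add, lie_lie, RingHom.id_apply]
          module })
    (fun X X' Y ↦ LinearMap.ext fun Z ↦ by
      simp only [LinearMap.coe_mk, AddHom.coe_mk, LinearMap.add_apply, map_add,
        AddMonoidHom.add_apply, add_lie]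
      abel)
    (fun a X Y ↦ LinearMap.ext fun Z ↦ by
      simp only [LinearMap.coe_mk, AddHom.coe_mk, LinearMap.smul_apply, map_smul_left,
        map_smul_right, lie_smul_left, map_sub, AddMonoidHom.sub_apply]
      module)
    (fun X Y Y' ↦ LinearMap.ext fun Z ↦ by
      simp only [LinearMap.coe_mk, AddHom.coe_mk, LinearMap.add_apply, map_add,
        AddMonoidHom.add_apply, lie_add]
      abel)
    (fun a X Y ↦ LinearMap.ext fun Z ↦ by
      simp only [LinearMap.coe_mk, AddHom.coe_mk, LinearMap.smul_apply, map_smul_left,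
        map_smul_right, LieRinehartRing.leibniz_smul_right, map_add, AddMonoidHom.add_apply]
      module)

theorem curvature_apply (D : Connection A L) (X Y Z : L) :
    D.curvature X Y Z = D X (D Y Z) - D Y (D X Z) - D ⁅X, Y⁆ Z := rfl

theorem curvature_swap (D : Connection A L) (X Y Z : L) :
    D.curvature Y X Z = -D.curvature X Y Z := by
  rw [curvature_apply, curvature_apply, ← lie_skew, map_neg, AddMonoidHom.neg_apply]
  abel

theorem bianchi (D : Connection A L) (X Y Z : L) :
    D.curvature X Y Z + D.curvature Y Z X + D.curvature Z X Y =
      D.covDeriv₂ D.torsion X Y Z + D.covDeriv₂ D.torsion Y Z X + D.covDeriv₂ D.torsion Z X Y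
        + (D.torsion (D.torsion X Y) Z + D.torsion (D.torsion Y Z) X
          + D.torsion (D.torsion Z X) Y) := by
  have key (U V W : L) : D.covDeriv₂ D.torsion U V W + D.torsion (D.torsion U V) W
      = D U (D V W) - D U (D W V) - D U ⁅V, W⁆ + D.torsion (D U W) V - D.torsion (D V U) W
        - (D ⁅U, V⁆ W - D W ⁅U, V⁆ - ⁅⁅U, V⁆, W⁆) := by
    rw [covDeriv₂_apply, D.torsion_swap (D U W) V, ← torsion_apply D ⁅U, V⁆ W]
    simp only [torsion_apply D V W, torsion_apply D U V, map_sub, LinearMap.sub_apply]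
    abel
  have jacobi := lie_jacobi X Y Z
  rw [← lie_skew X ⁅Y, Z⁆, ← lie_skew Y ⁅Z, X⁆, ← lie_skew Z ⁅X, Y⁆] at jacobi
  simp only [curvature_apply]
  linear_combination (norm := abel) jacobi - key X Y Z - key Y Z X - key Z X Y

theorem curvature_addOneForm (D : Connection A L) {S : L →ₗ[A] L →ₗ[A] L}
    (hS : ∀ X Y Z, D.covDeriv₂ S X Y Z = 0) (X Y Z : L) :
    (D.addOneForm S).curvature X Y Z
      = D.curvature X Y Z + S (D.torsion X Y) Z + (S X (S Y Z) - S Y (S X Z)) := by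
  have h (X Y Z : L) : D X (S Y Z) = S (D X Y) Z + S Y (D X Z) := by
    rw [← sub_eq_zero, ← hS X Y Z, covDeriv₂_apply]
    abel
  simp only [curvature_apply, addOneForm_apply, torsion_apply, map_add, map_sub,
    LinearMap.sub_apply, h]
  abel

theorem Preserves.curvature {D : Connection A L} {J : L →ₗ[A] L} (hD : D.Preserves J)
    (X Y Z : L) : D.curvature X Y (J Z) = J (D.curvature X Y Z) := by
  simp only [curvature_apply, hD _ _, map_sub]

theorem IsMetric.curvature_skew {D : Connection A L} {B : L →ₗ[A] L →ₗ[A] A}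
    (hD : D.IsMetric B) (X Y Z W : L) :
    B (D.curvature X Y Z) W = -B Z (D.curvature X Y W) := by
  have h := hD ⁅X, Y⁆ Z W
  rw [lie_lie, hD, hD] at h
  simp only [lie_add, hD _ _ _] at h
  simp only [curvature_apply, map_sub, LinearMap.sub_apply]
  linear_combination h

theorem curvature_of_covDeriv₂_eq_zero {D : Connection A L} {S : L →ₗ[A] L →ₗ[A] L}
    (hS : ∀ X Y Z, D.covDeriv₂ S X Y Z = 0) (X Y Z W : L) :
    D.curvature X Y (S Z W) = S (D.curvature X Y Z) W + S Z (D.curvature X Y W) := by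
  have h (X Y Z : L) : D X (S Y Z) = S (D X Y) Z + S Y (D X Z) := by
    rw [← sub_eq_zero, ← hS X Y Z, covDeriv₂_apply]
    abel
  simp only [curvature_apply, h, map_add, map_sub, LinearMap.sub_apply]
  abel

theorem IsMetric.koszul {D : Connection A L} {B : L →ₗ[A] L →ₗ[A] A} (hD : D.IsMetric B)
    (hB : ∀ X Y, B X Y = B Y X) (hT : D.torsion = 0) (X Y Z : L) :
    2 * B (D X Y) Z = ⁅X, B Y Z⁆ + ⁅Y, B X Z⁆ - ⁅Z, B X Y⁆
      + B ⁅X, Y⁆ Z - B ⁅X, Z⁆ Y - B ⁅Y, Z⁆ X := by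
  simp only [hD _ _ _, lie_eq_of_torsion_eq_zero hT, map_sub, LinearMap.sub_apply]
  rw [hB X (D Y Z), hB X (D Z Y), hB Y (D X Z)]
  ring

theorem Preserves.nijenhuis_eq_zero {D : Connection A L} {J : L →ₗ[A] L} (hD : D.Preserves J)
    (hT : D.torsion = 0) (hJ : ∀ X, J (J X) = -X) (X Y : L) :
    ⁅X, Y⁆ + J ⁅J X, Y⁆ + J ⁅X, J Y⁆ - ⁅J X, J Y⁆ = 0 := by
  simp only [lie_eq_of_torsion_eq_zero hT, hD _ _, map_sub, hJ]
  abel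

theorem IsMetric.closed_of_preserves {D : Connection A L} {B : L →ₗ[A] L →ₗ[A] A}
    (hD : D.IsMetric B) {J : L →ₗ[A] L} (hJ : D.Preserves J) (hT : D.torsion = 0)
    (hBJ : ∀ X Y, B (J X) Y = -B (J Y) X) (X Y Z : L) :
    ⁅X, B (J Y) Z⁆ - ⁅Y, B (J X) Z⁆ + ⁅Z, B (J X) Y⁆
      - B (J ⁅X, Y⁆) Z + B (J ⁅X, Z⁆) Y - B (J ⁅Y, Z⁆) X = 0 := by
  simp only [lie_eq_of_torsion_eq_zero hT, hD _ _ _, hJ _ _, map_sub, LinearMap.sub_apply]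
  rw [hBJ Y (D X Z), hBJ X (D Y Z), hBJ X (D Z Y)]
  ring

end LieRinehartRing

end Connection

end LieRinehart

/-! ### Hermitian connections with totally skew torsion -/

section HermitianModule

variable {A L : Type*} [CommRing A] [AddCommGroup L] [Module A L]

/-- A symmetric nondegenerate bilinear form `B` on a module, together with an orthogonal complex
structure `J`. Positivity is not required, so that the notion makes sense over any ring. -/
structure IsHermitianForm (B : L →ₗ[A] L →ₗ[A] A) (J : L →ₗ[A] L) : Prop where
  symm : ∀ x y, B x y = B y x
  eq_zero_of_forall : ∀ x, (∀ y, B x y = 0) → x = 0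
  sq : ∀ x, J (J x) = -x
  isometry : ∀ x y, B (J x) (J y) = B x y

namespace IsHermitianForm

variable {B : L →ₗ[A] L →ₗ[A] A} {J : L →ₗ[A] L} (h : IsHermitianForm B J)
include h

theorem eq_of_forall {x y : L} (hxy : ∀ z, B x z = B y z) : x = y :=
  sub_eq_zero.1 (h.eq_zero_of_forall _ fun z ↦ by rw [LinearMap.map_sub₂, hxy, sub_self])

theorem skew (x y : L) : B (J x) y = -B x (J y) := by
  rw [← h.isometry x (J y), h.sq, map_neg, neg_neg]

theorem skew_right (x y : L) : B x (J y) = -B (J x) y := by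
  rw [h.skew, neg_neg]

end IsHermitianForm

/-- The tensor `B(T(x, y), z)` is a `3`-form of type `(3, 0) + (0, 3)`. -/
structure IsTypeThreeZero (B : L →ₗ[A] L →ₗ[A] A) (J : L →ₗ[A] L) (T : L →ₗ[A] L →ₗ[A] L) :
    Prop where
  swap : ∀ x y, T y x = -T x y
  skew : ∀ x y z, B (T x y) z = -B y (T x z)
  map_J : ∀ x y, T x (J y) = -J (T x y)

namespace IsTypeThreeZero

variable {B : L →ₗ[A] L →ₗ[A] A} {J : L →ₗ[A] L} {T : L →ₗ[A] L →ₗ[A] L}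
  (hT : IsTypeThreeZero B J T)
include hT

theorem map_J_left (x y : L) : T (J x) y = -J (T x y) := by
  rw [hT.swap, hT.map_J, hT.swap x, map_neg, neg_neg]

theorem form_swap_left (x y z : L) : B (T y x) z = -B (T x y) z := by
  rw [hT.swap x y, map_neg, LinearMap.neg_apply]

theorem form_swap_right (hB : ∀ x y, B x y = B y x) (x y z : L) :
    B (T x z) y = -B (T x y) z := by
  rw [hT.skew x z, hB]

theorem form_rotate (hB : ∀ x y, B x y = B y x) (x y z : L) : B (T y z) x = B (T x y) z := by
  rw [hT.form_swap_right hB, hT.form_swap_left, neg_neg]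

end IsTypeThreeZero

/-- The algebraic symmetries of the curvature of a Hermitian connection. -/
structure IsHermitianCurvature (B : L →ₗ[A] L →ₗ[A] A) (J : L →ₗ[A] L)
    (R : L →ₗ[A] L →ₗ[A] L →ₗ[A] L) : Prop where
  swap : ∀ x y z, R y x z = -R x y z
  skew : ∀ x y z w, B (R x y z) w = -B z (R x y w)
  map_J : ∀ x y z, R x y (J z) = J (R x y z)

/-- The hypothesis `cyclic` holds for torsion-free connections, and also for metric connections with
parallel skew torsion. -/
theorem IsHermitianCurvature.pair_symm [IsAddTorsionFree A] {B : L →ₗ[A] L →ₗ[A] A}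
    {J : L →ₗ[A] L} {R : L →ₗ[A] L →ₗ[A] L →ₗ[A] L} (hR : IsHermitianCurvature B J R)
    (hB : ∀ x y, B x y = B y x)
    (cyclic : ∀ x y z w, B (R y z w + R z w y + R w y z) x = -B (R x y z + R y z x + R z x y) w)
    (x y z w : L) : B (R x y z) w = B (R z w x) y := by
  have skew (x y z w : L) : B (R x y w) z = -B (R x y z) w := by rw [hR.skew, hB]
  have swap (x y z w : L) : B (R y x z) w = -B (R x y z) w := by
    rw [hR.swap, map_neg, LinearMap.neg_apply]
  have h (x y z w : L) :
      B (R x y z) w - B (R z w x) y + (B (R z x y) w - B (R y w z) x) = 0 := by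
    have h₁ := cyclic x y z w
    simp only [map_add, LinearMap.add_apply] at h₁
    linear_combination h₁ - skew y z x w - skew z w x y - swap y w z x
  refine nsmul_right_injective two_ne_zero ?_
  simp only [nsmul_eq_mul]
  push_cast
  linear_combination 2 * h x y z w - h y z w x - h z x y w + skew y z x w - swap x w y z
    - skew z x y w + swap y w z x

section ParallelTorsion

variable {B : L →ₗ[A] L →ₗ[A] A} {J : L →ₗ[A] L} {T : L →ₗ[A] L →ₗ[A] L}
  {S R : L →ₗ[A] L →ₗ[A] L →ₗ[A] L}

variable (J S) in
/-- Twice the component of `S : L → Λ³L` of type `(4, 0) + (0, 4)`, when `S x` is of type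
`(3, 0) + (0, 3)` for each `x`. -/
def typeFourZero (x y z : L) : L := S x y z + J (S (J x) y z)

variable (J R) in
/-- Four times the component of `R(y, z) x` for which `y`, `z` and the conjugate of the output have
the same type. -/
def sameType (x y z : L) : L :=
  R y z x + J (R y (J z) x) + J (R (J y) z x) - R (J y) (J z) x

theorem form_typeFourZero_swap_right (h : IsHermitianForm B J)
    (hS : ∀ x, IsTypeThreeZero B J (S x)) (x y z w : L) :
    B (typeFourZero J S x y w) z = -B (typeFourZero J S x y z) w := by
  have h₁ : B (J (S (J x) y w)) z = -B (J (S (J x) y z)) w := by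
    rw [h.skew, (hS _).skew, neg_neg, h.symm, (hS _).map_J, map_neg, LinearMap.neg_apply]
  simp only [typeFourZero, map_add, LinearMap.add_apply, (hS x).form_swap_right h.symm y z w, h₁]
  ring

theorem typeFourZero_swap (hS : ∀ x, IsTypeThreeZero B J (S x)) (x y z : L) :
    typeFourZero J S x z y = -typeFourZero J S x y z := by
  simp only [typeFourZero, (hS _).swap y z, map_neg]
  abel

theorem form_typeFourZero_rotate (h : IsHermitianForm B J)
    (hS : ∀ x, IsTypeThreeZero B J (S x)) (x y z w : L) :
    B (typeFourZero J S x z w) y = B (typeFourZero J S x y z) w := by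
  rw [form_typeFourZero_swap_right h hS, typeFourZero_swap hS, map_neg, LinearMap.neg_apply,
    neg_neg]

/-- The quadratic torsion terms of `bianchi` have no component in which three arguments have the
same type. -/
theorem sameType_eq (h : IsHermitianForm B J) (hT : IsTypeThreeZero B J T)
    (hS : ∀ x, IsTypeThreeZero B J (S x)) (hR : IsHermitianCurvature B J R)
    (bianchi : ∀ x y z, R x y z + R y z x + R z x y =
      S x y z + S y z x + S z x y + (T (T x y) z + T (T y z) x + T (T z x) y)) (x y z : L) :
    sameType J R x y z =
      4 • S x y z + 2 • typeFourZero J S y z x + 2 • typeFourZero J S z x y := by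
  have h₁ := bianchi x y z
  have h₂ := congrArg J (bianchi x y (J z))
  have h₃ := congrArg J (bianchi x (J y) z)
  have h₄ := bianchi x (J y) (J z)
  simp only [hR.map_J, (hS _).map_J, (hS _).map_J_left, hT.map_J, hT.map_J_left, map_add, map_neg,
    h.sq, LinearMap.neg_apply] at h₁ h₂ h₃ h₄
  simp only [sameType, typeFourZero]
  linear_combination (norm := module) h₁ + h₂ + h₃ - h₄

theorem cyclicSum_form_sameType (h : IsHermitianForm B J) (hT : IsTypeThreeZero B J T)
    (hS : ∀ x, IsTypeThreeZero B J (S x)) (hR : IsHermitianCurvature B J R)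
    (bianchi : ∀ x y z, R x y z + R y z x + R z x y =
      S x y z + S y z x + S z x y + (T (T x y) z + T (T y z) x + T (T z x) y)) (x y z w : L) :
    B (sameType J R x y z) w + B (sameType J R x z w) y + B (sameType J R x w y) z =
      -2 * B (typeFourZero J S y z w + typeFourZero J S z w y + typeFourZero J S w y z) x := by
  have hR' (x y z w : L) : B (sameType J R x y z) w =
      -B (R y z w - R y (J z) (J w) - R (J y) z (J w) - R (J y) (J z) w) x := by
    simp only [sameType, map_add, map_sub, LinearMap.add_apply, LinearMap.sub_apply, h.skew,
      hR.skew _ _ x, h.symm x]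
    ring
  have h₁ := bianchi y z w
  have h₂ := bianchi y (J z) (J w)
  have h₃ := bianchi (J y) z (J w)
  have h₄ := bianchi (J y) (J z) w
  simp only [(hS _).map_J, (hS _).map_J_left, hT.map_J, hT.map_J_left, map_neg,
    h.sq, LinearMap.neg_apply] at h₁ h₂ h₃ h₄
  rw [hR', hR', hR', ← neg_add, ← neg_add, ← LinearMap.add_apply, ← map_add, ← LinearMap.add_apply,
    ← map_add, neg_mul, neg_inj, ← smul_eq_mul, ← LinearMap.smul_apply, ← map_smul]
  congr 2
  simp only [typeFourZero]
  linear_combination (norm := module) h₁ - h₂ - h₃ - h₄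

theorem typeFourZero_J (h : IsHermitianForm B J) (x y z : L) :
    typeFourZero J S (J x) y z = -J (typeFourZero J S x y z) := by
  simp only [typeFourZero, h.sq, map_neg, map_add, LinearMap.neg_apply]
  abel

theorem typeFourZero_J_middle (hS : ∀ x, IsTypeThreeZero B J (S x)) (x y z : L) :
    typeFourZero J S x (J y) z = -J (typeFourZero J S x y z) := by
  simp only [typeFourZero, (hS _).map_J_left, map_neg, map_add]
  abel

theorem typeFourZero_J_right (hS : ∀ x, IsTypeThreeZero B J (S x)) (x y z : L) :
    typeFourZero J S x y (J z) = -J (typeFourZero J S x y z) := by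
  simp only [typeFourZero, (hS _).map_J, map_neg, map_add]
  abel

theorem form_typeFourZero_swap_outer (h : IsHermitianForm B J)
    (hS : ∀ x, IsTypeThreeZero B J (S x)) (x y z w : L) :
    B (typeFourZero J S x y z) w = -B (typeFourZero J S x w z) y := by
  rw [form_typeFourZero_swap_right h hS x y w z, ← form_typeFourZero_rotate h hS x y w z]

variable [IsAddTorsionFree A]

theorem six_mul_form_eq (h : IsHermitianForm B J) (hT : IsTypeThreeZero B J T)
    (hS : ∀ x, IsTypeThreeZero B J (S x)) (hR : IsHermitianCurvature B J R)
    (bianchi : ∀ x y z, R x y z + R y z x + R z x y =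
      S x y z + S y z x + S z x y + (T (T x y) z + T (T y z) x + T (T z x) y)) (x y z w : L) :
    6 * B (S x y z) w =
      B (typeFourZero J S y z w + typeFourZero J S z w y + typeFourZero J S w y z) x := by
  have swap := form_typeFourZero_swap_right h hS
  have swap' := form_typeFourZero_swap_outer h hS
  have hsum := cyclicSum_form_sameType h hT hS hR bianchi x y z w
  simp only [sameType_eq h hT hS hR bianchi, map_add, map_nsmul, LinearMap.add_apply,
    LinearMap.smul_apply, nsmul_eq_mul] at hsum ⊢
  refine nsmul_right_injective two_ne_zero ?_
  simp only [nsmul_eq_mul]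
  linear_combination hsum - 4 * (hS x).form_rotate h.symm y z w
    + 4 * (hS x).form_rotate h.symm w y z - 2 * swap y z w x - 2 * swap z w y x
    - 2 * swap w y z x - 2 * swap' z x y w - 2 * swap' w x z y - 2 * swap' y x w z

/-- Comparing `bianchi` at `x, y` and at `J x, J y` kills the component of `S` of type
`(4, 0) + (0, 4)`, which in turn determines `S`. -/
theorem eq_zero_of_bianchi (h : IsHermitianForm B J)
    (hT : IsTypeThreeZero B J T) (hS : ∀ x, IsTypeThreeZero B J (S x))
    (hR : IsHermitianCurvature B J R)
    (bianchi : ∀ x y z, R x y z + R y z x + R z x y =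
      S x y z + S y z x + S z x y + (T (T x y) z + T (T y z) x + T (T z x) y)) (x y z : L) :
    S x y z = 0 := by
  have swap := form_typeFourZero_swap_right h hS
  have swap' := form_typeFourZero_swap_outer h hS
  have rotate := form_typeFourZero_rotate h hS
  have hS_eq := six_mul_form_eq h hT hS hR bianchi
  have typeFourZero_eq (x y z w : L) : 3 * B (typeFourZero J S x y z) w =
      B (typeFourZero J S y z w + typeFourZero J S z w y + typeFourZero J S w y z) x := by
    have hJ := hS_eq (J x) (J y) z w
    simp only [typeFourZero_J h, typeFourZero_J_middle hS, typeFourZero_J_right hS,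
      (hS _).map_J_left, ← neg_add, ← map_add, map_neg, LinearMap.neg_apply, h.isometry] at hJ
    refine nsmul_right_injective two_ne_zero ?_
    simp only [nsmul_eq_mul]
    have hS_eq := hS_eq x y z w
    rw [typeFourZero, map_add, LinearMap.add_apply]
    linear_combination hS_eq - hJ
  have typeFourZero_eq_zero (x y z w : L) : B (typeFourZero J S x y z) w = 0 := by
    have h₀ := typeFourZero_eq x y z w
    have h₁ := typeFourZero_eq y z w x
    have h₂ := typeFourZero_eq z w y x
    have h₃ := typeFourZero_eq w y z x
    simp only [map_add, LinearMap.add_apply] at h₀ h₁ h₂ h₃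
    refine nsmul_right_injective (n := 12) (by norm_num) ?_
    simp only [nsmul_eq_mul, mul_zero]
    push_cast
    linear_combination 5 * h₀ + h₁ + h₂ + h₃ + swap z w y x + swap' w x z y + 2 * rotate x y z w
      + swap w y z x + swap' y x w z + rotate x z w y + swap y z w x + swap' z x y w
  refine h.eq_zero_of_forall _ fun w ↦ nsmul_right_injective (n := 6) (by norm_num) ?_
  have := hS_eq x y z w
  simp only [map_add, LinearMap.add_apply, typeFourZero_eq_zero, add_zero] at this
  simpa only [nsmul_eq_mul, mul_zero, Nat.cast_ofNat] using this

end ParallelTorsion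

end HermitianModule

section NearlyKahlerConnection

variable {A L : Type*} [CommRing A] [LieRing L] [Module A L] [LieRingModule L A]
  {B : L →ₗ[A] L →ₗ[A] A} {J : L →ₗ[A] L}

namespace Connection

section Hermitian

variable [LieRinehartRing A L] {D : Connection A L}

theorem isHermitianCurvature (hD : D.IsMetric B) (hJ : D.Preserves J) :
    IsHermitianCurvature B J D.curvature :=
  ⟨D.curvature_swap, hD.curvature_skew, hJ.curvature⟩

theorem isTypeThreeZero_covDeriv₂_torsion (hD : D.IsMetric B) (hJ : D.Preserves J)
    (hT : IsTypeThreeZero B J D.torsion) (X : L) :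
    IsTypeThreeZero B J (D.covDeriv₂ D.torsion X) where
  swap := D.covDeriv₂_torsion_swap X
  skew := hD.covDeriv₂_skew hT.skew X
  map_J Y Z := by simp only [covDeriv₂_apply, hT.map_J, hJ X, map_neg, map_sub]; abel

theorem covDeriv₂_torsion_eq_zero [IsAddTorsionFree A] (h : IsHermitianForm B J)
    (hD : D.IsMetric B) (hJ : D.Preserves J) (hT : IsTypeThreeZero B J D.torsion) (X Y Z : L) :
    D.covDeriv₂ D.torsion X Y Z = 0 :=
  eq_zero_of_bianchi h hT (isTypeThreeZero_covDeriv₂_torsion hD hJ hT)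
    (isHermitianCurvature hD hJ) D.bianchi X Y Z

end Hermitian

section Canonical

variable {D : Connection A L}

theorem covDeriv_map_J (hJ : ∀ X, J (J X) = -X) (X Y : L) :
    D.covDeriv J X (J Y) = -J (D.covDeriv J X Y) := by
  simp only [covDeriv_apply, hJ, map_sub, map_neg]
  abel

theorem IsMetric.covDeriv_skew (hD : D.IsMetric B) (h : IsHermitianForm B J) (X Y Z : L) :
    B (D.covDeriv J X Y) Z = -B Y (D.covDeriv J X Z) := by
  have h₁ : ⁅X, B (J Y) Z⁆ = -⁅X, B Y (J Z)⁆ := by rw [h.skew, lie_neg]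
  rw [hD, hD] at h₁
  simp only [covDeriv_apply, map_sub, LinearMap.sub_apply, h.skew] at h₁ ⊢
  linear_combination h₁

variable (D J) in
/-- The tensor `(∇_X J) J Y`, the torsion of the canonical Hermitian connection. -/
def hermitianTorsion : L →ₗ[A] L →ₗ[A] L := (D.covDeriv J).compl₂ J

theorem hermitianTorsion_apply (X Y : L) :
    D.hermitianTorsion J X Y = D.covDeriv J X (J Y) := rfl

theorem isTypeThreeZero_hermitianTorsion (hD : D.IsMetric B) (h : IsHermitianForm B J)
    (hNK : ∀ X, D.covDeriv J X X = 0) : IsTypeThreeZero B J (D.hermitianTorsion J) where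
  swap X Y := by
    have swap (X Y : L) : D.covDeriv J X Y = -D.covDeriv J Y X := by
      have h₁ := hNK (X + Y)
      simp only [map_add, LinearMap.add_apply, hNK, add_zero, zero_add] at h₁
      rwa [add_comm, add_eq_zero_iff_eq_neg] at h₁
    simp only [hermitianTorsion_apply]
    rw [covDeriv_map_J h.sq, covDeriv_map_J h.sq, swap X Y, map_neg, neg_neg]
  skew X Y Z := by
    rw [hermitianTorsion_apply, hermitianTorsion_apply, hD.covDeriv_skew h, h.skew,
      covDeriv_map_J h.sq, map_neg]
  map_J X Y := by
    rw [hermitianTorsion_apply, hermitianTorsion_apply, covDeriv_map_J h.sq]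

variable [Algebra ℝ A] [Module ℝ L] [IsScalarTower ℝ A L]

variable (D J) in
/-- The canonical Hermitian connection `∇_X Y + ½ (∇_X J) J Y`. -/
def hermitian : Connection A L := D.addOneForm ((2⁻¹ : ℝ) • D.hermitianTorsion J)

theorem hermitian_apply (X Y : L) :
    D.hermitian J X Y = D X Y + (2⁻¹ : ℝ) • D.covDeriv J X (J Y) := rfl

theorem hermitian_isMetric (hD : D.IsMetric B) (h : IsHermitianForm B J)
    (hNK : ∀ X, D.covDeriv J X X = 0) : (D.hermitian J).IsMetric B := by
  refine hD.addOneForm fun X Y Z ↦ ?_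
  simp only [LinearMap.smul_apply, LinearMap.map_smul_of_tower,
    (isTypeThreeZero_hermitianTorsion hD h hNK).skew X Y Z, smul_neg]

theorem hermitian_preserves (hJ : ∀ X, J (J X) = -X) : (D.hermitian J).Preserves J := by
  intro X Y
  simp only [hermitian_apply, hJ, covDeriv_map_J hJ, map_neg, map_add, LinearMap.map_smul_of_tower,
    covDeriv_apply, map_sub]
  module

theorem hermitian_torsion [LieRinehartRing A L] (hD : D.IsMetric B) (h : IsHermitianForm B J)
    (hNK : ∀ X, D.covDeriv J X X = 0) (hT : D.torsion = 0) :
    (D.hermitian J).torsion = D.hermitianTorsion J := by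
  refine LinearMap.ext₂ fun X Y ↦ ?_
  rw [hermitian, torsion_addOneForm, hT]
  simp only [LinearMap.zero_apply, LinearMap.smul_apply,
    (isTypeThreeZero_hermitianTorsion hD h hNK).swap X Y]
  module

end Canonical

end Connection

end NearlyKahlerConnection

/-! ### Twistor splittings -/

section TwistorSplitting

variable {A L : Type*} [CommRing A] [AddCommGroup L] [Module A L]

/-- The projection `P` onto the vertical part of a Hermitian splitting for which `T` has the shape
of the torsion of a nearly Kähler twistor space: `T` vanishes on vertical vectors, is vertical on
horizontal vectors and horizontal on mixed pairs. -/
structure IsTwistorSplitting (B : L →ₗ[A] L →ₗ[A] A) (J : L →ₗ[A] L) (T : L →ₗ[A] L →ₗ[A] L)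
    (P : L →ₗ[A] L) : Prop where
  idem : ∀ x, P (P x) = P x
  symm : ∀ x y, B (P x) y = B x (P y)
  map_J : ∀ x, P (J x) = J (P x)
  vertical : ∀ x y, T (P x) (P y) = 0
  map_horizontal : ∀ x y, P (T (x - P x) y) = T (x - P x) (y - P y)

/-- The form `B` doubled on the range of the projection `P`. -/
def modifiedForm (B : L →ₗ[A] L →ₗ[A] A) (P : L →ₗ[A] L) : L →ₗ[A] L →ₗ[A] A := B + B.compl₂ P

theorem modifiedForm_apply (B : L →ₗ[A] L →ₗ[A] A) (P : L →ₗ[A] L) (x y : L) :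
    modifiedForm B P x y = B x y + B x (P y) := rfl

/-- The complex structure `J` with its sign reversed on the range of the projection `P`. -/
def reversedStructure (J P : L →ₗ[A] L) : L →ₗ[A] L := J - 2 • J ∘ₗ P

theorem reversedStructure_apply (J P : L →ₗ[A] L) (x : L) :
    reversedStructure J P x = J x - 2 • J (P x) := rfl

theorem IsTwistorSplitting.isHermitianForm [IsAddTorsionFree L] {B : L →ₗ[A] L →ₗ[A] A}
    {J : L →ₗ[A] L} {T : L →ₗ[A] L →ₗ[A] L} {P : L →ₗ[A] L} (hP : IsTwistorSplitting B J T P)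
    (h : IsHermitianForm B J) : IsHermitianForm (modifiedForm B P) (reversedStructure J P) where
  symm x y := by rw [modifiedForm_apply, modifiedForm_apply, h.symm x, ← hP.symm y, h.symm x]
  eq_zero_of_forall x hx := by
    have h₁ : x + P x = 0 := h.eq_zero_of_forall _ fun y ↦ by
      rw [map_add, LinearMap.add_apply, hP.symm]
      exact hx y
    have h₂ := congrArg P h₁
    rw [map_add, hP.idem, map_zero, ← two_nsmul] at h₂
    rwa [(nsmul_eq_zero_iff_right two_ne_zero).1 h₂, add_zero] at h₁
  sq x := by
    simp only [reversedStructure_apply, map_sub, map_nsmul, hP.map_J, hP.idem, h.sq]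
    module
  isometry x y := by
    simp only [modifiedForm_apply, reversedStructure_apply, map_sub, map_nsmul,
      LinearMap.sub_apply, LinearMap.smul_apply, hP.map_J, hP.idem, h.isometry, hP.symm]
    module

variable [Algebra ℝ A] [Module ℝ L] [IsScalarTower ℝ A L]

/-- The difference between the torsion-free connection of the modified metric and the connection
with torsion `T`: it is `-½ T(x, y)` for `x`, `y` horizontal, `-T(x, y)` for `x` horizontal and
`y` vertical, and `0` for `x` vertical. -/
def modifier (T : L →ₗ[A] L →ₗ[A] L) (P : L →ₗ[A] L) : L →ₗ[A] L →ₗ[A] L :=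
  -(2⁻¹ : ℝ) • T.compl₁₂ (LinearMap.id - P) (LinearMap.id + P)

theorem modifier_apply (T : L →ₗ[A] L →ₗ[A] L) (P : L →ₗ[A] L) (x y : L) :
    modifier T P x y = -(2⁻¹ : ℝ) • T (x - P x) (y + P y) := rfl

namespace IsTwistorSplitting

variable {B : L →ₗ[A] L →ₗ[A] A} {J : L →ₗ[A] L} {T : L →ₗ[A] L →ₗ[A] L} {P : L →ₗ[A] L}
  (hP : IsTwistorSplitting B J T P)
include hP

theorem modifiedForm_modifier (hT : IsTypeThreeZero B J T) (x y z : L) :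
    modifiedForm B P (modifier T P x y) z = -modifiedForm B P y (modifier T P x z) := by
  have h (u v : L) : modifiedForm B P u v = B (u + P u) v := by
    rw [modifiedForm_apply, ← hP.symm, map_add, LinearMap.add_apply]
  rw [h y, modifiedForm_apply, ← map_add, modifier_apply, modifier_apply,
    LinearMap.map_smul_of_tower, LinearMap.map_smul_of_tower, LinearMap.smul_apply, hT.skew,
    smul_neg]

theorem modifier_reversedStructure (hT : IsTypeThreeZero B J T) (x y : L) :
    modifier T P x (reversedStructure J P y) = reversedStructure J P (modifier T P x y) := by
  have h := hP.map_horizontal x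
  simp only [modifier_apply, reversedStructure_apply]
  generalize x - P x = e at h
  simp only [map_add, map_sub, map_nsmul, LinearMap.map_smul_of_tower, h, hP.map_J, hP.idem,
    hT.map_J]
  module

theorem add_modifier_sub_modifier (hT : IsTypeThreeZero B J T) (x y : L) :
    T x y + modifier T P x y - modifier T P y x = 0 := by
  simp only [modifier_apply, map_add, map_sub, LinearMap.sub_apply, hP.vertical, hT.swap x y,
    hT.swap x (P y), hT.swap (P x) y]
  module

end IsTwistorSplitting

end TwistorSplitting

section ModifiedConnection

variable {A L : Type*} [CommRing A] [LieRing L] [Module A L] [LieRingModule L A]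
  {B : L →ₗ[A] L →ₗ[A] A} {J P : L →ₗ[A] L}

namespace Connection

variable {D : Connection A L}

theorem IsMetric.modifiedForm (hD : D.IsMetric B) (hP : D.Preserves P) :
    D.IsMetric (modifiedForm B P) := by
  intro X Y Z
  simp only [modifiedForm_apply, lie_add, hD X, hP X]
  ring

theorem Preserves.reversedStructure (hJ : D.Preserves J) (hP : D.Preserves P) :
    D.Preserves (reversedStructure J P) := by
  intro X Y
  simp only [reversedStructure_apply, map_sub, map_nsmul, hJ X, hP X]

variable [Algebra ℝ A] [Module ℝ L] [IsScalarTower ℝ A L]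

theorem Preserves.covDeriv₂_modifier (hP : D.Preserves P) {T : L →ₗ[A] L →ₗ[A] L}
    (hT : ∀ X Y Z, D.covDeriv₂ T X Y Z = 0) (X Y Z : L) :
    D.covDeriv₂ (modifier T P) X Y Z = 0 := by
  have hsmul (W : L) : D X (-(2⁻¹ : ℝ) • W) = -(2⁻¹ : ℝ) • D X W := by
    rw [neg_smul, neg_smul, map_neg]
    exact_mod_cast congrArg _ (map_inv_natCast_smul (D X) ℝ ℝ 2 W)
  have h := hT X (Y - P Y) (Z + P Z)
  rw [covDeriv₂_apply, map_sub (D X), map_add (D X), hP, hP] at h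
  rw [covDeriv₂_apply, modifier_apply, modifier_apply, modifier_apply, hsmul, ← smul_sub,
    ← smul_sub, h, smul_zero]

variable [LieRinehartRing A L]

variable (D P) in
/-- The connection `D` made torsion-free by subtracting a multiple of its torsion; for the canonical
connection of a nearly Kähler twistor space this is the Levi-Civita connection of the modified
metric. -/
def modified : Connection A L := D.addOneForm (modifier D.torsion P)

theorem modified_isMetric (hT : IsTypeThreeZero B J D.torsion)
    (hP : IsTwistorSplitting B J D.torsion P) (hDP : D.Preserves P) (hD : D.IsMetric B) :
    (D.modified P).IsMetric (NearlyKahler.modifiedForm B P) :=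
  (hD.modifiedForm hDP).addOneForm (hP.modifiedForm_modifier hT)

theorem modified_preserves (hT : IsTypeThreeZero B J D.torsion)
    (hP : IsTwistorSplitting B J D.torsion P) (hDP : D.Preserves P) (hJ : D.Preserves J) :
    (D.modified P).Preserves (NearlyKahler.reversedStructure J P) :=
  (hJ.reversedStructure hDP).addOneForm (hP.modifier_reversedStructure hT)

theorem modified_torsion (hT : IsTypeThreeZero B J D.torsion)
    (hP : IsTwistorSplitting B J D.torsion P) : (D.modified P).torsion = 0 := by
  refine LinearMap.ext₂ fun X Y ↦ ?_
  rw [modified, torsion_addOneForm, hP.add_modifier_sub_modifier hT]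
  rfl

theorem modified_curvature (hDP : D.Preserves P)
    (hT : ∀ X Y Z, D.covDeriv₂ D.torsion X Y Z = 0) (X Y Z : L) :
    (D.modified P).curvature X Y Z = D.curvature X Y Z + modifier D.torsion P (D.torsion X Y) Z
      + (modifier D.torsion P X (modifier D.torsion P Y Z)
        - modifier D.torsion P Y (modifier D.torsion P X Z)) :=
  D.curvature_addOneForm (hDP.covDeriv₂_modifier hT) X Y Z

end Connection

end ModifiedConnection

/-! ### Parallel projections -/

theorem Connection.IsMetric.preserves_of_idem {A L : Type*} [CommRing A] [LieRing L] [Module A L]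
    [LieRingModule L A] {D : Connection A L} {B : L →ₗ[A] L →ₗ[A] A} {P : L →ₗ[A] L}
    (hD : D.IsMetric B) (hB : ∀ X, (∀ Y, B X Y = 0) → X = 0) (idem : ∀ X, P (P X) = P X)
    (symm : ∀ X Y, B (P X) Y = B X (P Y)) (hP : ∀ X Y, P (D X (P Y)) = D X (P Y)) :
    D.Preserves P := by
  intro X Y
  have orthogonal (W Z : L) : B (W - P W) (P Z) = 0 := by
    rw [← symm, map_sub, idem, sub_self, map_zero, LinearMap.zero_apply]
  have horizontal : P (D X (Y - P Y)) = 0 := hB _ fun Z ↦ by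
    have h := hD X (Y - P Y) (P Z)
    rw [orthogonal, lie_zero, ← hP, orthogonal, add_zero] at h
    rw [symm, ← h]
  rw [map_sub, map_sub, hP, sub_eq_zero] at horizontal
  exact horizontal.symm

theorem Connection.lie_smul_eq_zero {A L : Type*} [CommRing A] [LieRing L] [Module A L]
    [LieRingModule L A] {D : Connection A L} {B : L →ₗ[A] L →ₗ[A] A} {T : L →ₗ[A] L →ₗ[A] L}
    {P : L →ₗ[A] L} (hD : D.IsMetric B) (hT : ∀ X Y Z, D.covDeriv₂ T X Y Z = 0)
    (hDP : D.Preserves P) {f : A}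
    (hf : ∀ V Y, P V = V → P Y = 0 → T V (T V Y) = -(f * B V V) • Y) (X : L) {V Y : L}
    (hV : P V = V) (hY : P Y = 0) : ⁅X, f⁆ • B V V • Y = 0 := by
  have leibniz (U W : L) : D X (T U W) = T (D X U) W + T U (D X W) := by
    have h := hT X U W
    rw [covDeriv₂_apply] at h
    linear_combination (norm := abel) h
  have vertical : P (D X V) = D X V := by rw [← hDP, hV]
  have horizontal : P (D X Y) = 0 := by rw [← hDP, hY, map_zero]
  have polarized : T (D X V) (T V Y) + T V (T (D X V) Y)
      = -(f * (B V (D X V) + B (D X V) V)) • Y := by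
    have h := hf (V + D X V) Y (by rw [map_add, hV, vertical]) hY
    simp only [map_add, LinearMap.add_apply, hf V Y hV hY, hf _ Y vertical hY] at h
    linear_combination (norm := module) h
  have h := congrArg (D X) (hf V Y hV hY)
  rw [neg_smul, mul_smul, map_neg (D X), map_smul_right, map_smul_right, hD, leibniz, leibniz,
    map_add, hf V _ hV horizontal] at h
  linear_combination (norm := module) h - polarized

/-! ### Ricci curvature of Kähler curvature tensors -/

section KahlerCurvature

variable {K V : Type*} [Field K] [AddCommGroup V] [Module K V]

/-- The Ricci tensor of a curvature tensor, the trace of `e ↦ R(e, u)v`. -/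
def ricciTensor (R : V →ₗ[K] V →ₗ[K] V →ₗ[K] V) (u v : V) : K :=
  LinearMap.trace K V ((R.flip u).flip v)

theorem trace_eq_of_adjoint [FiniteDimensional K V] {B : LinearMap.BilinForm K V}
    (hB : B.Nondegenerate) {f f' : V →ₗ[K] V} (h : ∀ x y, B (f x) y = B x (f' y)) :
    LinearMap.trace K V f = LinearMap.trace K V f' := by
  have h_conj : (B.toDual hB).conj f = Module.Dual.transpose (R := K) f' := by
    ext φ y
    obtain ⟨x, rfl⟩ := (B.toDual hB).surjective φ
    simp [LinearEquiv.conj_apply, LinearMap.BilinForm.toDual_def, h, Module.Dual.transpose_apply]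
  rw [← LinearMap.trace_conj' f (B.toDual hB), h_conj, LinearMap.trace_transpose']

variable {B : V →ₗ[K] V →ₗ[K] K} {J : V →ₗ[K] V} {R : V →ₗ[K] V →ₗ[K] V →ₗ[K] V}

theorem IsHermitianForm.nondegenerate (h : IsHermitianForm B J) :
    LinearMap.BilinForm.Nondegenerate B :=
  ⟨h.eq_zero_of_forall, fun x hx ↦ h.eq_zero_of_forall x fun y ↦ by rw [h.symm, hx]⟩

/-- The curvature tensor of a Kähler metric. -/
structure IsKahlerCurvature (B : V →ₗ[K] V →ₗ[K] K) (J : V →ₗ[K] V)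
    (R : V →ₗ[K] V →ₗ[K] V →ₗ[K] V) : Prop extends IsHermitianCurvature B J R where
  bianchi : ∀ x y z, R x y z + R y z x + R z x y = 0

namespace IsKahlerCurvature

variable [IsAddTorsionFree K] (hR : IsKahlerCurvature B J R) (h : IsHermitianForm B J)
include hR h

theorem pair_symm (x y z w : V) : B (R x y z) w = B (R z w x) y :=
  hR.toIsHermitianCurvature.pair_symm h.symm (by simp [hR.bianchi]) x y z w

theorem map_J_J (x y z : V) : R (J x) (J y) z = R x y z :=
  h.eq_of_forall fun w ↦ by
    rw [hR.pair_symm h, hR.map_J, h.isometry, ← hR.pair_symm h]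

variable [FiniteDimensional K V]

theorem ricciTensor_symm (u v : V) : ricciTensor R u v = ricciTensor R v u := by
  refine trace_eq_of_adjoint h.nondegenerate fun x y ↦ ?_
  simp only [LinearMap.flip_apply]
  rw [hR.pair_symm h, hR.swap, map_neg, LinearMap.neg_apply, hR.skew, neg_neg]

theorem ricciTensor_J_J (u v : V) : ricciTensor R (J u) (J v) = ricciTensor R u v := by
  have conj : (R.flip (J u)).flip (J v) = -(J ∘ₗ (R.flip u).flip v ∘ₗ J) := by
    ext x
    have h₁ := hR.map_J_J h (J x) u v
    rw [h.sq, map_neg, LinearMap.neg_apply, LinearMap.neg_apply] at h₁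
    simp only [LinearMap.flip_apply, LinearMap.neg_apply, LinearMap.comp_apply, hR.map_J, ← h₁,
      map_neg, neg_neg]
  have J_J : J ∘ₗ J = -LinearMap.id := LinearMap.ext h.sq
  rw [ricciTensor, conj, map_neg, LinearMap.trace_comp_comm', LinearMap.comp_assoc, J_J,
    LinearMap.comp_neg, map_neg, neg_neg, LinearMap.comp_id, ricciTensor]

/-- The Ricci form of a Kähler metric is the curvature of its canonical bundle. -/
theorem trace_J_comp (u v : V) :
    LinearMap.trace K V (J ∘ₗ R u v) = 2 * ricciTensor R v (J u) := by
  have decomp : J ∘ₗ R u v = (R.flip v).flip (J u) - (R.flip u).flip (J v) := by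
    ext x
    have h₁ := hR.bianchi u v x
    rw [hR.swap x v u] at h₁
    simp only [LinearMap.comp_apply, LinearMap.sub_apply, LinearMap.flip_apply, hR.map_J]
    rw [← map_sub]
    congr 1
    linear_combination (norm := abel) h₁
  have h₂ : ricciTensor R u (J v) = -ricciTensor R v (J u) := by
    rw [← hR.ricciTensor_J_J h, h.sq, hR.ricciTensor_symm h, ricciTensor, ricciTensor,
      ← map_neg (LinearMap.trace K V)]
    congr 1
    ext x
    simp only [LinearMap.flip_apply, LinearMap.neg_apply, map_neg]
  rw [decomp, map_sub, ← ricciTensor, ← ricciTensor, h₂]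
  ring

end IsKahlerCurvature

end KahlerCurvature

/-! ### Linear algebra of a parallel plane -/

section Plane

variable {V : Type*} [AddCommGroup V] [Module ℝ V]

theorem exists_eq_smul_add_smul_of_finrank_eq_two {J : V →ₗ[ℝ] V} (hJ : ∀ x, J (J x) = -x)
    {L : Submodule ℝ V} (hL : Module.finrank ℝ L = 2) (hJL : ∀ v ∈ L, J v ∈ L) {v w : V}
    (hv : v ∈ L) (hv₀ : v ≠ 0) (hw : w ∈ L) : ∃ a b : ℝ, w = a • v + b • J v := by
  have indep : LinearIndependent ℝ ![(⟨v, hv⟩ : L), ⟨J v, hJL v hv⟩] := by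
    rw [LinearIndependent.pair_iff]
    intro s t hst
    have h₁ : s • v + t • J v = 0 := congrArg Subtype.val hst
    have h₂ := congrArg J h₁
    rw [map_add, map_smul, map_smul, hJ, map_zero] at h₂
    have h₃ : (s ^ 2 + t ^ 2) • v = 0 := by
      linear_combination (norm := module) s • h₁ - t • h₂
    have h₄ := (smul_eq_zero.1 h₃).resolve_right hv₀
    constructor <;> nlinarith [sq_nonneg s, sq_nonneg t]
  have hmem : (⟨w, hw⟩ : L) ∈ Submodule.span ℝ (Set.range ![(⟨v, hv⟩ : L), ⟨J v, hJL v hv⟩]) := by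
    rw [indep.span_eq_top_of_card_eq_finrank (by simp [hL])]
    trivial
  rw [Matrix.range_cons_cons_empty, Submodule.mem_span_pair] at hmem
  obtain ⟨a, b, hab⟩ := hmem
  exact ⟨a, b, (congrArg Subtype.val hab).symm⟩

theorem IsHermitianForm.apply_J_self {B : V →ₗ[ℝ] V →ₗ[ℝ] ℝ} {J : V →ₗ[ℝ] V}
    (h : IsHermitianForm B J) (x : V) : B (J x) x = 0 := by
  linarith [h.skew x x, h.symm x (J x)]

/-- The data induced on a tangent space by a Hermitian connection with curvature `R` and parallel
torsion `T` of type `(3, 0) + (0, 3)`, and by a parallel complex line, given as the range of the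
projection `P`. Vectors fixed by `P` are called vertical, those in its kernel horizontal. -/
structure IsHolonomyPlane (B : V →ₗ[ℝ] V →ₗ[ℝ] ℝ) (J : V →ₗ[ℝ] V) (T : V →ₗ[ℝ] V →ₗ[ℝ] V)
    (R : V →ₗ[ℝ] V →ₗ[ℝ] V →ₗ[ℝ] V) (P : V →ₗ[ℝ] V) : Prop where
  form : IsHermitianForm B J
  pos : ∀ x, x ≠ 0 → 0 < B x x
  torsion : IsTypeThreeZero B J T
  curvature : IsHermitianCurvature B J R
  curvature_torsion : ∀ x y z w, R x y (T z w) = T (R x y z) w + T z (R x y w)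
  bianchi : ∀ x y z, R x y z + R y z x + R z x y = T (T x y) z + T (T y z) x + T (T z x) y
  idem : ∀ x, P (P x) = P x
  symm : ∀ x y, B (P x) y = B x (P y)
  map_J : ∀ x, P (J x) = J (P x)
  map_curvature : ∀ x y z, P (R x y z) = R x y (P z)
  finrank_range : Module.finrank ℝ (LinearMap.range P) = 2
  injective : ∀ v x, P v = v → v ≠ 0 → P x = 0 → T v x = 0 → x = 0

/-- The Hermitian connection has sectional curvature `k` on the vertical plane. -/
def HasVerticalCurvature (B : V →ₗ[ℝ] V →ₗ[ℝ] ℝ) (J : V →ₗ[ℝ] V)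
    (R : V →ₗ[ℝ] V →ₗ[ℝ] V →ₗ[ℝ] V) (P : V →ₗ[ℝ] V) (k : ℝ) : Prop :=
  ∀ v w, P v = v → P w = w → R v (J v) w = -(k * B v v) • J w

namespace IsHolonomyPlane

variable {B : V →ₗ[ℝ] V →ₗ[ℝ] ℝ} {J : V →ₗ[ℝ] V} {T : V →ₗ[ℝ] V →ₗ[ℝ] V}
  {R : V →ₗ[ℝ] V →ₗ[ℝ] V →ₗ[ℝ] V} {P : V →ₗ[ℝ] V} (h : IsHolonomyPlane B J T R P)
include h

theorem proj_sub_proj (x : V) : P (x - P x) = 0 := by rw [map_sub, h.idem, sub_self]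

theorem exists_ne_zero : ∃ v, P v = v ∧ v ≠ 0 := by
  have hP : LinearMap.range P ≠ ⊥ := fun hP ↦ by
    have := h.finrank_range
    rw [hP, finrank_bot] at this
    omega
  obtain ⟨_, ⟨v, rfl⟩, hv⟩ := Submodule.exists_mem_ne_zero_of_ne_bot hP
  exact ⟨P v, h.idem v, hv⟩

theorem exists_eq_smul_add_smul {v w : V} (hv : P v = v) (hv₀ : v ≠ 0) (hw : P w = w) :
    ∃ a b : ℝ, w = a • v + b • J v := by
  refine exists_eq_smul_add_smul_of_finrank_eq_two h.form.sq h.finrank_range ?_ ⟨v, hv⟩ hv₀ ⟨w, hw⟩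
  rintro _ ⟨u, rfl⟩
  exact ⟨J u, h.map_J u⟩

theorem torsion_vertical {v w : V} (hv : P v = v) (hw : P w = w) : T v w = 0 := by
  have := IsAddTorsionFree.of_isTorsionFree ℝ V
  have self : T v v = 0 := self_eq_neg.1 (h.torsion.swap v v)
  rcases eq_or_ne v 0 with rfl | hv₀
  · rw [map_zero, LinearMap.zero_apply]
  · obtain ⟨a, b, rfl⟩ := h.exists_eq_smul_add_smul hv hv₀ hw
    rw [map_add, map_smul, map_smul, h.torsion.map_J, self, map_zero, neg_zero, smul_zero,
      smul_zero, add_zero]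

theorem proj_torsion_of_vertical {v : V} (hv : P v = v) (x : V) : P (T v x) = 0 :=
  h.form.eq_zero_of_forall _ fun y ↦ by
    rw [h.symm, h.torsion.skew, h.torsion_vertical hv (h.idem y), map_zero, neg_zero]

theorem curvature_pair_symm (x y z w : V) : B (R x y z) w = B (R z w x) y := by
  refine h.curvature.pair_symm h.form.symm (fun x y z w ↦ ?_) x y z w
  rw [h.bianchi, h.bianchi]
  have hT (x y z w : V) : B (T (T x y) z) w = B (T x y) (T z w) := by
    rw [← h.torsion.form_rotate h.form.symm, h.form.symm]
  simp only [map_add, LinearMap.add_apply, hT]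
  rw [h.torsion.swap x w, h.torsion.swap x y, h.torsion.swap y w, h.form.symm (T z w),
    h.form.symm (-T y w)]
  simp only [map_neg, LinearMap.neg_apply]
  ring

theorem curvature_mixed {v x : V} (hv : P v = v) (hx : P x = 0) (y : V) : R v x y = 0 :=
  h.form.eq_zero_of_forall _ fun z ↦ by
    rw [h.curvature_pair_symm, ← hv, ← h.map_curvature, h.symm, hx, map_zero]

theorem proj_torsion_horizontal {x y : V} (hx : P x = 0) (hy : P y = 0) : P (T x y) = T x y := by
  obtain ⟨v, hv, hv₀⟩ := h.exists_ne_zero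
  have leibniz {x y : V} (hx : P x = 0) (hy : P y = 0) :
      T v (T x y) = (T (T v x) y - P (T (T v x) y)) + (T x (T v y) - P (T x (T v y))) := by
    have vertical : P (R x y v) = R x y v := by rw [h.map_curvature, hv]
    have bianchi := h.bianchi x y v
    rw [h.curvature_mixed hv hx, h.curvature.swap v y x, h.curvature_mixed hv hy, neg_zero,
      add_zero, add_zero, h.torsion.swap v y, map_neg, LinearMap.neg_apply, h.torsion.swap x,
      neg_neg, h.torsion.swap v (T x y)] at bianchi
    rw [bianchi, map_add, map_add, map_neg, h.proj_torsion_of_vertical hv] at vertical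
    linear_combination (norm := abel) vertical
  have map_J_horizontal {x : V} (hx : P x = 0) : P (J x) = 0 := by rw [h.map_J, hx, map_zero]
  have J_zero : J (T v (T x y)) = 0 := by
    have h₁ := leibniz (map_J_horizontal hx) hy
    have h₂ := leibniz hx (map_J_horizontal hy)
    simp only [h.torsion.map_J, h.torsion.map_J_left, map_neg, LinearMap.neg_apply, neg_neg,
      h.map_J] at h₁ h₂
    have h₃ : (2 : ℝ) • J (T v (T x y)) = 0 := by
      linear_combination (norm := module) h₁ + h₂
    exact (smul_eq_zero.1 h₃).resolve_left two_ne_zero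
  have zero : T v (T x y) = 0 := by rw [← neg_eq_zero, ← h.form.sq, J_zero, map_zero]
  have h₁ := h.injective v (T x y - P (T x y)) hv hv₀ (h.proj_sub_proj _) (by
    rw [map_sub, zero, h.torsion_vertical hv (h.idem _), sub_zero])
  exact (sub_eq_zero.1 h₁).symm

theorem isTwistorSplitting : IsTwistorSplitting B J T P where
  idem := h.idem
  symm := h.symm
  map_J := h.map_J
  vertical x y := h.torsion_vertical (h.idem x) (h.idem y)
  map_horizontal x y := by
    have h₁ : P (T (x - P x) (P y)) = 0 := by
      rw [h.torsion.swap, map_neg, h.proj_torsion_of_vertical (h.idem y), neg_zero]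
    rw [← h.proj_torsion_horizontal (h.proj_sub_proj x) (h.proj_sub_proj y),
      map_sub (T (x - P x)), map_sub P (T _ y), h₁, sub_zero]

theorem curvature_J_self {v x : V} (hv : P v = v) (hx : P x = 0) :
    R v (J v) x = -(2 : ℝ) • J (T v (T v x)) := by
  have hJv : P (J v) = J v := by rw [h.map_J, hv]
  have bianchi := h.bianchi v (J v) x
  rw [h.curvature_mixed hJv hx, h.curvature.swap v x, h.curvature_mixed hv hx, neg_zero, add_zero,
    add_zero, h.torsion_vertical hv hJv, map_zero, LinearMap.zero_apply, zero_add,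
    h.torsion.swap v x] at bianchi
  simp only [h.torsion.map_J, h.torsion.map_J_left, map_neg, LinearMap.neg_apply, neg_neg,
    h.torsion.swap v (T v x)] at bianchi
  rw [bianchi]
  module

theorem exists_curvature_eq_smul (x y : V) : ∃ c : ℝ, ∀ v, P v = v → R x y v = c • J v := by
  obtain ⟨v, hv, hv₀⟩ := h.exists_ne_zero
  obtain ⟨a, c, hc⟩ := h.exists_eq_smul_add_smul hv hv₀
    ((h.map_curvature x y v).trans (congrArg (R x y) hv))
  have ha : a = 0 := by
    have skew : B (R x y v) v = 0 := by
      linarith [h.curvature.skew x y v v, h.form.symm v (R x y v)]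
    rw [hc, map_add, LinearMap.add_apply, map_smul, map_smul, LinearMap.smul_apply,
      LinearMap.smul_apply, h.form.apply_J_self, smul_zero, add_zero] at skew
    exact (smul_eq_zero.1 skew).resolve_right (h.pos v hv₀).ne'
  rw [ha, zero_smul, zero_add] at hc
  refine ⟨c, fun w hw ↦ ?_⟩
  obtain ⟨s, t, rfl⟩ := h.exists_eq_smul_add_smul hv hv₀ hw
  simp only [map_add, map_smul, h.curvature.map_J, hc]
  module

theorem exists_hasVerticalCurvature : ∃ k, HasVerticalCurvature B J R P k := by
  obtain ⟨v, hv, hv₀⟩ := h.exists_ne_zero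
  obtain ⟨c, hc⟩ := h.exists_curvature_eq_smul v (J v)
  refine ⟨-c / B v v, fun u w hu hw ↦ ?_⟩
  obtain ⟨a, b, rfl⟩ := h.exists_eq_smul_add_smul hv hv₀ hu
  have hR : R (a • v + b • J v) (J (a • v + b • J v)) w = ((a ^ 2 + b ^ 2) * c) • J w := by
    have := IsAddTorsionFree.of_isTorsionFree ℝ V
    have self (x : V) : R x x w = 0 := self_eq_neg.1 (h.curvature.swap x x w)
    simp only [map_add, map_smul, h.form.sq, LinearMap.add_apply, LinearMap.smul_apply, map_neg,
      LinearMap.neg_apply, self, h.curvature.swap v (J v), hc w hw]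
    module
  have hB : B (a • v + b • J v) (a • v + b • J v) = (a ^ 2 + b ^ 2) * B v v := by
    simp only [map_add, map_smul, LinearMap.add_apply, LinearMap.smul_apply, h.form.symm v (J v),
      h.form.apply_J_self, h.form.isometry, smul_eq_mul]
    ring
  rw [hR, hB]
  congr 1
  field_simp [(h.pos v hv₀).ne']

variable {k : ℝ} (hk : HasVerticalCurvature B J R P k)
include hk

theorem torsion_torsion {v x : V} (hv : P v = v) (hx : P x = 0) :
    T v (T v x) = -(k / 4 * B v v) • x := by
  rcases eq_or_ne v 0 with rfl | hv₀
  · simp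
  have hTx := h.proj_torsion_of_vertical hv
  have leibniz := h.curvature_torsion v (J v) v x
  rw [h.curvature_J_self hv (hTx x), h.curvature_J_self hv hx, hk v v hv hv, map_smul, map_smul,
    LinearMap.smul_apply, h.torsion.map_J, h.torsion.map_J_left] at leibniz
  have zero : T v (J (T v (T v x) + (k / 4 * B v v) • x)) = 0 := by
    rw [h.torsion.map_J, map_add, map_smul, map_add, map_smul]
    linear_combination (norm := module) (4⁻¹ : ℝ) • leibniz
  have hJ := h.injective v _ hv hv₀ (by
    rw [h.map_J, map_add, map_smul, hx, hTx, smul_zero, add_zero, map_zero]) zero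
  have h₁ := congrArg J hJ
  rw [h.form.sq, map_zero, neg_eq_zero] at h₁
  rw [neg_smul, ← add_eq_zero_iff_eq_neg, h₁]

theorem pos_of_exists_horizontal (hP : ∃ x, P x = 0 ∧ x ≠ 0) : 0 < k := by
  obtain ⟨x, hx, hx₀⟩ := hP
  obtain ⟨v, hv, hv₀⟩ := h.exists_ne_zero
  have h₁ := h.pos (T v x) fun h₁ ↦ hx₀ (h.injective v x hv hv₀ hx h₁)
  rw [h.torsion.skew, h.torsion_torsion hk hv hx, map_smul, smul_eq_mul] at h₁
  have := mul_pos (h.pos v hv₀) (h.pos x hx₀)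
  nlinarith

theorem curvature_vertical (x y : V) {v : V} (hv : P v = v) :
    R x y v = (k / 2 * modifiedForm B P (reversedStructure J P x) y) • J v := by
  obtain ⟨u, hu, hu₀⟩ := h.exists_ne_zero
  obtain ⟨c, hc⟩ := h.exists_curvature_eq_smul x y
  have hR : R u (J u) x = (k / 2 * B u u) • (J x - 3 • J (P x)) := by
    rw [← sub_add_cancel x (P x), map_add (R u (J u)),
      h.curvature_J_self hu (h.proj_sub_proj x), h.torsion_torsion hk hu (h.proj_sub_proj x),
      hk u (P x) hu (h.idem x), sub_add_cancel]
    simp only [map_smul, map_sub]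
    module
  have hB : modifiedForm B P (reversedStructure J P x) y = B (J x - 3 • J (P x)) y := by
    rw [modifiedForm_apply, reversedStructure_apply, ← h.symm]
    simp only [map_sub, map_nsmul, h.map_J, h.idem, LinearMap.sub_apply, LinearMap.smul_apply]
    module
  have pair := h.curvature_pair_symm x y u (J u)
  rw [hc u hu, hR, map_smul, map_smul, LinearMap.smul_apply, LinearMap.smul_apply,
    h.form.isometry, ← hB, smul_eq_mul, smul_eq_mul] at pair
  rw [hc v hv]
  congr 1
  exact mul_right_cancel₀ (h.pos u hu₀).ne' (by linarith)

end IsHolonomyPlane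

/-! ### Ricci curvature of the modified metric -/

section Trace

theorem two_mul_trace_of_mul_self_eq_neg_smul {K V : Type*} [Field K] [AddCommGroup V] [Module K V]
    {θ J N Q : Module.End K V} {μ ρ : K} (hμ : μ ≠ 0) (hθ : θ * θ = -μ • Q) (hJ : J * J = -1)
    (hJθ : J * θ = -(θ * J)) (hN : N * θ - θ * N = -ρ • (J * θ)) :
    2 * LinearMap.trace K V (J * N * Q) = ρ * LinearMap.trace K V Q := by
  have h₁ : J * N * (θ * θ) - J * θ * N * θ = ρ • (θ * θ) := by
    calc J * N * (θ * θ) - J * θ * N * θ = J * (N * θ - θ * N) * θ := by noncomm_ring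
      _ = -ρ • (J * J * (θ * θ)) := by
        rw [hN, mul_smul_comm, smul_mul_assoc, mul_assoc, mul_assoc, mul_assoc]
      _ = ρ • (θ * θ) := by rw [hJ, neg_one_mul, neg_smul_neg]
  have h₂ : LinearMap.trace K V (J * θ * N * θ) = -LinearMap.trace K V (J * N * (θ * θ)) := by
    rw [hJθ, neg_mul, neg_mul, map_neg, mul_assoc θ, mul_assoc θ, LinearMap.trace_mul_comm,
      mul_assoc]
  have h₃ := congrArg (LinearMap.trace K V) h₁
  rw [map_sub, h₂, hθ, mul_smul_comm] at h₃
  simp only [map_smul, smul_eq_mul] at h₃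
  exact mul_left_cancel₀ hμ (by linear_combination -h₃)

variable {V : Type*} [AddCommGroup V] [Module ℝ V]

theorem trace_eq_zero_of_conj_eq_neg {K f : Module.End ℝ V} (hK : K * K = 1) (hf : K * f * K = -f) :
    LinearMap.trace ℝ V f = 0 := by
  have h := congrArg (LinearMap.trace ℝ V) hf
  rw [LinearMap.trace_mul_comm, ← mul_assoc, hK, one_mul, map_neg] at h
  linarith

variable {B : V →ₗ[ℝ] V →ₗ[ℝ] ℝ} {J : V →ₗ[ℝ] V} {T : V →ₗ[ℝ] V →ₗ[ℝ] V}
  {R : V →ₗ[ℝ] V →ₗ[ℝ] V →ₗ[ℝ] V} {P : V →ₗ[ℝ] V}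

theorem IsTwistorSplitting.trace_reversedStructure_modifier (hP : IsTwistorSplitting B J T P)
    (u : V) : LinearMap.trace ℝ V (reversedStructure J P ∘ₗ modifier T P u) = 0 := by
  refine trace_eq_zero_of_conj_eq_neg (K := LinearMap.id - (2 : ℝ) • P) ?_ ?_
  · ext x
    simp only [Module.End.mul_apply, Module.End.one_apply, LinearMap.sub_apply, LinearMap.id_apply,
      LinearMap.smul_apply, map_sub, map_smul, hP.idem]
    module
  · ext x
    have h := hP.map_horizontal u
    simp only [Module.End.mul_apply, LinearMap.comp_apply, LinearMap.neg_apply, modifier_apply,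
      reversedStructure_apply, LinearMap.sub_apply, LinearMap.id_apply, LinearMap.smul_apply]
    generalize u - P u = e at h
    simp only [map_add, map_sub, map_smul, map_nsmul, h, hP.map_J, hP.idem]
    module

theorem IsTwistorSplitting.trace_reversedStructure_comp (hP : IsTwistorSplitting B J T P)
    (hT : IsTypeThreeZero B J T) {N : V →ₗ[ℝ] V} {u v w : V} {S : V →ₗ[ℝ] V}
    (hS : ∀ x, S x = N x + modifier T P w x
      + (modifier T P u (modifier T P v x) - modifier T P v (modifier T P u x))) :
    LinearMap.trace ℝ V (reversedStructure J P ∘ₗ S)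
      = LinearMap.trace ℝ V (reversedStructure J P ∘ₗ N) := by
  have comm (u : V) : reversedStructure J P ∘ₗ modifier T P u
      = modifier T P u ∘ₗ reversedStructure J P :=
    LinearMap.ext fun x ↦ (hP.modifier_reversedStructure hT u x).symm
  have bracket : LinearMap.trace ℝ V (reversedStructure J P ∘ₗ modifier T P u ∘ₗ modifier T P v)
      = LinearMap.trace ℝ V (reversedStructure J P ∘ₗ modifier T P v ∘ₗ modifier T P u) := by
    rw [← LinearMap.comp_assoc, comm, LinearMap.comp_assoc]
    exact (LinearMap.trace_mul_comm ..).trans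
      (congrArg _ (LinearMap.comp_assoc _ (modifier T P v) _))
  have hS' : S = N + modifier T P w
      + (modifier T P u ∘ₗ modifier T P v - modifier T P v ∘ₗ modifier T P u) :=
    LinearMap.ext hS
  rw [hS', LinearMap.comp_add, LinearMap.comp_add, LinearMap.comp_sub, map_add, map_add, map_sub,
    bracket, hP.trace_reversedStructure_modifier, sub_self, add_zero, add_zero]

namespace IsHolonomyPlane

variable [FiniteDimensional ℝ V] (h : IsHolonomyPlane B J T R P)
include h

theorem trace_proj : LinearMap.trace ℝ V P = 2 := by
  have hP : LinearMap.IsProj (LinearMap.range P) P :=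
    ⟨LinearMap.mem_range_self P, by rintro _ ⟨x, rfl⟩; exact h.idem x⟩
  rw [hP.trace, h.finrank_range, Nat.cast_ofNat]

variable {n : ℕ} (hn : Module.finrank ℝ V = 2 * n) {k : ℝ} (hk : HasVerticalCurvature B J R P k)
include hn hk

/-- The curvature operator of the Hermitian connection commutes, up to its action on a vertical
vector `v`, with `T v`, whose square is a multiple of the projection to the horizontal space; hence
its trace on the horizontal space is determined by its action on the vertical plane. -/
theorem trace_reversedStructure_curvature (hk₀ : k ≠ 0) (x y : V) :
    LinearMap.trace ℝ V (reversedStructure J P ∘ₗ R x y)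
      = (n + 1) * (k / 2 * modifiedForm B P (reversedStructure J P x) y) := by
  obtain ⟨v, hv, hv₀⟩ := h.exists_ne_zero
  have hR {w : V} (hw : P w = w) := h.curvature_vertical hk x y hw
  set ρ := k / 2 * modifiedForm B P (reversedStructure J P x) y
  have sq : T v * T v = -(k / 4 * B v v) • (LinearMap.id - P) := LinearMap.ext fun w ↦ by
    have h₁ := h.torsion_torsion hk hv (h.proj_sub_proj w)
    rwa [map_sub (T v) w, h.torsion_vertical hv (h.idem w), sub_zero] at h₁
  have hJ : J * J = -1 := LinearMap.ext h.form.sq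
  have anti : J * T v = -(T v * J) := LinearMap.ext fun w ↦ by
    rw [LinearMap.neg_apply, Module.End.mul_apply, Module.End.mul_apply, h.torsion.map_J, neg_neg]
  have comm : R x y * T v - T v * R x y = -ρ • (J * T v) := LinearMap.ext fun w ↦ by
    simp only [LinearMap.sub_apply, LinearMap.smul_apply, Module.End.mul_apply,
      h.curvature_torsion, hR hv, map_smul, LinearMap.smul_apply, h.torsion.map_J_left]
    module
  have horizontal := two_mul_trace_of_mul_self_eq_neg_smul
    (mul_ne_zero (div_ne_zero hk₀ four_ne_zero) (h.pos v hv₀).ne') sq hJ anti comm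
  have decomp : reversedStructure J P ∘ₗ R x y = J * R x y * (LinearMap.id - P) + ρ • P :=
    LinearMap.ext fun w ↦ by
      simp only [LinearMap.comp_apply, LinearMap.add_apply, LinearMap.smul_apply,
        LinearMap.sub_apply, LinearMap.id_apply, Module.End.mul_apply, map_sub,
        reversedStructure_apply, h.map_curvature, hR (h.idem w), map_smul, h.form.sq]
      module
  rw [map_sub, h.trace_proj, LinearMap.trace_id, hn] at horizontal
  rw [decomp, map_add, map_smul, h.trace_proj, smul_eq_mul]
  push_cast at horizontal
  linear_combination horizontal / 2

theorem ricciTensor_eq (hk₀ : k ≠ 0) {S : V →ₗ[ℝ] V →ₗ[ℝ] V →ₗ[ℝ] V}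
    (hS : IsKahlerCurvature (modifiedForm B P) (reversedStructure J P) S)
    (hSR : ∀ x y z, S x y z = R x y z + modifier T P (T x y) z
      + (modifier T P x (modifier T P y z) - modifier T P y (modifier T P x z))) (x y : V) :
    ricciTensor S x y = (n + 1) * k / 4 * modifiedForm B P x y := by
  have := IsAddTorsionFree.of_isTorsionFree ℝ V
  have hP := h.isTwistorSplitting
  have hB := hP.isHermitianForm h.form
  have trace := hS.trace_J_comp hB (reversedStructure J P y) x
  rw [hP.trace_reversedStructure_comp h.torsion (hSR _ _),
    h.trace_reversedStructure_curvature hn hk hk₀, hB.sq] at trace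
  simp only [map_neg, LinearMap.neg_apply, hB.symm y x] at trace
  have neg : ricciTensor S x (-y) = -ricciTensor S x y := by
    rw [ricciTensor, map_neg, map_neg, ricciTensor]
  linear_combination trace / 2 + neg

end IsHolonomyPlane

end Trace

end Plane

/-! ### The Lie–Rinehart algebra of smooth vector fields -/

section SmoothVectorField

variable {E : Type*} [NormedAddCommGroup E] [NormedSpace ℝ E]
  {M : Type*} [TopologicalSpace M] [ChartedSpace E M]

variable (E M) in
/-- The ring of smooth real functions on `M`. -/
abbrev SmoothFunction : Type _ := C^∞⟮𝓘(ℝ, E), M; 𝓘(ℝ, ℝ), ℝ⟯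

theorem SmoothFunction.mdifferentiableAt (f : SmoothFunction E M) (x : M) :
    MDiffAt (fun y ↦ f y) x :=
  f.contMDiff.mdifferentiableAt (by simp)

variable [IsManifold 𝓘(ℝ, E) ∞ M]

variable (E M) in
/-- The smooth vector fields on `M`. -/
abbrev SmoothVectorField : Type _ :=
  Cₛ^∞⟮𝓘(ℝ, E); E, (fun x : M ↦ TangentSpace 𝓘(ℝ, E) x)⟯

namespace SmoothVectorField

instance : Module (SmoothFunction E M) (SmoothVectorField E M) where
  smul f X := ⟨(fun y ↦ f y) • fun y ↦ X y, f.contMDiff.smul_section X.contMDiff⟩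
  one_smul X := by ext x; exact one_smul ℝ (X x)
  mul_smul f h X := by ext x; exact mul_smul (f x) (h x) (X x)
  smul_zero f := by ext x; exact smul_zero (f x)
  smul_add f X Y := by ext x; exact smul_add (f x) (X x) (Y x)
  add_smul f h X := by ext x; exact add_smul (f x) (h x) (X x)
  zero_smul X := by ext x; exact zero_smul ℝ (X x)

theorem smul_apply (f : SmoothFunction E M) (X : SmoothVectorField E M) (x : M) :
    (f • X) x = f x • X x := rfl

instance : IsScalarTower ℝ (SmoothFunction E M) (SmoothVectorField E M) where
  smul_assoc r f X := by ext x; exact smul_assoc r (f x) (X x)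

variable (E) in
/-- Evaluation of smooth vector fields at the point `x`. -/
def eval (x : M) : SmoothVectorField E M →ₗ[ℝ] TangentSpace 𝓘(ℝ, E) x where
  toFun X := X x
  map_add' _ _ := rfl
  map_smul' _ _ := rfl

@[simp]
theorem eval_apply (x : M) (X : SmoothVectorField E M) : eval E x X = X x := rfl

instance : Bracket (SmoothVectorField E M) (SmoothFunction E M) where
  bracket X f :=
    ⟨fun x ↦ mvfderiv 𝓘(ℝ, E) (fun y ↦ f y) x (X x), by
      have h : ContMDiff 𝓘(ℝ, E) 𝓘(ℝ, ℝ).tangent ∞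
          (fun x ↦ tangentMap 𝓘(ℝ, E) 𝓘(ℝ, ℝ) f ⟨x, X x⟩) :=
        (f.contMDiff.contMDiff_tangentMap (m := ∞) (by simp)).comp X.contMDiff
      exact (contMDiff_snd_tangentBundle_modelSpace ℝ 𝓘(ℝ, ℝ)).comp h⟩

theorem lie_function_apply (X : SmoothVectorField E M) (f : SmoothFunction E M) (x : M) :
    ⁅X, f⁆ x = mvfderiv 𝓘(ℝ, E) (fun y ↦ f y) x (X x) := rfl

variable [FiniteDimensional ℝ E]

instance : Bracket (SmoothVectorField E M) (SmoothVectorField E M) where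
  bracket X Y :=
    have : CompleteSpace E := FiniteDimensional.complete ℝ E
    have : IsManifold 𝓘(ℝ, E) (minSmoothness ℝ 2) M := by
      rw [minSmoothness_of_isRCLikeNormedField]
      infer_instance
    have : IsManifold 𝓘(ℝ, E) (((⊤ : ℕ∞) : ℕ∞ω) + 1) M :=
      inferInstanceAs (IsManifold 𝓘(ℝ, E) ∞ M)
    ⟨mlieBracket 𝓘(ℝ, E) (fun y ↦ X y) (fun y ↦ Y y),
      fun _ ↦ ContMDiffAt.mlieBracket_vectorField (n := (⊤ : ℕ∞)) (m := (⊤ : ℕ∞))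
        X.contMDiff.contMDiffAt Y.contMDiff.contMDiffAt (by simp)⟩

instance : LieRing (SmoothVectorField E M) where
  add_lie X X' Y := by
    have : CompleteSpace E := FiniteDimensional.complete ℝ E
    ext x
    exact mlieBracket_add_left X.mdifferentiableAt X'.mdifferentiableAt
  lie_add X Y Y' := by
    have : CompleteSpace E := FiniteDimensional.complete ℝ E
    ext x
    exact mlieBracket_add_right Y.mdifferentiableAt Y'.mdifferentiableAt
  lie_self X := by
    ext x
    exact congrFun mlieBracket_self x
  leibniz_lie X Y Z := by
    have : CompleteSpace E := FiniteDimensional.complete ℝ E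
    have : IsManifold 𝓘(ℝ, E) (minSmoothness ℝ 3) M := by
      rw [minSmoothness_of_isRCLikeNormedField]
      infer_instance
    have h (W : SmoothVectorField E M) (x : M) :
        CMDiffAt (minSmoothness ℝ 2) (T% (fun y ↦ W y)) x := by
      rw [minSmoothness_of_isRCLikeNormedField]
      exact (W.contMDiff x).of_le ENat.LEInfty.out
    ext x
    exact leibniz_identity_mlieBracket_apply (h X x) (h Y x) (h Z x)

theorem lie_function_smul (X : SmoothVectorField E M) (f : SmoothFunction E M)
    (Y : SmoothVectorField E M) : ⁅X, f • Y⁆ = f • ⁅X, Y⁆ + ⁅X, f⁆ • Y := by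
  have : CompleteSpace E := FiniteDimensional.complete ℝ E
  ext x
  exact (mlieBracket_smul_right (V := fun y ↦ X y) (f.mdifferentiableAt x)
    Y.mdifferentiableAt).trans (add_comm _ _)

theorem exists_bump [T2Space M] {x : M} {U : Set M} (hU : U ∈ nhds x) :
    ∃ χ : SmoothFunction E M, (∀ᶠ y in nhds x, χ y = 1) ∧ tsupport χ ⊆ U := by
  obtain ⟨f, -, hf⟩ := (SmoothBumpFunction.nhds_basis_tsupport (I := 𝓘(ℝ, E)) x).mem_iff.1 hU
  exact ⟨⟨f, f.contMDiff⟩, f.eventuallyEq_one, hf⟩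

theorem exists_eventuallyEq [T2Space M] {x : M} {U : Set M} (hU : U ∈ nhds x)
    {s : Π x : M, TangentSpace 𝓘(ℝ, E) x} (hs : CMDiff[U] ∞ (T% s)) :
    ∃ X : SmoothVectorField E M, ∀ᶠ y in nhds x, X y = s y := by
  obtain ⟨V, hVU, hV, hxV⟩ := mem_nhds_iff.1 hU
  obtain ⟨χ, hχ, hsupp⟩ := exists_bump (E := E) (hV.mem_nhds hxV)
  refine ⟨⟨(fun y ↦ χ y) • s, ContMDiffOn.smul_section_of_tsupport
    χ.contMDiff.contMDiffOn hV hsupp (hs.mono hVU)⟩, ?_⟩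
  filter_upwards [hχ] with y hy
  change χ y • s y = s y
  rw [hy, one_smul]

theorem exists_smoothFunction_eventuallyEq [T2Space M] {x : M} {U : Set M} (hU : U ∈ nhds x)
    {u : M → ℝ} (hu : CMDiff[U] ∞ u) : ∃ f : SmoothFunction E M, ∀ᶠ y in nhds x, f y = u y := by
  obtain ⟨V, hVU, hV, hxV⟩ := mem_nhds_iff.1 hU
  obtain ⟨χ, hχ, hsupp⟩ := exists_bump (E := E) (hV.mem_nhds hxV)
  refine ⟨⟨fun y ↦ χ y • u y, contMDiff_of_tsupport fun y hy ↦ ?_⟩, ?_⟩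
  · have hyV : y ∈ V := hsupp (closure_mono (Function.support_smul_subset_left _ _) hy)
    exact χ.contMDiff.contMDiffAt.smul ((hu.mono hVU).contMDiffAt (hV.mem_nhds hyV))
  · filter_upwards [hχ] with y hy
    change χ y • u y = u y
    rw [hy, one_smul]

theorem exists_eventuallyEq_extend [T2Space M] {x : M} (v : TangentSpace 𝓘(ℝ, E) x) :
    ∃ X : SmoothVectorField E M, ∀ᶠ y in nhds x, X y = extend E v y := by
  obtain ⟨U, hU, h⟩ := exists_contMDiffOn_extend (k := ∞) 𝓘(ℝ, E) E v
  exact exists_eventuallyEq hU h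

theorem eval_surjective [T2Space M] (x : M) : Function.Surjective (eval E x) := by
  intro v
  obtain ⟨X, hX⟩ := exists_eventuallyEq_extend v
  exact ⟨X, hX.self_of_nhds.trans (extend_apply_self E v)⟩

theorem lie_lie_function [T2Space M] (X Y : SmoothVectorField E M) (f : SmoothFunction E M) :
    ⁅⁅X, Y⁆, f⁆ = ⁅X, ⁅Y, f⁆⁆ - ⁅Y, ⁅X, f⁆⁆ := by
  ext x
  obtain hx | hx := subsingleton_or_nontrivial (TangentSpace 𝓘(ℝ, E) x)
  · have h (W : SmoothVectorField E M) (u : SmoothFunction E M) : ⁅W, u⁆ x = 0 := by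
      rw [lie_function_apply, Subsingleton.elim (W x) 0, map_zero]
    exact (h _ _).trans ((congrArg₂ (· - ·) (h _ _) (h _ _)).trans (sub_zero _)).symm
  · obtain ⟨v, hv⟩ := exists_ne (0 : TangentSpace 𝓘(ℝ, E) x)
    obtain ⟨Z, rfl⟩ := eval_surjective x v
    -- compare the coefficients of `Z` in the Jacobi identity for `X`, `Y` and `f • Z`
    have jacobi := lie_lie X Y (f • Z)
    simp only [lie_function_smul, lie_add] at jacobi
    have h : (⁅⁅X, Y⁆, f⁆ - (⁅X, ⁅Y, f⁆⁆ - ⁅Y, ⁅X, f⁆⁆)) • Z = 0 := by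
      linear_combination (norm := module) jacobi - f • lie_lie X Y Z
    have hx := (smul_eq_zero.1 (congrArg (eval E x) h)).resolve_right hv
    exact sub_eq_zero.1 hx

instance [T2Space M] : LieRingModule (SmoothVectorField E M) (SmoothFunction E M) where
  add_lie X Y f := by
    ext x
    exact map_add (mvfderiv 𝓘(ℝ, E) (fun y ↦ f y) x) (X x) (Y x)
  lie_add X f h := by
    ext x
    exact congrArg (· (X x)) (mvfderiv_add (f.mdifferentiableAt x) (h.mdifferentiableAt x))
  leibniz_lie X Y f := by rw [lie_lie_function, sub_add_cancel]

instance [T2Space M] : LieRinehartRing (SmoothFunction E M) (SmoothVectorField E M) where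
  lie_smul_eq_mul' f h X := by
    ext x
    exact map_smul (mvfderiv 𝓘(ℝ, E) (fun y ↦ h y) x) (f x) (X x)
  leibniz_mul_right' X f h := by
    ext x
    have := congrArg (· (X x)) (mvfderiv_mul (f.mdifferentiableAt x) (h.mdifferentiableAt x))
    exact this.trans (congrArg₂ _ rfl (mul_comm _ _))
  leibniz_smul_right' X Y f := lie_function_smul X f Y

end SmoothVectorField

end SmoothVectorField

/-! ### Tensors -/

section Tensor

variable {E : Type*} [NormedAddCommGroup E] [NormedSpace ℝ E]
  {M : Type*} [TopologicalSpace M] [ChartedSpace E M]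

variable (E) in
/-- The ideal of the smooth functions vanishing at `x`. -/
def vanishingIdeal (x : M) : Ideal (SmoothFunction E M) :=
  RingHom.ker (ContMDiffMap.evalRingHom x)

theorem mem_vanishingIdeal {x : M} {f : SmoothFunction E M} :
    f ∈ vanishingIdeal E x ↔ f x = 0 := Iff.rfl

variable [FiniteDimensional ℝ E] [IsManifold 𝓘(ℝ, E) ∞ M] [T2Space M]

namespace SmoothVectorField

theorem exists_eventuallyEq_sum_smul (X : SmoothVectorField E M) {x : M} (h : X x = 0) :
    ∃ (n : ℕ) (f : Fin n → SmoothFunction E M) (Y : Fin n → SmoothVectorField E M),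
      (∀ i, f i x = 0) ∧ ∀ᶠ y in nhds x, X y = ∑ i, f i y • Y i y := by
  let t := trivializationAt E (fun x : M ↦ TangentSpace 𝓘(ℝ, E) x) x
  have hx : x ∈ t.baseSet := mem_baseSet_trivializationAt E _ x
  have ht : t.baseSet ∈ nhds x := t.open_baseSet.mem_nhds hx
  let b := Module.finBasis ℝ E
  choose Y hY using fun i ↦ exists_eventuallyEq ht (t.contMDiffOn_localFrame_baseSet ∞ b i)
  choose f hf using fun i ↦ exists_smoothFunction_eventuallyEq ht
    (contMDiffOn_baseSet_localFrameCoeff b X.contMDiff.contMDiffOn i)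
  refine ⟨_, f, Y, fun i ↦ ?_, ?_⟩
  · exact (hf i).self_of_nhds.trans
      ((congrArg (t.localFrameCoeff 𝓘(ℝ, E) b i x) h).trans (map_zero _))
  · filter_upwards [t.eventually_eq_localFrame_sum_coeff_smul (I := 𝓘(ℝ, E)) (s := X) b hx,
      Filter.eventually_all.2 hY, Filter.eventually_all.2 hf] with y hXy hYy hfy
    exact hXy.trans (Finset.sum_congr rfl fun i _ ↦ (congrArg₂ (· • ·) (hfy i) (hYy i)).symm)

theorem mem_vanishingIdeal_smul_top {X : SmoothVectorField E M} {x : M} (h : X x = 0) :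
    X ∈ vanishingIdeal E x • (⊤ : Submodule (SmoothFunction E M) (SmoothVectorField E M)) := by
  obtain ⟨n, f, Y, hf, hX⟩ := X.exists_eventuallyEq_sum_smul h
  obtain ⟨χ, hχ, hsupp⟩ := exists_bump (E := E) hX
  have hsum (y : M) : (∑ i, f i • Y i) y = ∑ i, f i y • Y i y := map_sum (eval E y) _ _
  have hX : X = (1 - χ) • X + χ • ∑ i, f i • Y i := by
    ext y
    change X y = (1 - χ y) • X y + χ y • (∑ i, f i • Y i) y
    by_cases hy : y ∈ tsupport χ
    · rw [hsum, ← hsupp hy]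
      module
    · rw [image_eq_zero_of_notMem_tsupport hy]
      module
  rw [hX]
  refine add_mem (Submodule.smul_mem_smul ?_ trivial) (Submodule.smul_mem _ _
    (sum_mem fun i _ ↦ Submodule.smul_mem_smul (hf i) trivial))
  exact sub_eq_zero.2 hχ.self_of_nhds.symm

theorem map_apply_eq_zero (Φ : SmoothVectorField E M →ₗ[SmoothFunction E M] SmoothVectorField E M)
    {X : SmoothVectorField E M} {x : M} (h : X x = 0) : Φ X x = 0 := by
  refine Submodule.smul_induction_on (mem_vanishingIdeal_smul_top h) (fun f hf Y _ ↦ ?_)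
    fun Y Z hY hZ ↦ ?_
  · rw [map_smul, smul_apply, mem_vanishingIdeal.1 hf, zero_smul]
  · rw [map_add, ← eval_apply, map_add, eval_apply, eval_apply, hY, hZ, add_zero]

theorem map_apply_congr (Φ : SmoothVectorField E M →ₗ[SmoothFunction E M] SmoothVectorField E M)
    {X Y : SmoothVectorField E M} {x : M} (h : X x = Y x) : Φ X x = Φ Y x := by
  have h₀ : (X - Y) x = 0 := sub_eq_zero.2 h
  have h₁ := map_apply_eq_zero Φ h₀
  rw [map_sub] at h₁
  exact sub_eq_zero.1 h₁

variable (E) in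
/-- A linear choice of a smooth vector field with a given value at `x`. -/
def extension (x : M) : TangentSpace 𝓘(ℝ, E) x →ₗ[ℝ] SmoothVectorField E M :=
  ((eval E x).exists_rightInverse_of_surjective
    (LinearMap.range_eq_top.2 (eval_surjective x))).choose

@[simp]
theorem extension_apply_self (x : M) (v : TangentSpace 𝓘(ℝ, E) x) : extension E x v x = v :=
  LinearMap.congr_fun ((eval E x).exists_rightInverse_of_surjective
    (LinearMap.range_eq_top.2 (eval_surjective x))).choose_spec v

/-- The value at `x` of a trilinear operation on vector fields. -/
def tensorAt (S : SmoothVectorField E M →ₗ[SmoothFunction E M] SmoothVectorField E M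
      →ₗ[SmoothFunction E M] SmoothVectorField E M →ₗ[SmoothFunction E M] SmoothVectorField E M)
    (x : M) : TangentSpace 𝓘(ℝ, E) x →ₗ[ℝ] TangentSpace 𝓘(ℝ, E) x →ₗ[ℝ]
      TangentSpace 𝓘(ℝ, E) x →ₗ[ℝ] TangentSpace 𝓘(ℝ, E) x where
  toFun u := LinearMap.mk₂ ℝ
    (fun v w ↦ eval E x (S (extension E x u) (extension E x v) (extension E x w)))
    (fun v v' w ↦ by simp only [map_add, LinearMap.add_apply])
    (fun r v w ↦ by simp only [map_smul, LinearMap.map_smul_of_tower, LinearMap.smul_apply])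
    (fun v w w' ↦ by simp only [map_add])
    (fun r v w ↦ by simp only [map_smul, LinearMap.map_smul_of_tower])
  map_add' u u' := LinearMap.ext₂ fun v w ↦ by
    simp only [LinearMap.mk₂_apply, map_add, LinearMap.add_apply]
  map_smul' r u := LinearMap.ext₂ fun v w ↦ by
    simp only [LinearMap.mk₂_apply, map_smul, LinearMap.map_smul_of_tower, LinearMap.smul_apply,
      RingHom.id_apply]

theorem tensorAt_apply (S : SmoothVectorField E M →ₗ[SmoothFunction E M] SmoothVectorField E M
      →ₗ[SmoothFunction E M] SmoothVectorField E M →ₗ[SmoothFunction E M] SmoothVectorField E M)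
    (X Y Z : SmoothVectorField E M) (x : M) : tensorAt S x (X x) (Y x) (Z x) = S X Y Z x := by
  have hX := extension_apply_self x (X x)
  have hY := extension_apply_self x (Y x)
  have hZ := extension_apply_self x (Z x)
  exact (map_apply_congr (S _ _) hZ).trans ((map_apply_congr ((S _).flip Z) hY).trans
    (map_apply_congr ((S.flip Y).flip Z) hX))

end SmoothVectorField

end Tensor

/-! ### Smoothness criteria -/

section Smoothness

variable {E : Type*} [NormedAddCommGroup E] [NormedSpace ℝ E]
  {M : Type*} [TopologicalSpace M] [ChartedSpace E M]
  {F₁ : Type*} [NormedAddCommGroup F₁] [NormedSpace ℝ F₁] {V₁ : M → Type*}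
  [TopologicalSpace (TotalSpace F₁ V₁)] [∀ x, AddCommGroup (V₁ x)] [∀ x, Module ℝ (V₁ x)]
  [∀ x, TopologicalSpace (V₁ x)] [FiberBundle F₁ V₁] [VectorBundle ℝ F₁ V₁]
  {F₂ : Type*} [NormedAddCommGroup F₂] [NormedSpace ℝ F₂] {V₂ : M → Type*}
  [TopologicalSpace (TotalSpace F₂ V₂)] [∀ x, AddCommGroup (V₂ x)] [∀ x, Module ℝ (V₂ x)]
  [∀ x, TopologicalSpace (V₂ x)] [FiberBundle F₂ V₂] [VectorBundle ℝ F₂ V₂]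

theorem inCoordinates_apply_trivializationAt {x y : M}
    (h₁ : y ∈ (trivializationAt F₁ V₁ x).baseSet) (h₂ : y ∈ (trivializationAt F₂ V₂ x).baseSet)
    (φ : V₁ y →L[ℝ] V₂ y) (v : V₁ y) :
    ContinuousLinearMap.inCoordinates F₁ V₁ F₂ V₂ x y x y φ (trivializationAt F₁ V₁ x ⟨y, v⟩).2 =
      (trivializationAt F₂ V₂ x ⟨y, φ v⟩).2 := by
  rw [ContinuousLinearMap.inCoordinates_eq h₁ h₂]
  exact congrArg (fun w ↦ (trivializationAt F₂ V₂ x ⟨y, φ w⟩).2)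
    (((trivializationAt F₁ V₁ x).continuousLinearEquivAt ℝ y h₁).symm_apply_apply v)

variable [∀ x, IsTopologicalAddGroup (V₂ x)] [∀ x, ContinuousSMul ℝ (V₂ x)]

theorem contMDiff_of_clm_bundle_apply [CompleteSpace F₁] {φ : Π x : M, V₁ x →L[ℝ] V₂ x}
    (hφ : ContMDiff 𝓘(ℝ, E) (𝓘(ℝ, E).prod 𝓘(ℝ, F₁ →L[ℝ] F₂)) ∞
      (fun x ↦ TotalSpace.mk' (F₁ →L[ℝ] F₂) (E := fun x ↦ V₁ x →L[ℝ] V₂ x) x (φ x)))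
    (hinv : ∀ x, (φ x).IsInvertible) {s : Π x : M, V₁ x}
    (hs : ContMDiff 𝓘(ℝ, E) (𝓘(ℝ, E).prod 𝓘(ℝ, F₂)) ∞
      (fun x ↦ TotalSpace.mk' F₂ x (φ x (s x)))) :
    ContMDiff 𝓘(ℝ, E) (𝓘(ℝ, E).prod 𝓘(ℝ, F₁)) ∞ (fun x ↦ TotalSpace.mk' F₁ x (s x)) := by
  intro x
  let t₁ := trivializationAt F₁ V₁ x
  let t₂ := trivializationAt F₂ V₂ x
  have hx₁ : x ∈ t₁.baseSet := mem_baseSet_trivializationAt F₁ V₁ x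
  have hx₂ : x ∈ t₂.baseSet := mem_baseSet_trivializationAt F₂ V₂ x
  let Φ (y : M) : F₁ →L[ℝ] F₂ := ContinuousLinearMap.inCoordinates F₁ V₁ F₂ V₂ x y x y (φ y)
  have hΦ (y : M) (h₁ : y ∈ t₁.baseSet) (h₂ : y ∈ t₂.baseSet) : (Φ y).IsInvertible := by
    simp only [Φ]
    rw [ContinuousLinearMap.inCoordinates_eq h₁ h₂]
    exact ContinuousLinearMap.isInvertible_equiv.comp
      ((hinv y).comp ContinuousLinearMap.isInvertible_equiv)
  have hΦinv : ContMDiffAt 𝓘(ℝ, E) 𝓘(ℝ, F₂ →L[ℝ] F₁) ∞ (fun y ↦ (Φ y).inverse) x :=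
    (hΦ x hx₁ hx₂).contDiffAt_map_inverse.contMDiffAt.comp x ((contMDiffAt_hom_bundle _).1 (hφ x)).2
  refine contMDiffAt_totalSpace.2 ⟨contMDiffAt_id, ?_⟩
  refine (hΦinv.clm_apply (contMDiffAt_totalSpace.1 (hs x)).2).congr_of_eventuallyEq ?_
  filter_upwards [t₁.open_baseSet.mem_nhds hx₁, t₂.open_baseSet.mem_nhds hx₂] with y h₁ h₂
  exact ((hΦ y h₁ h₂).inverse_apply_eq.2
    (inCoordinates_apply_trivializationAt h₁ h₂ (φ y) (s y)).symm).symm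

variable [FiniteDimensional ℝ E]

theorem contMDiffAt_of_forall_apply {Φ : M → E →L[ℝ] F₂} {x : M}
    (h : ∀ v, ContMDiffAt 𝓘(ℝ, E) 𝓘(ℝ, F₂) ∞ (fun y ↦ Φ y v) x) :
    ContMDiffAt 𝓘(ℝ, E) 𝓘(ℝ, E →L[ℝ] F₂) ∞ Φ x := by
  let b := Module.finBasis ℝ E
  let c (i) : E →L[ℝ] ℝ := LinearMap.toContinuousLinearMap (b.coord i)
  have hsum : Φ = fun y ↦ ∑ i, ContinuousLinearMap.smulRightL ℝ E F₂ (c i) (Φ y (b i)) := by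
    ext y v
    rw [sum_apply]
    conv_lhs => rw [← b.sum_repr v, map_sum]
    exact Finset.sum_congr rfl fun i _ ↦ map_smul (Φ y) _ _
  rw [hsum]
  exact ContMDiffAt.sum fun i _ ↦
    (ContinuousLinearMap.smulRightL ℝ E F₂ (c i)).contDiff.comp_contMDiffAt (h (b i))

variable [IsManifold 𝓘(ℝ, E) ∞ M] [T2Space M]

theorem contMDiff_hom_of_apply {φ : Π x : M, TangentSpace 𝓘(ℝ, E) x →L[ℝ] V₂ x}
    (h : ∀ Z : SmoothVectorField E M, ContMDiff 𝓘(ℝ, E) (𝓘(ℝ, E).prod 𝓘(ℝ, F₂)) ∞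
      (fun x ↦ TotalSpace.mk' F₂ x (φ x (Z x)))) :
    ContMDiff 𝓘(ℝ, E) (𝓘(ℝ, E).prod 𝓘(ℝ, E →L[ℝ] F₂)) ∞
      (fun x ↦ TotalSpace.mk' (E →L[ℝ] F₂)
        (E := fun x : M ↦ TangentSpace 𝓘(ℝ, E) x →L[ℝ] V₂ x) x (φ x)) := by
  refine fun x ↦ (contMDiffAt_hom_bundle _).2
    ⟨contMDiffAt_id, contMDiffAt_of_forall_apply fun v ↦ ?_⟩
  let t := trivializationAt E (fun x : M ↦ TangentSpace 𝓘(ℝ, E) x) x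
  let t₂ := trivializationAt F₂ V₂ x
  have ht : t.baseSet ∈ nhds x := t.open_baseSet.mem_nhds (mem_baseSet_trivializationAt E _ x)
  have ht₂ : t₂.baseSet ∈ nhds x := t₂.open_baseSet.mem_nhds (mem_baseSet_trivializationAt F₂ _ x)
  obtain ⟨Z, hZ⟩ := SmoothVectorField.exists_eventuallyEq_extend (E := E) (x := x) (t.symm x v)
  refine (contMDiffAt_totalSpace.1 (h Z x)).2.congr_of_eventuallyEq ?_
  filter_upwards [ht, ht₂, hZ] with y hy hy₂ hZy
  have hv : (t ⟨y, Z y⟩).2 = v := by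
    rw [hZy, extend, t.apply_mk_symm hy, t.apply_mk_symm (mem_baseSet_trivializationAt E _ x)]
  rw [← hv]
  exact inCoordinates_apply_trivializationAt hy hy₂ (φ y) (Z y)

end Smoothness

/-! ### The Levi-Civita connection on smooth vector fields -/

section LeviCivita

variable {E : Type*} [NormedAddCommGroup E] [NormedSpace ℝ E]
  {M : Type*} [TopologicalSpace M] [ChartedSpace E M] [IsManifold 𝓘(ℝ, E) ∞ M]

/-- The Riemannian metric as a bilinear form on the module of smooth vector fields. -/
def Metric.fieldForm (g : Metric E M) :
    SmoothVectorField E M →ₗ[SmoothFunction E M] SmoothVectorField E M →ₗ[SmoothFunction E M]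
      SmoothFunction E M :=
  LinearMap.mk₂ _
    (fun X Y ↦ ⟨fun y ↦ g.inner y (X y) (Y y), fun x ↦ (contMDiffAt_totalSpace.1
      (ContMDiff.clm_bundle_apply₂ (F₁ := E) (F₂ := E) (E₃ := Bundle.Trivial M ℝ)
        g.contMDiff X.contMDiff Y.contMDiff x)).2⟩)
    (fun X X' Y ↦ by ext x; exact congrArg (· (Y x)) (map_add (g.inner x) (X x) (X' x)))
    (fun f X Y ↦ by ext x; exact congrArg (· (Y x)) (map_smul (g.inner x) (f x) (X x)))
    (fun X Y Y' ↦ by ext x; exact map_add (g.inner x (X x)) (Y x) (Y' x))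
    (fun f X Y ↦ by ext x; exact map_smul (g.inner x (X x)) (f x) (Y x))

theorem Metric.fieldForm_apply (g : Metric E M) (X Y : SmoothVectorField E M) (x : M) :
    g.fieldForm X Y x = g.inner x (X x) (Y x) := rfl

theorem Metric.fieldForm_symm (g : Metric E M) (X Y : SmoothVectorField E M) :
    g.fieldForm X Y = g.fieldForm Y X := by
  ext x
  exact g.symm x (X x) (Y x)

variable [FiniteDimensional ℝ E]

theorem Metric.isInvertible_inner (g : Metric E M) (x : M) : (g.inner x).IsInvertible :=
  ⟨(((g.form x).toDual (g.form_nondegenerate x)).trans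
    LinearMap.toContinuousLinearMap).toContinuousLinearEquiv, rfl⟩

theorem leviCivita_congr (g : Metric E M) (X : SmoothVectorField E M)
    {Y : Π x : M, TangentSpace 𝓘(ℝ, E) x} {x : M} (h : ∀ᶠ y in nhds x, X y = Y y) :
    leviCivita g (fun y ↦ X y) x = leviCivita g Y x := by
  have hT : (T% (fun y ↦ X y)) =ᶠ[nhds x] (T% Y) := h.mono fun y hy ↦ by simp only [hy]
  exact (leviCivita g).isCovariantDerivativeOnUniv.congr_of_eventuallyEq X.mdifferentiableAt
    (X.mdifferentiableAt.congr_of_eventuallyEq hT.symm) Filter.univ_mem h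

variable [T2Space M]

theorem Metric.isSmoothField_of_inner (g : Metric E M) {s : Π x : M, TangentSpace 𝓘(ℝ, E) x}
    (h : ∀ Z : SmoothVectorField E M,
      ContMDiff 𝓘(ℝ, E) 𝓘(ℝ, ℝ) ∞ (fun y ↦ g.inner y (s y) (Z y))) :
    IsSmoothField s :=
  contMDiff_of_clm_bundle_apply g.contMDiff g.isInvertible_inner
    (contMDiff_hom_of_apply (V₂ := Bundle.Trivial M ℝ) fun Z x ↦
      contMDiffAt_totalSpace.2 ⟨contMDiffAt_id, h Z x⟩)

theorem Metric.eq_of_fieldForm (g : Metric E M) {X Y : SmoothVectorField E M}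
    (h : ∀ Z, g.fieldForm X Z = g.fieldForm Y Z) : X = Y := by
  ext x
  refine g.ext_inner fun u ↦ ?_
  obtain ⟨Z, rfl⟩ := SmoothVectorField.eval_surjective x u
  exact DFunLike.congr_fun (h Z) x

theorem leviCivita_isSmoothField (g : Metric E M) (X Y : SmoothVectorField E M) :
    IsSmoothField fun x ↦ leviCivita g (fun y ↦ Y y) x (X x) := by
  refine g.isSmoothField_of_inner fun Z ↦ ?_
  have koszul_eq (y : M) : g.inner y (leviCivita g (fun y ↦ Y y) y (X y)) (Z y) = 1 / 2 *
      (⁅X, g.fieldForm Y Z⁆ + ⁅Y, g.fieldForm X Z⁆ - ⁅Z, g.fieldForm X Y⁆ + g.fieldForm ⁅X, Y⁆ Z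
        - g.fieldForm ⁅X, Z⁆ Y - g.fieldForm ⁅Y, Z⁆ X) y :=
    inner_leviCivitaFun g X.mdifferentiableAt Y.mdifferentiableAt Z.mdifferentiableAt
  exact (funext koszul_eq) ▸ contMDiff_const.mul (ContMDiffMap.contMDiff _)

namespace Metric

/-- The Levi-Civita connection, acting on smooth vector fields. -/
def connection (g : Metric E M) : Connection (SmoothFunction E M) (SmoothVectorField E M) where
  toFun :=
    { toFun X :=
        { toFun Y := ⟨fun x ↦ leviCivita g (fun y ↦ Y y) x (X x), leviCivita_isSmoothField g X Y⟩
          map_zero' := by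
            ext x
            exact congrArg (· (X x)) (leviCivita g).isCovariantDerivativeOnUniv.zero
          map_add' Y Y' := by
            ext x
            exact congrArg (· (X x)) ((leviCivita g).isCovariantDerivativeOnUniv.add
              Y.mdifferentiableAt Y'.mdifferentiableAt) }
      map_add' X X' := by
        ext Y x
        exact map_add (leviCivita g (fun y ↦ Y y) x) (X x) (X' x)
      map_smul' f X := by
        ext Y x
        exact map_smul (leviCivita g (fun y ↦ Y y) x) (f x) (X x) }
  map_smul_right' X f Y := by
    ext x
    have h := (leviCivita g).isCovariantDerivativeOnUniv.leibniz (x := x) Y.mdifferentiableAt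
      (f.mdifferentiableAt x)
    exact (congrArg (· (X x)) h).trans (add_comm _ _)

theorem connection_apply (g : Metric E M) (X Y : SmoothVectorField E M) (x : M) :
    g.connection X Y x = leviCivita g (fun y ↦ Y y) x (X x) := rfl

theorem connection_isMetric (g : Metric E M) : g.connection.IsMetric g.fieldForm := by
  intro X Y Z
  ext x
  exact leviCivita_metric g X.mdifferentiableAt Y.mdifferentiableAt Z.mdifferentiableAt

theorem connection_torsion (g : Metric E M) : g.connection.torsion = 0 := by
  refine LinearMap.ext₂ fun X Y ↦ ?_
  ext x
  exact sub_eq_zero.2 (leviCivita_torsion_free g X.mdifferentiableAt Y.mdifferentiableAt)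

theorem eq_connection {g : Metric E M}
    {D : Connection (SmoothFunction E M) (SmoothVectorField E M)} (hD : D.IsMetric g.fieldForm)
    (hT : D.torsion = 0) : D = g.connection := by
  refine Connection.ext fun X Y ↦ g.eq_of_fieldForm fun Z ↦ ?_
  have h := (hD.koszul g.fieldForm_symm hT X Y Z).trans
    (g.connection_isMetric.koszul g.fieldForm_symm g.connection_torsion X Y Z).symm
  ext x
  rw [two_mul, two_mul] at h
  have hx : g.fieldForm (D X Y) Z x + g.fieldForm (D X Y) Z x =
      g.fieldForm (g.connection X Y) Z x + g.fieldForm (g.connection X Y) Z x :=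
    DFunLike.congr_fun h x
  linarith

end Metric

theorem curvature_eq_of_eventuallyEq (g : Metric E M) (X Y Z : SmoothVectorField E M)
    {X' Y' Z' : Π x : M, TangentSpace 𝓘(ℝ, E) x} {x : M} (hX : ∀ᶠ y in nhds x, X y = X' y)
    (hY : ∀ᶠ y in nhds x, Y y = Y' y) (hZ : ∀ᶠ y in nhds x, Z y = Z' y) :
    g.connection.curvature X Y Z x = curvature g X' Y' Z' x := by
  have apply_eventuallyEq {W : SmoothVectorField E M} {W' : Π x : M, TangentSpace 𝓘(ℝ, E) x}
      (hW : ∀ᶠ y in nhds x, W y = W' y) :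
      ∀ᶠ y in nhds x, g.connection W Z y = leviCivita g Z' y (W' y) := by
    filter_upwards [hW, eventually_eventually_nhds.2 hZ] with y hWy hZy
    rw [Metric.connection_apply, leviCivita_congr g Z hZy, hWy]
  have lie_eq : ⁅X, Y⁆ x = mlieBracket 𝓘(ℝ, E) X' Y' x :=
    Filter.EventuallyEq.mlieBracket_vectorField_eq hX hY
  rw [curvature, ← leviCivita_congr g _ (apply_eventuallyEq hY),
    ← leviCivita_congr g _ (apply_eventuallyEq hX), ← leviCivita_congr g Z hZ, ← lie_eq,
    ← hX.self_of_nhds, ← hY.self_of_nhds]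
  rfl

theorem ricci_eq_ricciTensor (g : Metric E M) (x : M) (u v : TangentSpace 𝓘(ℝ, E) x) :
    ricci g x u v = ricciTensor (SmoothVectorField.tensorAt g.connection.curvature x) u v := by
  have curvature_extend (w : TangentSpace 𝓘(ℝ, E) x) :
      curvature g (extend E w) (extend E u) (extend E v) x =
        SmoothVectorField.tensorAt g.connection.curvature x w u v := by
    obtain ⟨W, hW⟩ := SmoothVectorField.exists_eventuallyEq_extend w
    obtain ⟨U, hU⟩ := SmoothVectorField.exists_eventuallyEq_extend u
    obtain ⟨V, hV⟩ := SmoothVectorField.exists_eventuallyEq_extend v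
    rw [← curvature_eq_of_eventuallyEq g W U V hW hU hV, ← SmoothVectorField.tensorAt_apply,
      hW.self_of_nhds, hU.self_of_nhds, hV.self_of_nhds]
    simp only [extend_apply_self]
  rw [ricciTensor, LinearMap.trace_eq_matrix_trace ℝ (Module.finBasis ℝ _)]
  exact Finset.sum_congr rfl fun i _ ↦ by
    rw [curvature_extend, Matrix.diag, LinearMap.toMatrix_apply]
    rfl

end LeviCivita

/-! ### Almost Hermitian and nearly Kähler manifolds -/

section AlmostHermitian

variable {E : Type*} [NormedAddCommGroup E] [NormedSpace ℝ E]
  {M : Type*} [TopologicalSpace M] [ChartedSpace E M] [IsManifold 𝓘(ℝ, E) ∞ M]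

/-- The action on smooth vector fields of a field `A` of endomorphisms of the tangent spaces that
is smooth, in the sense that it preserves smooth vector fields. -/
def fieldEndomorphism (A : Π x : M, TangentSpace 𝓘(ℝ, E) x →ₗ[ℝ] TangentSpace 𝓘(ℝ, E) x)
    (hA : ∀ X : SmoothVectorField E M, IsSmoothField fun x ↦ A x (X x)) :
    SmoothVectorField E M →ₗ[SmoothFunction E M] SmoothVectorField E M where
  toFun X := ⟨fun x ↦ A x (X x), hA X⟩
  map_add' X Y := by
    ext x
    exact map_add (A x) (X x) (Y x)
  map_smul' f X := by
    ext x
    exact map_smul (A x) (f x) (X x)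

/-- The action of an almost complex structure on smooth vector fields. -/
def AlmostComplex.fieldMap (J : AlmostComplex E M) :
    SmoothVectorField E M →ₗ[SmoothFunction E M] SmoothVectorField E M :=
  fieldEndomorphism (fun x ↦ (J x).toLinearMap)
    fun X ↦ ContMDiff.clm_bundle_apply (F₁ := E) (F₂ := E) J.smooth X.contMDiff

theorem AlmostComplex.fieldMap_apply (J : AlmostComplex E M) (X : SmoothVectorField E M) (x : M) :
    J.fieldMap X x = J x (X x) := rfl

theorem AlmostComplex.fieldMap_fieldMap (J : AlmostComplex E M) (X : SmoothVectorField E M) :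
    J.fieldMap (J.fieldMap X) = -X := by
  ext x
  exact J.sq x (X x)

variable {g : Metric E M} {J : AlmostComplex E M}

theorem IsAlmostHermitian.isHermitianForm_form (h : IsAlmostHermitian g J) (x : M) :
    IsHermitianForm (g.form x) (J x).toLinearMap where
  symm := g.symm x
  eq_zero_of_forall v hv := g.eq_zero_of_self (hv v)
  sq := J.sq x
  isometry := h x

variable [FiniteDimensional ℝ E] [T2Space M]

theorem IsAlmostHermitian.isHermitianForm_fieldForm (h : IsAlmostHermitian g J) :
    IsHermitianForm g.fieldForm J.fieldMap where
  symm := g.fieldForm_symm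
  eq_zero_of_forall X hX := g.eq_of_fieldForm fun Z ↦ by
    rw [hX, map_zero, LinearMap.zero_apply]
  sq := J.fieldMap_fieldMap
  isometry X Y := by
    ext x
    exact h x (X x) (Y x)

theorem isKahler_of_preserves (h : IsAlmostHermitian g J)
    (hJ : g.connection.Preserves J.fieldMap) : IsKahler g J := by
  refine ⟨h, fun X Y hX hY x ↦ ?_, fun X Y Z hX hY hZ x ↦ ?_⟩
  · exact DFunLike.congr_fun (hJ.nijenhuis_eq_zero g.connection_torsion J.fieldMap_fieldMap
      ⟨X, hX⟩ ⟨Y, hY⟩) x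
  · have skew (X Y : SmoothVectorField E M) :
        g.fieldForm (J.fieldMap X) Y = -g.fieldForm (J.fieldMap Y) X := by
      rw [h.isHermitianForm_fieldForm.skew, g.fieldForm_symm]
    exact DFunLike.congr_fun (g.connection_isMetric.closed_of_preserves hJ g.connection_torsion
      skew ⟨X, hX⟩ ⟨Y, hY⟩ ⟨Z, hZ⟩) x

theorem tensorAt_curvature_apply
    {A : Π x : M, TangentSpace 𝓘(ℝ, E) x →ₗ[ℝ] TangentSpace 𝓘(ℝ, E) x}
    {hA : ∀ X : SmoothVectorField E M, IsSmoothField fun x ↦ A x (X x)}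
    {D : Connection (SmoothFunction E M) (SmoothVectorField E M)}
    (hD : D.Preserves (fieldEndomorphism A hA)) (x : M) (u v w : TangentSpace 𝓘(ℝ, E) x) :
    SmoothVectorField.tensorAt D.curvature x u v (A x w)
      = A x (SmoothVectorField.tensorAt D.curvature x u v w) := by
  obtain ⟨X, rfl⟩ := SmoothVectorField.eval_surjective x u
  obtain ⟨Y, rfl⟩ := SmoothVectorField.eval_surjective x v
  obtain ⟨Z, rfl⟩ := SmoothVectorField.eval_surjective x w
  simp only [SmoothVectorField.eval_apply]
  exact (SmoothVectorField.tensorAt_apply D.curvature X Y (fieldEndomorphism A hA Z) x).trans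
    ((DFunLike.congr_fun (hD.curvature X Y Z) x).trans
      (congrArg (A x) (SmoothVectorField.tensorAt_apply D.curvature X Y Z x).symm))

theorem isHermitianCurvature_tensorAt
    {D : Connection (SmoothFunction E M) (SmoothVectorField E M)} (hD : D.IsMetric g.fieldForm)
    (hJ : D.Preserves J.fieldMap) (x : M) :
    IsHermitianCurvature (g.form x) (J x).toLinearMap
      (SmoothVectorField.tensorAt D.curvature x) where
  swap u v w := by
    obtain ⟨X, rfl⟩ := SmoothVectorField.eval_surjective x u
    obtain ⟨Y, rfl⟩ := SmoothVectorField.eval_surjective x v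
    obtain ⟨Z, rfl⟩ := SmoothVectorField.eval_surjective x w
    simp only [SmoothVectorField.eval_apply, SmoothVectorField.tensorAt_apply]
    exact DFunLike.congr_fun (D.curvature_swap X Y Z) x
  skew u v w z := by
    obtain ⟨X, rfl⟩ := SmoothVectorField.eval_surjective x u
    obtain ⟨Y, rfl⟩ := SmoothVectorField.eval_surjective x v
    obtain ⟨Z, rfl⟩ := SmoothVectorField.eval_surjective x w
    obtain ⟨W, rfl⟩ := SmoothVectorField.eval_surjective x z
    simp only [SmoothVectorField.eval_apply, SmoothVectorField.tensorAt_apply]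
    exact DFunLike.congr_fun (hD.curvature_skew X Y Z W) x
  map_J := tensorAt_curvature_apply hJ x

theorem isKahlerCurvature_tensorAt (hJ : g.connection.Preserves J.fieldMap) (x : M) :
    IsKahlerCurvature (g.form x) (J x).toLinearMap
      (SmoothVectorField.tensorAt g.connection.curvature x) where
  toIsHermitianCurvature := isHermitianCurvature_tensorAt g.connection_isMetric hJ x
  bianchi u v w := by
    obtain ⟨X, rfl⟩ := SmoothVectorField.eval_surjective x u
    obtain ⟨Y, rfl⟩ := SmoothVectorField.eval_surjective x v
    obtain ⟨Z, rfl⟩ := SmoothVectorField.eval_surjective x w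
    have key := g.connection.bianchi X Y Z
    simp only [Connection.covDeriv₂_apply, g.connection_torsion, LinearMap.zero_apply,
      map_zero, sub_zero, add_zero] at key
    simp only [SmoothVectorField.eval_apply, SmoothVectorField.tensorAt_apply]
    exact DFunLike.congr_fun key x

/-- The value at `x` of the torsion `T(v, w) = (∇_v J)(J w)` of the canonical Hermitian connection
of a nearly Kähler structure. -/
def hermitianTorsionAt (g : Metric E M) (J : AlmostComplex E M) (x : M) :
    TangentSpace 𝓘(ℝ, E) x →ₗ[ℝ] TangentSpace 𝓘(ℝ, E) x →ₗ[ℝ] TangentSpace 𝓘(ℝ, E) x :=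
  (nablaJ g J x).compl₂ (J x).toLinearMap

theorem connection_covDeriv_fieldMap (X Y : SmoothVectorField E M) (x : M) :
    g.connection.covDeriv J.fieldMap X Y x = nablaJ g J x (X x) (Y x) :=
  (nablaJ_apply g J Y.mdifferentiableAt (X x)).symm

variable (g J) in
/-- The canonical Hermitian connection, acting on smooth vector fields. -/
def hermitianConnection : Connection (SmoothFunction E M) (SmoothVectorField E M) :=
  g.connection.hermitian J.fieldMap

theorem hermitianConnection_apply (X Y : SmoothVectorField E M) (x : M) :
    hermitianConnection g J X Y x = canonicalConnection g J (fun y ↦ Y y) x (X x) := by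
  have h : hermitianConnection g J X Y x = g.connection X Y x
      + (2⁻¹ : ℝ) • g.connection.covDeriv J.fieldMap X (J.fieldMap Y) x := rfl
  rw [h, connection_covDeriv_fieldMap, canonicalConnection_apply, one_div, J.fieldMap_apply,
    g.connection_apply]

theorem hermitianConnection_preserves (g : Metric E M) (J : AlmostComplex E M) :
    (hermitianConnection g J).Preserves J.fieldMap :=
  Connection.hermitian_preserves J.fieldMap_fieldMap

namespace IsNearlyKahler

variable (h : IsNearlyKahler g J)
include h

theorem covDeriv_fieldMap_self (X : SmoothVectorField E M) :
    g.connection.covDeriv J.fieldMap X X = 0 := by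
  ext x
  rw [connection_covDeriv_fieldMap]
  exact h.2 x (X x)

theorem hermitianConnection_isMetric : (hermitianConnection g J).IsMetric g.fieldForm :=
  Connection.hermitian_isMetric g.connection_isMetric h.1.isHermitianForm_fieldForm
    h.covDeriv_fieldMap_self

theorem isTypeThreeZero_torsion :
    IsTypeThreeZero g.fieldForm J.fieldMap (hermitianConnection g J).torsion := by
  rw [hermitianConnection, Connection.hermitian_torsion g.connection_isMetric
    h.1.isHermitianForm_fieldForm h.covDeriv_fieldMap_self g.connection_torsion]
  exact Connection.isTypeThreeZero_hermitianTorsion g.connection_isMetric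
    h.1.isHermitianForm_fieldForm h.covDeriv_fieldMap_self

theorem covDeriv₂_torsion_eq_zero (X Y Z : SmoothVectorField E M) :
    (hermitianConnection g J).covDeriv₂ (hermitianConnection g J).torsion X Y Z = 0 :=
  have := IsAddTorsionFree.of_isTorsionFree ℝ (SmoothFunction E M)
  Connection.covDeriv₂_torsion_eq_zero h.1.isHermitianForm_fieldForm h.hermitianConnection_isMetric
    (hermitianConnection_preserves g J) h.isTypeThreeZero_torsion X Y Z

theorem torsion_apply (X Y : SmoothVectorField E M) (x : M) :
    (hermitianConnection g J).torsion X Y x = hermitianTorsionAt g J x (X x) (Y x) := by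
  rw [hermitianConnection, Connection.hermitian_torsion g.connection_isMetric
    h.1.isHermitianForm_fieldForm h.covDeriv_fieldMap_self g.connection_torsion,
    Connection.hermitianTorsion_apply, connection_covDeriv_fieldMap]
  rfl

theorem isTypeThreeZero_hermitianTorsionAt (x : M) :
    IsTypeThreeZero (g.form x) (J x).toLinearMap (hermitianTorsionAt g J x) where
  swap u v := by
    obtain ⟨X, rfl⟩ := SmoothVectorField.eval_surjective x u
    obtain ⟨Y, rfl⟩ := SmoothVectorField.eval_surjective x v
    simp only [SmoothVectorField.eval_apply, ← h.torsion_apply]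
    exact DFunLike.congr_fun (h.isTypeThreeZero_torsion.swap X Y) x
  skew u v w := by
    obtain ⟨X, rfl⟩ := SmoothVectorField.eval_surjective x u
    obtain ⟨Y, rfl⟩ := SmoothVectorField.eval_surjective x v
    obtain ⟨Z, rfl⟩ := SmoothVectorField.eval_surjective x w
    simp only [SmoothVectorField.eval_apply, ← h.torsion_apply]
    exact DFunLike.congr_fun (h.isTypeThreeZero_torsion.skew X Y Z) x
  map_J u v := by
    obtain ⟨X, rfl⟩ := SmoothVectorField.eval_surjective x u
    obtain ⟨Y, rfl⟩ := SmoothVectorField.eval_surjective x v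
    simp only [SmoothVectorField.eval_apply, ← h.torsion_apply]
    exact (h.torsion_apply X (J.fieldMap Y) x).symm.trans
      (DFunLike.congr_fun (h.isTypeThreeZero_torsion.map_J X Y) x)

theorem nablaJ_eq (x : M) (u v : TangentSpace 𝓘(ℝ, E) x) :
    nablaJ g J x u v = J x (hermitianTorsionAt g J x u v) := by
  have map_J : nablaJ g J x u (J x (J x v)) = -J x (hermitianTorsionAt g J x u v) :=
    (h.isTypeThreeZero_hermitianTorsionAt x).map_J u v
  rwa [J.sq, map_neg, neg_inj] at map_J

theorem bianchi_hermitianConnection (x : M) (u v w : TangentSpace 𝓘(ℝ, E) x) :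
    let R := SmoothVectorField.tensorAt (hermitianConnection g J).curvature x
    let T := hermitianTorsionAt g J x
    R u v w + R v w u + R w u v = T (T u v) w + T (T v w) u + T (T w u) v := by
  obtain ⟨X, rfl⟩ := SmoothVectorField.eval_surjective x u
  obtain ⟨Y, rfl⟩ := SmoothVectorField.eval_surjective x v
  obtain ⟨Z, rfl⟩ := SmoothVectorField.eval_surjective x w
  have key := (hermitianConnection g J).bianchi X Y Z
  simp only [h.covDeriv₂_torsion_eq_zero, add_zero, zero_add] at key
  simp only [SmoothVectorField.eval_apply, SmoothVectorField.tensorAt_apply, ← h.torsion_apply]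
  exact DFunLike.congr_fun key x

theorem curvature_hermitianTorsionAt (x : M) (u v w z : TangentSpace 𝓘(ℝ, E) x) :
    let R := SmoothVectorField.tensorAt (hermitianConnection g J).curvature x
    let T := hermitianTorsionAt g J x
    R u v (T w z) = T (R u v w) z + T w (R u v z) := by
  obtain ⟨X, rfl⟩ := SmoothVectorField.eval_surjective x u
  obtain ⟨Y, rfl⟩ := SmoothVectorField.eval_surjective x v
  obtain ⟨Z, rfl⟩ := SmoothVectorField.eval_surjective x w
  obtain ⟨W, rfl⟩ := SmoothVectorField.eval_surjective x z
  simp only [SmoothVectorField.eval_apply, SmoothVectorField.tensorAt_apply, ← h.torsion_apply]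
  exact DFunLike.congr_fun (Connection.curvature_of_covDeriv₂_eq_zero
    h.covDeriv₂_torsion_eq_zero X Y Z W) x

end IsNearlyKahler

end AlmostHermitian

/-! ### The parallel line bundle -/

section Projection

variable {E : Type*} [NormedAddCommGroup E] [NormedSpace ℝ E]
  {M : Type*} [TopologicalSpace M] [ChartedSpace E M] [IsManifold 𝓘(ℝ, E) ∞ M]
  [FiniteDimensional ℝ E]

/-- The orthogonal projection onto `L`, as a field of endomorphisms of the tangent spaces. -/
def proj (g : Metric E M) (L : Distribution E M) (x : M) :
    TangentSpace 𝓘(ℝ, E) x →ₗ[ℝ] TangentSpace 𝓘(ℝ, E) x :=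
  (L x).subtype ∘ₗ orthProj g L x

variable {g : Metric E M} {L : Distribution E M} {x : M}

theorem proj_mem (v : TangentSpace 𝓘(ℝ, E) x) : proj g L x v ∈ L x :=
  (orthProj g L x v).2

theorem proj_eq_self_iff {v : TangentSpace 𝓘(ℝ, E) x} : proj g L x v = v ↔ v ∈ L x :=
  ⟨fun hv ↦ hv ▸ proj_mem v, fun hv ↦
    congrArg Subtype.val (Submodule.projectionOnto_apply_of_mem_left (isCompl_orthCompl g L x) hv)⟩

theorem proj_eq_zero_iff {v : TangentSpace 𝓘(ℝ, E) x} :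
    proj g L x v = 0 ↔ v ∈ orthCompl g L x := by
  rw [proj, LinearMap.comp_apply, Submodule.subtype_apply, orthProj, ZeroMemClass.coe_eq_zero,
    Submodule.projectionOnto_apply_eq_zero_iff]

theorem range_proj : LinearMap.range (proj g L x) = L x :=
  le_antisymm (LinearMap.range_le_iff_comap.2 (eq_top_iff.2 fun v _ ↦ proj_mem v))
    fun v hv ↦ ⟨v, proj_eq_self_iff.2 hv⟩

theorem proj_proj (v : TangentSpace 𝓘(ℝ, E) x) : proj g L x (proj g L x v) = proj g L x v :=
  proj_eq_self_iff.2 (proj_mem v)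

theorem sub_proj_mem (v : TangentSpace 𝓘(ℝ, E) x) : v - proj g L x v ∈ orthCompl g L x := by
  rw [← proj_eq_zero_iff, map_sub, proj_proj, sub_self]

theorem inner_proj (v w : TangentSpace 𝓘(ℝ, E) x) :
    g.inner x (proj g L x v) w = g.inner x v (proj g L x w) := by
  have hv : g.inner x (proj g L x w) (v - proj g L x v) = 0 := sub_proj_mem v _ (proj_mem w)
  have hw : g.inner x (proj g L x v) (w - proj g L x w) = 0 := sub_proj_mem w _ (proj_mem v)
  rw [map_sub, sub_eq_zero] at hv hw
  rw [hw, g.symm x v, hv, g.symm]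

theorem inner_proj_self_nonneg (v : TangentSpace 𝓘(ℝ, E) x) :
    0 ≤ g.inner x (proj g L x v) v := by
  rw [← proj_proj, inner_proj]
  rcases eq_or_ne (proj g L x v) 0 with hv | hv
  · rw [hv, map_zero]
  · exact (g.pos x _ hv).le

variable {J : AlmostComplex E M}

theorem proj_map_J (h : IsAlmostHermitian g J) (hJL : IsStable J L) (v : TangentSpace 𝓘(ℝ, E) x) :
    proj g L x (J x v) = J x (proj g L x v) := by
  have horizontal : J x (v - proj g L x v) ∈ orthCompl g L x := fun w hw ↦ by
    refine ((h.isHermitianForm_form x).skew_right w _).trans ?_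
    exact neg_eq_zero.2 (sub_proj_mem v _ (hJL x w hw))
  have vertical : J x (proj g L x v) ∈ L x := hJL x _ (proj_mem v)
  rw [← proj_eq_zero_iff, map_sub, map_sub, proj_eq_self_iff.2 vertical, sub_eq_zero] at horizontal
  exact horizontal

end Projection

/-- A nearly Kähler structure with a parallel complex line subbundle `L` whose torsion form is
nondegenerate on the orthogonal complement of `L`. -/
structure HasParallelPlane {E : Type*} [NormedAddCommGroup E] [NormedSpace ℝ E]
    [FiniteDimensional ℝ E] {M : Type*} [TopologicalSpace M] [ChartedSpace E M]
    [IsManifold 𝓘(ℝ, E) ∞ M] (g : Metric E M) (J : AlmostComplex E M) (L : Distribution E M) :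
    Prop where
  nearlyKahler : IsNearlyKahler g J
  subbundle : IsSubbundle L 2
  stable : IsStable J L
  parallel : IsParallel g J L
  injective : ∀ x : M, ∀ u ∈ orthCompl g L x, torsionEndo g J L x u = 0 → u = 0

namespace HasParallelPlane

variable {E : Type*} [NormedAddCommGroup E] [NormedSpace ℝ E] [FiniteDimensional ℝ E]
  {M : Type*} [TopologicalSpace M] [ChartedSpace E M] [IsManifold 𝓘(ℝ, E) ∞ M]
  {g : Metric E M} {J : AlmostComplex E M} {L : Distribution E M} (h : HasParallelPlane g J L)
include h

theorem exists_ne_zero (x : M) : ∃ v ∈ L x, v ≠ 0 := by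
  refine (L x).exists_mem_ne_zero_of_ne_bot fun hL ↦ ?_
  have rank := h.subbundle.1 x
  rw [hL, finrank_bot] at rank
  omega

theorem proj_eq {x : M} {v : TangentSpace 𝓘(ℝ, E) x} (hv : v ∈ L x) (hv₀ : v ≠ 0)
    (u : TangentSpace 𝓘(ℝ, E) x) :
    proj g L x u = (g.inner x u v / g.inner x v v) • v
      + (g.inner x u (J x v) / g.inner x v v) • J x v := by
  have form := h.nearlyKahler.1.isHermitianForm_form x
  obtain ⟨a, b, hab⟩ := exists_eq_smul_add_smul_of_finrank_eq_two form.sq (h.subbundle.1 x)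
    (h.stable x) hv hv₀ (proj_mem (g := g) u)
  have orthogonal : g.inner x (J x v) v = 0 := form.apply_J_self v
  have orthogonal' : g.inner x v (J x v) = 0 := (g.symm x v (J x v)).trans orthogonal
  have inner_v : g.inner x u v = a * g.inner x v v := by
    rw [← proj_eq_self_iff.2 hv, ← inner_proj, hab, proj_eq_self_iff.2 hv]
    simp [orthogonal]
  have inner_Jv : g.inner x u (J x v) = b * g.inner x v v := by
    rw [← proj_eq_self_iff.2 (h.stable x v hv), ← inner_proj, hab]
    simp [h.nearlyKahler.1 x v v, orthogonal']
  have norm_ne_zero := (g.pos x v hv₀).ne'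
  rw [inner_v, inner_Jv, mul_div_cancel_right₀ _ norm_ne_zero,
    mul_div_cancel_right₀ _ norm_ne_zero]
  exact hab

theorem traceOn_eq {x : M} {v : TangentSpace 𝓘(ℝ, E) x} (hv : v ∈ L x) (hv₀ : v ≠ 0)
    (A : TangentSpace 𝓘(ℝ, E) x →ₗ[ℝ] TangentSpace 𝓘(ℝ, E) x) :
    traceOn g L x A
      = (g.inner x v (A v) + g.inner x (J x v) (A (J x v))) / g.inner x v v := by
  have trace_eq : traceOn g L x A = LinearMap.trace ℝ _ (proj g L x ∘ₗ A) := by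
    rw [traceOn, ← LinearMap.comp_assoc, LinearMap.trace_comp_comm', ← LinearMap.comp_assoc]
    rfl
  have proj_comp : proj g L x ∘ₗ A = (1 / g.inner x v v) • ((g.form x v ∘ₗ A).smulRight v
      + (g.form x (J x v) ∘ₗ A).smulRight (J x v)) := by
    ext z
    refine (h.proj_eq hv hv₀ (A z)).trans ?_
    rw [g.symm x _ v, g.symm x _ (J x v), div_eq_mul_one_div, div_eq_mul_one_div]
    simp only [LinearMap.smul_apply, LinearMap.add_apply, LinearMap.smulRight_apply,
      LinearMap.comp_apply, Metric.form_apply]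
    module
  rw [trace_eq, proj_comp, map_smul, map_add, LinearMap.trace_smulRight, LinearMap.trace_smulRight,
    smul_eq_mul, one_div, inv_mul_eq_div]
  rfl

theorem isSmoothField_proj (X : SmoothVectorField E M) :
    IsSmoothField fun x ↦ proj g L x (X x) := by
  intro x
  obtain ⟨v, hv, hv₀⟩ := h.exists_ne_zero x
  obtain ⟨Y, hY, rfl⟩ := h.subbundle.2 x v hv
  let V : SmoothVectorField E M := ⟨Y, hY.1⟩
  have ne_zero : g.fieldForm V V x ≠ 0 := (g.pos x _ hv₀).ne'
  have quotient (f : SmoothFunction E M) :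
      ContMDiffAt 𝓘(ℝ, E) 𝓘(ℝ, ℝ) ∞ (fun y ↦ f y / g.fieldForm V V y) x :=
    f.contMDiff.contMDiffAt.div₀ (g.fieldForm V V).contMDiff.contMDiffAt ne_zero
  refine (((quotient (g.fieldForm X V)).smul_section V.contMDiff.contMDiffAt).add_section
    ((quotient (g.fieldForm X (J.fieldMap V))).smul_section
      (J.fieldMap V).contMDiff.contMDiffAt)).congr_of_eventuallyEq ?_
  filter_upwards [(g.fieldForm V V).contMDiff.continuous.continuousAt.eventually_ne ne_zero]
    with y hy
  have hy₀ : Y y ≠ 0 := fun hy₀ ↦ hy <| by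
    rw [g.fieldForm_apply, show V y = 0 from hy₀, map_zero]
  exact congrArg (TotalSpace.mk' E y) (h.proj_eq (hY.2 y) hy₀ (X y))

/-- The projection onto `L`, acting on smooth vector fields. -/
def fieldProj : SmoothVectorField E M →ₗ[SmoothFunction E M] SmoothVectorField E M :=
  fieldEndomorphism (proj g L) h.isSmoothField_proj

variable [T2Space M]

theorem hermitianConnection_preserves : (hermitianConnection g J).Preserves h.fieldProj := by
  refine h.nearlyKahler.hermitianConnection_isMetric.preserves_of_idem
    h.nearlyKahler.1.isHermitianForm_fieldForm.eq_zero_of_forall (fun X ↦ ?_) (fun X Y ↦ ?_)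
    fun X Y ↦ ?_
  · ext x
    exact proj_proj (X x)
  · ext x
    exact inner_proj (X x) (Y x)
  · ext x
    refine proj_eq_self_iff.2 ?_
    rw [hermitianConnection_apply]
    exact h.parallel _ ⟨(h.fieldProj Y).contMDiff, fun y ↦ proj_mem (Y y)⟩ x (X x)

theorem inner_torsionEndo_apply {x : M} {v : TangentSpace 𝓘(ℝ, E) x} (hv : v ∈ L x) (hv₀ : v ≠ 0)
    (u w : TangentSpace 𝓘(ℝ, E) x) :
    g.inner x (torsionEndo g J L x u) w = g.inner x (hermitianTorsionAt g J x v u)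
      (hermitianTorsionAt g J x v w) / g.inner x v v := by
  set T := hermitianTorsionAt g J x
  have type := h.nearlyKahler.isTypeThreeZero_hermitianTorsionAt x
  have quadratic (z : TangentSpace 𝓘(ℝ, E) x) :
      g.inner x z (nablaJ g J x u (nablaJ g J x w z)) = -g.inner x (T z u) (T z w) := by
    have map_J : T u (J x (T w z)) = -J x (T u (T w z)) := type.map_J u (T w z)
    have skew : g.inner x (T u z) (T w z) = -g.inner x z (T u (T w z)) := type.skew u z (T w z)
    have swap (u : TangentSpace 𝓘(ℝ, E) x) : T u z = -T z u := type.swap z u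
    rw [h.nearlyKahler.nablaJ_eq, h.nearlyKahler.nablaJ_eq, map_J, map_neg, J.sq,
      neg_neg, ← neg_eq_iff_eq_neg.2 skew, swap u, swap w, map_neg, map_neg, neg_apply, neg_neg]
  have map_J_left (u : TangentSpace 𝓘(ℝ, E) x) : T (J x v) u = -J x (T v u) :=
    type.map_J_left v u
  rw [inner_torsionEndo, h.traceOn_eq hv hv₀]
  simp only [LinearMap.comp_apply, quadratic, map_J_left, map_neg, neg_apply,
    neg_neg, h.nearlyKahler.1 x]
  ring

theorem isHolonomyPlane (x : M) :
    IsHolonomyPlane (g.form x) (J x).toLinearMap (hermitianTorsionAt g J x)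
      (SmoothVectorField.tensorAt (hermitianConnection g J).curvature x) (proj g L x) where
  form := h.nearlyKahler.1.isHermitianForm_form x
  pos := g.pos x
  torsion := h.nearlyKahler.isTypeThreeZero_hermitianTorsionAt x
  curvature := isHermitianCurvature_tensorAt h.nearlyKahler.hermitianConnection_isMetric
    (NearlyKahler.hermitianConnection_preserves g J) x
  curvature_torsion := h.nearlyKahler.curvature_hermitianTorsionAt x
  bianchi := h.nearlyKahler.bianchi_hermitianConnection x
  idem := proj_proj
  symm := inner_proj
  map_J := proj_map_J h.nearlyKahler.1 h.stable
  map_curvature u v w := (tensorAt_curvature_apply h.hermitianConnection_preserves x u v w).symm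
  finrank_range := by rw [range_proj, h.subbundle.1 x]
  injective v u hv hv₀ hu hT := by
    refine h.injective x u (proj_eq_zero_iff.1 hu) (g.ext_inner fun w ↦ ?_)
    rw [h.inner_torsionEndo_apply (proj_eq_self_iff.1 hv) hv₀, hT]
    simp

end HasParallelPlane

/-! ### The curvature of the parallel plane -/

section LocallyConstant

variable {E : Type*} [NormedAddCommGroup E] [NormedSpace ℝ E]
  {M : Type*} [TopologicalSpace M] [ChartedSpace E M] [IsManifold 𝓘(ℝ, E) ∞ M]

theorem SmoothFunction.hasFDerivAt_comp_extChartAt_symm (f : SmoothFunction E M)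
    (hf : ∀ x, mvfderiv 𝓘(ℝ, E) (fun y ↦ f y) x = 0) (x : M) {z : E}
    (hz : z ∈ (extChartAt 𝓘(ℝ, E) x).target) :
    HasFDerivAt (f ∘ (extChartAt 𝓘(ℝ, E) x).symm) (0 : E →L[ℝ] ℝ) z := by
  have hd : MDifferentiableAt 𝓘(ℝ, E) 𝓘(ℝ, E) (extChartAt 𝓘(ℝ, E) x).symm z :=
    ((contMDiffOn_extChartAt_symm (n := ∞) x).mdifferentiableOn (by simp)).mdifferentiableAt
      ((isOpen_extChartAt_target x).mem_nhds hz)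
  have h := (f.mdifferentiableAt _).hasMFDerivAt.comp z hd.hasMFDerivAt
  have hzero : mfderiv 𝓘(ℝ, E) 𝓘(ℝ, ℝ) f ((extChartAt 𝓘(ℝ, E) x).symm z) = 0 := hf _
  rw [hzero, ContinuousLinearMap.zero_comp] at h
  exact h.hasFDerivAt

theorem SmoothFunction.isLocallyConstant (f : SmoothFunction E M)
    (hf : ∀ x, mvfderiv 𝓘(ℝ, E) (fun y ↦ f y) x = 0) : IsLocallyConstant f := by
  rw [IsLocallyConstant.iff_eventually_eq]
  intro x
  let φ := extChartAt 𝓘(ℝ, E) x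
  obtain ⟨r, hr, hball⟩ :=
    Metric.isOpen_iff.1 (isOpen_extChartAt_target (I := 𝓘(ℝ, E)) x)
      _ (mem_extChartAt_target (I := 𝓘(ℝ, E)) x)
  have hconst {z : E} (hz : z ∈ Metric.ball (φ x) r) : f (φ.symm z) = f (φ.symm (φ x)) :=
    Metric.isOpen_ball.is_const_of_fderiv_eq_zero (convex_ball _ _).isPreconnected
      (fun z hz ↦ (f.hasFDerivAt_comp_extChartAt_symm hf x (hball hz)).differentiableAt
        |>.differentiableWithinAt)
      (fun z hz ↦ (f.hasFDerivAt_comp_extChartAt_symm hf x (hball hz)).fderiv) hz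
      (Metric.mem_ball_self hr)
  filter_upwards [extChartAt_source_mem_nhds (I := 𝓘(ℝ, E)) x,
    (continuousAt_extChartAt (I := 𝓘(ℝ, E)) x).preimage_mem_nhds (Metric.ball_mem_nhds _ hr)]
    with y hy hyr
  rw [← φ.left_inv hy, hconst hyr, φ.left_inv (mem_extChartAt_source x)]

end LocallyConstant

namespace HasParallelPlane

variable {E : Type*} [NormedAddCommGroup E] [NormedSpace ℝ E] [FiniteDimensional ℝ E]
  {M : Type*} [TopologicalSpace M] [ChartedSpace E M] [IsManifold 𝓘(ℝ, E) ∞ M]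
  {g : Metric E M} {J : AlmostComplex E M} {L : Distribution E M} (h : HasParallelPlane g J L)
include h

theorem exists_horizontal (hE : Module.finrank ℝ E ≠ 2) (x : M) :
    ∃ u : TangentSpace 𝓘(ℝ, E) x, proj g L x u = 0 ∧ u ≠ 0 := by
  obtain ⟨u, hu, hu₀⟩ := (orthCompl g L x).exists_mem_ne_zero_of_ne_bot fun hL ↦ hE <| by
    have rank := Submodule.finrank_add_eq_of_isCompl (isCompl_orthCompl g L x)
    rw [hL, finrank_bot, h.subbundle.1 x] at rank
    exact rank.symm
  exact ⟨u, proj_eq_zero_iff.2 hu, hu₀⟩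

variable [T2Space M]

/-- The sectional curvature of the canonical Hermitian connection on the planes of `L`. -/
def verticalCurvature (x : M) : ℝ := (h.isHolonomyPlane x).exists_hasVerticalCurvature.choose

theorem hasVerticalCurvature (x : M) :
    HasVerticalCurvature (g.form x) (J x).toLinearMap
      (SmoothVectorField.tensorAt (hermitianConnection g J).curvature x) (proj g L x)
      (h.verticalCurvature x) :=
  (h.isHolonomyPlane x).exists_hasVerticalCurvature.choose_spec

theorem inner_torsion_torsion {x : M} {v u : TangentSpace 𝓘(ℝ, E) x} (hv : v ∈ L x)
    (hu : u ∈ orthCompl g L x) (w : TangentSpace 𝓘(ℝ, E) x) :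
    g.inner x (hermitianTorsionAt g J x v u) (hermitianTorsionAt g J x v w)
      = h.verticalCurvature x / 4 * g.inner x v v * g.inner x u w := by
  have plane := h.isHolonomyPlane x
  have skew := plane.torsion.skew v (hermitianTorsionAt g J x v u) w
  rw [plane.torsion_torsion (h.hasVerticalCurvature x) (proj_eq_self_iff.2 hv)
    (proj_eq_zero_iff.2 hu), map_smul] at skew
  simp only [LinearMap.smul_apply, smul_eq_mul, Metric.form_apply] at skew
  linarith

theorem torsionEndo_eq {x : M} {u : TangentSpace 𝓘(ℝ, E) x} (hu : u ∈ orthCompl g L x) :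
    torsionEndo g J L x u = (h.verticalCurvature x / 4) • u := by
  obtain ⟨v, hv, hv₀⟩ := h.exists_ne_zero x
  refine g.ext_inner fun w ↦ ?_
  have norm_ne_zero := (g.pos x v hv₀).ne'
  rw [h.inner_torsionEndo_apply hv hv₀, h.inner_torsion_torsion hv hu, map_smul, smul_apply,
    smul_eq_mul]
  field_simp

theorem exists_sections (hE : Module.finrank ℝ E ≠ 2) (x : M) :
    ∃ V Y : SmoothVectorField E M, h.fieldProj V = V ∧ h.fieldProj Y = 0 ∧ V x ≠ 0 ∧ Y x ≠ 0 := by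
  obtain ⟨v, hv, hv₀⟩ := h.exists_ne_zero x
  obtain ⟨u, hu, hu₀⟩ := h.exists_horizontal hE x
  let V := SmoothVectorField.extension E x v
  let Y := SmoothVectorField.extension E x u
  refine ⟨h.fieldProj V, Y - h.fieldProj Y, ?_, ?_, fun hV ↦ hv₀ ?_, fun hY ↦ hu₀ ?_⟩
  · ext y
    exact proj_proj (V y)
  · ext y
    exact proj_eq_zero_iff.2 (sub_proj_mem (Y y))
  · rw [← proj_eq_self_iff.2 hv, ← SmoothVectorField.extension_apply_self x v]
    exact hV
  · have hY : Y x - proj g L x (Y x) = 0 := hY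
    rwa [SmoothVectorField.extension_apply_self, hu, sub_zero] at hY

theorem verticalCurvature_pos (hE : Module.finrank ℝ E ≠ 2) (x : M) : 0 < h.verticalCurvature x :=
  (h.isHolonomyPlane x).pos_of_exists_horizontal (h.hasVerticalCurvature x)
    (h.exists_horizontal hE x)

theorem contMDiff_verticalCurvature (hE : Module.finrank ℝ E ≠ 2) :
    ContMDiff 𝓘(ℝ, E) 𝓘(ℝ, ℝ) ∞ h.verticalCurvature := by
  intro x
  obtain ⟨V, Y, hV, hY, hV₀, hY₀⟩ := h.exists_sections hE x
  let W := (hermitianConnection g J).torsion V Y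
  let f := g.fieldForm V V * g.fieldForm Y Y
  have ne_zero : f x ≠ 0 := mul_ne_zero (g.pos x _ hV₀).ne' (g.pos x _ hY₀).ne'
  refine ((contMDiff_const (c := (4 : ℝ))).mul (g.fieldForm W W).contMDiff).contMDiffAt.div₀
    f.contMDiff.contMDiffAt ne_zero |>.congr_of_eventuallyEq ?_
  filter_upwards [f.contMDiff.continuous.continuousAt.eventually_ne ne_zero] with y hy
  have hV : V y ∈ L y := proj_eq_self_iff.1 (DFunLike.congr_fun hV y)
  have hY : Y y ∈ orthCompl g L y := proj_eq_zero_iff.1 (DFunLike.congr_fun hY y)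
  have hW : g.fieldForm W W y = h.verticalCurvature y / 4 * f y := by
    refine (congrArg₂ (g.inner y · ·) (h.nearlyKahler.torsion_apply V Y y)
      (h.nearlyKahler.torsion_apply V Y y)).trans ((h.inner_torsion_torsion hV hY _).trans ?_)
    exact mul_assoc _ _ _
  rw [Pi.div_apply, Pi.mul_apply, hW]
  field_simp

theorem isLocallyConstant_verticalCurvature (hE : Module.finrank ℝ E ≠ 2) :
    IsLocallyConstant h.verticalCurvature := by
  let f : SmoothFunction E M :=
    ⟨fun x ↦ h.verticalCurvature x / 4, (h.contMDiff_verticalCurvature hE).div_const 4⟩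
  have torsion_torsion (V Y : SmoothVectorField E M) (hV : h.fieldProj V = V)
      (hY : h.fieldProj Y = 0) :
      (hermitianConnection g J).torsion V ((hermitianConnection g J).torsion V Y)
        = -(f * g.fieldForm V V) • Y := by
    ext x
    rw [h.nearlyKahler.torsion_apply, h.nearlyKahler.torsion_apply]
    exact (h.isHolonomyPlane x).torsion_torsion (h.hasVerticalCurvature x)
      (DFunLike.congr_fun hV x) (DFunLike.congr_fun hY x)
  have hf : IsLocallyConstant f := f.isLocallyConstant fun x ↦ ContinuousLinearMap.ext fun w ↦ by
    obtain ⟨V, Y, hV, hY, hV₀, hY₀⟩ := h.exists_sections hE x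
    obtain ⟨X, rfl⟩ := SmoothVectorField.eval_surjective x w
    have key := DFunLike.congr_fun (Connection.lie_smul_eq_zero
      h.nearlyKahler.hermitianConnection_isMetric h.nearlyKahler.covDeriv₂_torsion_eq_zero
      h.hermitianConnection_preserves torsion_torsion X hV hY) x
    exact (smul_eq_zero.1 key).resolve_right (smul_ne_zero (g.pos x _ hV₀).ne' hY₀)
  have eq_comp : h.verticalCurvature = (4 * ·) ∘ f :=
    funext fun x ↦ (mul_div_cancel₀ (h.verticalCurvature x) four_ne_zero).symm
  exact eq_comp ▸ hf.comp _

end HasParallelPlane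

/-! ### The Kähler–Einstein structure -/

namespace HasParallelPlane

variable {E : Type*} [NormedAddCommGroup E] [NormedSpace ℝ E] [FiniteDimensional ℝ E]
  {M : Type*} [TopologicalSpace M] [ChartedSpace E M] [IsManifold 𝓘(ℝ, E) ∞ M]
  {g : Metric E M} {J : AlmostComplex E M} {L : Distribution E M} (h : HasParallelPlane g J L)

theorem reversedStructure_fieldMap_apply (Z : SmoothVectorField E M) (x : M) :
    reversedStructure J.fieldMap h.fieldProj Z x
      = reversedStructure (J x).toLinearMap (proj g L x) (Z x) := by
  rw [reversedStructure_apply, reversedStructure_apply, two_smul, two_smul]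
  rfl

variable [T2Space M]

/-- The metric which is `g` on the orthogonal complement of `L` and `2g` on `L`. -/
def modifiedMetric : Metric E M where
  inner x := g.inner x + (g.inner x).comp (LinearMap.toContinuousLinearMap (proj g L x))
  symm x v w := congrArg₂ (· + ·) (g.symm x v w)
    ((g.symm x (proj g L x v) w).trans (inner_proj w v).symm)
  pos x v hv := add_pos_of_pos_of_nonneg (g.pos x v hv) (inner_proj_self_nonneg v)
  isVonNBounded x := (g.isVonNBounded x).subset fun v hv ↦
    (le_add_of_nonneg_right (inner_proj_self_nonneg v)).trans_lt hv
  contMDiff := by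
    refine contMDiff_hom_of_apply (F₂ := E →L[ℝ] ℝ)
      (V₂ := fun x : M ↦ TangentSpace 𝓘(ℝ, E) x →L[ℝ] Bundle.Trivial M ℝ x) fun Z ↦
        contMDiff_hom_of_apply (F₂ := ℝ) (V₂ := Bundle.Trivial M ℝ) fun W x ↦ ?_
    exact contMDiffAt_totalSpace.2
      ⟨contMDiffAt_id, (g.fieldForm Z W + g.fieldForm (h.fieldProj Z) W).contMDiff x⟩

/-- The almost complex structure which is `J` on the orthogonal complement of `L` and `-J`
on `L`. -/
def reversed : AlmostComplex E M where
  toFun x := LinearMap.toContinuousLinearMap (reversedStructure (J x).toLinearMap (proj g L x))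
  smooth := by
    refine contMDiff_hom_of_apply fun Z ↦ ?_
    simpa only [LinearMap.coe_toContinuousLinearMap',
      reversedStructure_fieldMap_apply] using
      (reversedStructure J.fieldMap h.fieldProj Z).contMDiff
  sq x := by
    have := IsAddTorsionFree.of_isTorsionFree ℝ (TangentSpace 𝓘(ℝ, E) x)
    exact ((h.isHolonomyPlane x).isTwistorSplitting.isHermitianForm (h.isHolonomyPlane x).form).sq

theorem form_modifiedMetric (x : M) :
    h.modifiedMetric.form x = modifiedForm (g.form x) (proj g L x) :=
  LinearMap.ext₂ fun v w ↦ congrArg (g.inner x v w + ·) (inner_proj v w)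

theorem fieldForm_modifiedMetric :
    h.modifiedMetric.fieldForm = modifiedForm g.fieldForm h.fieldProj := by
  refine LinearMap.ext₂ fun X Y ↦ ?_
  ext x
  exact LinearMap.congr_fun₂ (h.form_modifiedMetric x) (X x) (Y x)

theorem fieldMap_reversed : h.reversed.fieldMap = reversedStructure J.fieldMap h.fieldProj := by
  refine LinearMap.ext fun Z ↦ ?_
  ext x
  exact (h.reversedStructure_fieldMap_apply Z x).symm

theorem isTwistorSplitting : IsTwistorSplitting g.fieldForm J.fieldMap
    (hermitianConnection g J).torsion h.fieldProj where
  idem X := by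
    ext x
    exact proj_proj (X x)
  symm X Y := by
    ext x
    exact inner_proj (X x) (Y x)
  map_J X := by
    ext x
    exact proj_map_J h.nearlyKahler.1 h.stable (X x)
  vertical X Y := by
    ext x
    exact (h.nearlyKahler.torsion_apply _ _ x).trans
      ((h.isHolonomyPlane x).isTwistorSplitting.vertical (X x) (Y x))
  map_horizontal X Y := by
    ext x
    refine (congrArg (proj g L x) (h.nearlyKahler.torsion_apply _ _ x)).trans ?_
    rw [h.nearlyKahler.torsion_apply]
    exact (h.isHolonomyPlane x).isTwistorSplitting.map_horizontal (X x) (Y x)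

theorem isAlmostHermitian : IsAlmostHermitian h.modifiedMetric h.reversed := by
  intro x
  have := IsAddTorsionFree.of_isTorsionFree ℝ (TangentSpace 𝓘(ℝ, E) x)
  have form := (h.isHolonomyPlane x).isTwistorSplitting.isHermitianForm (h.isHolonomyPlane x).form
  rw [← h.form_modifiedMetric] at form
  exact form.isometry

theorem connection_modifiedMetric :
    h.modifiedMetric.connection = (hermitianConnection g J).modified h.fieldProj := by
  refine (Metric.eq_connection ?_ ?_).symm
  · rw [fieldForm_modifiedMetric]
    exact Connection.modified_isMetric h.nearlyKahler.isTypeThreeZero_torsion h.isTwistorSplitting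
      h.hermitianConnection_preserves h.nearlyKahler.hermitianConnection_isMetric
  · exact Connection.modified_torsion h.nearlyKahler.isTypeThreeZero_torsion h.isTwistorSplitting

theorem connection_preserves : h.modifiedMetric.connection.Preserves h.reversed.fieldMap := by
  rw [connection_modifiedMetric, fieldMap_reversed]
  exact Connection.modified_preserves h.nearlyKahler.isTypeThreeZero_torsion h.isTwistorSplitting
    h.hermitianConnection_preserves (NearlyKahler.hermitianConnection_preserves g J)

theorem tensorAt_curvature_modifiedMetric (x : M) (u v w : TangentSpace 𝓘(ℝ, E) x) :
    SmoothVectorField.tensorAt h.modifiedMetric.connection.curvature x u v w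
      = SmoothVectorField.tensorAt (hermitianConnection g J).curvature x u v w
        + modifier (hermitianTorsionAt g J x) (proj g L x) (hermitianTorsionAt g J x u v) w
        + (modifier (hermitianTorsionAt g J x) (proj g L x) u
            (modifier (hermitianTorsionAt g J x) (proj g L x) v w)
          - modifier (hermitianTorsionAt g J x) (proj g L x) v
            (modifier (hermitianTorsionAt g J x) (proj g L x) u w)) := by
  have modifier_field (X Y : SmoothVectorField E M) :
      modifier (hermitianConnection g J).torsion h.fieldProj X Y x
        = modifier (hermitianTorsionAt g J x) (proj g L x) (X x) (Y x) := by
    rw [modifier_apply, modifier_apply]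
    change -(2⁻¹ : ℝ) • (hermitianConnection g J).torsion _ _ x = _
    rw [h.nearlyKahler.torsion_apply]
    rfl
  obtain ⟨X, rfl⟩ := SmoothVectorField.eval_surjective x u
  obtain ⟨Y, rfl⟩ := SmoothVectorField.eval_surjective x v
  obtain ⟨Z, rfl⟩ := SmoothVectorField.eval_surjective x w
  have key := DFunLike.congr_fun (Connection.modified_curvature h.hermitianConnection_preserves
    h.nearlyKahler.covDeriv₂_torsion_eq_zero X Y Z) x
  rw [← connection_modifiedMetric] at key
  simp only [SmoothVectorField.eval_apply, SmoothVectorField.tensorAt_apply,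
    ← h.nearlyKahler.torsion_apply, ← modifier_field]
  exact key

theorem isKahler : IsKahler h.modifiedMetric h.reversed :=
  isKahler_of_preserves h.isAlmostHermitian h.connection_preserves

theorem isEinstein {n : ℕ} (hn : Module.finrank ℝ E = 2 * n) (hE : Module.finrank ℝ E ≠ 2)
    {k : ℝ} (hk : ∀ x, h.verticalCurvature x = k) :
    IsEinstein h.modifiedMetric ((n + 1) / 4 * k) := by
  intro x u v
  have hS := isKahlerCurvature_tensorAt h.connection_preserves x
  rw [h.form_modifiedMetric] at hS
  have ricci := (h.isHolonomyPlane x).ricciTensor_eq hn (h.hasVerticalCurvature x)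
    (h.verticalCurvature_pos hE x).ne' hS (h.tensorAt_curvature_modifiedMetric x) u v
  rw [ricci_eq_ricciTensor, ricci, hk, ← h.form_modifiedMetric, Metric.form_apply]
  ring

theorem isModifiedMetric : IsModifiedMetric g h.modifiedMetric L := by
  have inner_eq {x : M} (v w : TangentSpace 𝓘(ℝ, E) x) : h.modifiedMetric.inner x v w
      = g.inner x v w + g.inner x (proj g L x v) w := rfl
  refine fun x ↦ ⟨fun v hv w _ ↦ ?_, fun v hv w _ ↦ ?_, fun v hv w hw ↦ ?_⟩
  · rw [inner_eq, proj_eq_zero_iff.2 hv, map_zero, zero_apply, add_zero]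
  · rw [inner_eq, proj_eq_self_iff.2 hv, two_mul]
  · rw [inner_eq, proj_eq_zero_iff.2 hv, map_zero, zero_apply, add_zero, g.symm]
    exact hv w hw

theorem isReversed : IsReversed g J h.reversed L := by
  refine fun x ↦ ⟨fun v hv ↦ ?_, fun v hv ↦ ?_⟩
  · refine (reversedStructure_apply (J x).toLinearMap (proj g L x) v).trans ?_
    rw [proj_eq_zero_iff.2 hv, map_zero, smul_zero, sub_zero]
    rfl
  · refine (reversedStructure_apply (J x).toLinearMap (proj g L x) v).trans ?_
    rw [proj_eq_self_iff.2 hv, ContinuousLinearMap.coe_coe]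
    module

end HasParallelPlane

theorem HasParallelPlane.finrank_ne_two_of_isStrict {E : Type*} [NormedAddCommGroup E]
    [NormedSpace ℝ E] [FiniteDimensional ℝ E] {M : Type*} [TopologicalSpace M] [ChartedSpace E M]
    [IsManifold 𝓘(ℝ, E) ∞ M] [T2Space M] [Nonempty M] {g : Metric E M} {J : AlmostComplex E M}
    {L : Distribution E M} (h : HasParallelPlane g J L) (hstrict : IsStrict g J) :
    Module.finrank ℝ E ≠ 2 := by
  intro hE
  obtain ⟨x⟩ := ‹Nonempty M›
  have top : L x = ⊤ := Submodule.eq_top_of_finrank_eq ((h.subbundle.1 x).trans hE.symm)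
  have proj_eq (v : TangentSpace 𝓘(ℝ, E) x) : proj g L x v = v :=
    proj_eq_self_iff.2 (top ▸ Submodule.mem_top)
  obtain ⟨v, -, hv⟩ := h.exists_ne_zero x
  refine hstrict x v hv (LinearMap.ext fun w ↦ ?_)
  rw [h.nearlyKahler.nablaJ_eq, (h.isHolonomyPlane x).torsion_vertical (proj_eq v) (proj_eq w),
    map_zero]
  rfl

end NearlyKahler

end

open NearlyKahler in
theorem lemma5p1_general {E : Type*} [NormedAddCommGroup E] [NormedSpace ℝ E]
    [FiniteDimensional ℝ E] {n : ℕ} (hn : Module.finrank ℝ E = 2 * n) (hE : Module.finrank ℝ E ≠ 2)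
    {M : Type*} [TopologicalSpace M] [ChartedSpace E M] [IsManifold 𝓘(ℝ, E) ∞ M]
    [T2Space M] [ConnectedSpace M] (g : Metric E M) (J : AlmostComplex E M)
    (hNK : IsNearlyKahler g J) (L : Distribution E M) (hrank : IsSubbundle L 2)
    (hJL : IsStable J L) (hparallel : IsParallel g J L)
    (hinj : ∀ x : M, ∀ u ∈ orthCompl g L x, torsionEndo g J L x u = 0 → u = 0) :
    ∃ k : ℝ, 0 < k ∧ (∀ x : M, ∀ u ∈ orthCompl g L x, torsionEndo g J L x u = (k / 4) • u) ∧
      ∃ (g' : Metric E M) (J' : AlmostComplex E M), IsModifiedMetric g g' L ∧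
        IsReversed g J J' L ∧ IsEinstein g' ((n + 1) / 4 * k) ∧ IsKahler g' J' := by
  have h : HasParallelPlane g J L := ⟨hNK, hrank, hJL, hparallel, hinj⟩
  obtain ⟨x₀⟩ := ‹ConnectedSpace M›.toNonempty
  have constant (x : M) : h.verticalCurvature x = h.verticalCurvature x₀ :=
    (h.isLocallyConstant_verticalCurvature hE).apply_eq_of_preconnectedSpace x x₀
  exact ⟨h.verticalCurvature x₀, h.verticalCurvature_pos hE x₀,
    fun x u hu ↦ constant x ▸ h.torsionEndo_eq hu, h.modifiedMetric, h.reversed,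
    h.isModifiedMetric, h.isReversed, h.isEinstein hn hE constant, h.isKahler⟩

theorem lemma5p1 {n : ℕ} {M : Type*} [TopologicalSpace M]
    [ChartedSpace (EuclideanSpace ℝ (Fin (2 * n))) M]
    [IsManifold 𝓘(ℝ, EuclideanSpace ℝ (Fin (2 * n))) ∞ M]
    [T2Space M] [SecondCountableTopology M] [ConnectedSpace M]
    (g : NearlyKahler.Metric (EuclideanSpace ℝ (Fin (2 * n))) M)
    (J : NearlyKahler.AlmostComplex (EuclideanSpace ℝ (Fin (2 * n))) M)
    (hNK : NearlyKahler.IsNearlyKahler g J)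
    (hstrict : NearlyKahler.IsStrict g J)
    (L : NearlyKahler.Distribution (EuclideanSpace ℝ (Fin (2 * n))) M)
    (hrank : NearlyKahler.IsSubbundle L 2)
    (hJL : NearlyKahler.IsStable J L)
    (hparallel : NearlyKahler.IsParallel g J L)
    (hinj : ∀ x : M, ∀ u ∈ NearlyKahler.orthCompl g L x,
      NearlyKahler.torsionEndo g J L x u = 0 → u = 0) :
    ∃ k : ℝ, 0 < k ∧
      (∀ x : M, ∀ u ∈ NearlyKahler.orthCompl g L x,
        NearlyKahler.torsionEndo g J L x u = (k / 4) • u) ∧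
      ∃ (g' : NearlyKahler.Metric (EuclideanSpace ℝ (Fin (2 * n))) M)
        (J' : NearlyKahler.AlmostComplex (EuclideanSpace ℝ (Fin (2 * n))) M),
        NearlyKahler.IsModifiedMetric g g' L ∧
        NearlyKahler.IsReversed g J J' L ∧
        NearlyKahler.IsEinstein g' ((n + 1) / 4 * k) ∧
        NearlyKahler.IsKahler g' J' := by
  have h : NearlyKahler.HasParallelPlane g J L := ⟨hNK, hrank, hJL, hparallel, hinj⟩
  exact lemma5p1_general finrank_euclideanSpace_fin (h.finrank_ne_two_of_isStrict hstrict) g J hNK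
    L hrank hJL hparallel hinj
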